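/- **Setting.** Let $f=\frac1n\sum_{i=1}^n f_i$ on $\mathbb R^d$, $d\ge 2$, with each $f_i$ differentiable, $f\ge f_{\min}$, and $f$ differentiable with $L$-Lipschitz gradient. Client $i$ has a stochastic gradient oracle: a query at $x$ draws a fresh independent sample and returns $\tilde\nabla f_i(x)$, where almost surely $x\mapsto\tilde\nabla f_i(x)$ is $\tilde L_i$-Lipschitz, $\mathbb E[\tilde\nabla f_i(x)]=\nabla f_i(x)$ and $\Pr(\|\tilde\nabla f_i(x)-\nabla f_i(x)\|\ge t)\le 2e^{-t^2/(2\sigma^2)}$ for all $x$ and all $t\ge0$; here $\sigma>0$ and $\sqrt{\frac1n\sum_i\tilde L_i^2}\le\tilde L$. Let $\mathcal C:\mathbb R^d\to\mathbb R^d$ be a (possibly random) $\mu$-compressor, $\mu\in(0,1]$: almost surely $\|x-\mathcal C(x)\|^2\le(1-\mu)\|x\|^2$ for all $x$. For an integer $p\ge 1$ put $\mathrm{FCC}_p(x)=\sum_{l=1}^p\mathcal C(v_l)$ with $v_1=x$, $v_l=x-\sum_{j<l}\mathcal C(v_j)$. **Algorithm (Power-EF).** Start from $x_0$ and $e^{(i)}_0=e^{(i)}_{-1}=g^{(i)}_{-1}=g_{-1}=0$.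 In iteration $t=0,\dots,T-1$ the server broadcasts $\xi_t\sim\mathcal N(0,\frac{r^2}{npd}I)$; each client $i$ averages $p$ oracle queries at $x_t$ to $\tilde\nabla_pf_i(x_t)$, forms $w^{(i)}_t=\mathrm{FCC}_p(e^{(i)}_t-e^{(i)}_{t-1})$, $c^{(i)}_t=\mathcal C(e^{(i)}_t+\tilde\nabla_pf_i(x_t)+\xi_t-g^{(i)}_{t-1}-w^{(i)}_t)$, $g^{(i)}_t=g^{(i)}_{t-1}+w^{(i)}_t+c^{(i)}_t$, $e^{(i)}_{t+1}=e^{(i)}_t+\tilde\nabla_pf_i(x_t)+\xi_t-g^{(i)}_t$, and sends the $p+1$ compressed messages that make up $w_t^{(i)}$ and $c_t^{(i)}$; the server sets $g_t=g_{t-1}+\frac1n\sum_i(w^{(i)}_t+c^{(i)}_t)$ and $x_{t+1}=x_t-\eta g_t$. All samples, perturbations and compressor seeds are mutually independent. **Parameters.** Let $r\ge0$, let $\Delta,\Phi>0$ satisfy $f(x_0)-f_{\min}\le\Delta$ and $\frac1n\sum_i\|\nabla f_i(x_0)\|^2+\tilde L\,(f(x_0)-f_{\min})\le\Phi$, and put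 $\chi^2=\sigma^2\log d+r^2$. For $\iota>0$, $\varepsilon>0$ and $\kappa_T,\kappa_\eta,\kappa_p>0$ take $$p=\kappa_p\frac1\mu\log\frac1\mu,\qquad \eta=\kappa_\eta\min\Big\{\frac{\mu\varepsilon}{L\sqrt{\mu\Phi+\chi^2\iota/(np)}},\frac{np\varepsilon^2}{\chi^2L}\Big\},\qquad T=\kappa_T\max\Big\{\frac{\Delta}{\eta\varepsilon^2},\frac{\chi^2\iota}{np\varepsilon^2}\Big\},$$ with $T$ rounded up to an integer and $p$ rounded up to a positive integer. **Claim.** There is a universal integer $k$ such that for all $L,\tilde L,\sigma,\Delta,\Phi,K>0$ and $r\ge0$ there is $M>0$ for which the following holds. For all $d\ge2$ and $\iota>0$ there are $\kappa_T,\kappa_\eta,\kappa_p>0$ such that, for all $n\ge1$, $\mu\in(0,1]$ and $0<\varepsilon\le K\sqrt\mu$, and for every problem, oracle, compressor and starting point as above, with probability at least $1-7e^{-\iota}$ at least $3/4$ of the iterates $x_0,\dots,x_T$ satisfy $\|\nabla f(x_t)\|\le\varepsilon$, while both the number of stochastic gradient queries made by each client and the number of compressed messages sent by each client (the communication rounds)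 during the $T$ iterations are at most $$M\,\big[(1+\log d)(1+\iota)(1+\log\tfrac1\mu)\big]^k\Big(\frac1{n\varepsilon^4}+\frac1{\mu^{1.5}\varepsilon^3}\Big)=\tilde O\Big(\frac1{n\varepsilon^4}+\frac1{\mu^{1.5}\varepsilon^3}\Big).$$ In particular the first term decreases linearly in the number of clients $n$, and no similarity of the $f_i$ is assumed. -/

import Mathlib

open MeasureTheory ProbabilityTheory
open scoped Gradient

universe u v w

noncomputable section

namespace PowerEF

/-- The model space `ℝ^d` with its Euclidean norm. -/
abbrev Vec (d : ℕ) : Type := EuclideanSpace ℝ (Fin d)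

/-! ### Objective functions -/

/-- The global objective `f = (1/n) ∑ i, f_i`. -/
def globalObjective {n d : ℕ} (f : Fin n → Vec d → ℝ) (x : Vec d) : ℝ :=
  (1 / (n : ℝ)) * ∑ i, f i x

/-- `F` is differentiable with `L`-Lipschitz gradient. -/
def IsSmooth {d : ℕ} (F : Vec d → ℝ) (L : ℝ) : Prop :=
  Differentiable ℝ F ∧ ∀ x y, ‖∇ F x - ∇ F y‖ ≤ L * ‖x - y‖

/-- `x` is an `ε`-optimal first-order stationary point of `F`. -/
def IsFOSP {d : ℕ} (F : Vec d → ℝ) (ε : ℝ) (x : Vec d) : Prop :=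
  ‖∇ F x‖ ≤ ε

/-! ### Stochastic gradient oracles and compressors -/

/-- A stochastic gradient oracle for the local objective `h`: a query at `x` draws a fresh sample
`s` with distribution `D` and returns `G x s`. The answers are Lipschitz in `x` (for almost every
sample), unbiased, and have norm-sub-Gaussian deviations from the true gradient. -/
structure IsStochasticGradient {d : ℕ} {S : Type u} [MeasurableSpace S] (D : Measure S)
    (G : Vec d → S → Vec d) (h : Vec d → ℝ) (lip σ : ℝ) : Prop where
  measurable : Measurable (Function.uncurry G)
  lipschitz : ∀ᵐ s ∂D, ∀ x y, ‖G x s - G y s‖ ≤ lip * ‖x - y‖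
  unbiased : ∀ x, ∫ s, G x s ∂D = ∇ h x
  tail : ∀ x, ∀ t : ℝ, 0 ≤ t →
    D.real {s | t ≤ ‖G x s - ∇ h x‖} ≤ 2 * Real.exp (-t ^ 2 / (2 * σ ^ 2))

/-- A possibly random mapping `C` (with internal randomness `z` of distribution `ν`) is a
`μ`-compressor. -/
structure IsCompressor {d : ℕ} {U : Type v} [MeasurableSpace U] (ν : Measure U)
    (C : U → Vec d → Vec d) (μ : ℝ) : Prop where
  measurable : Measurable (Function.uncurry C)
  contraction : ∀ᵐ z ∂ν, ∀ x, ‖x - C z x‖ ^ 2 ≤ (1 - μ) * ‖x‖ ^ 2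

/-! ### The sources of randomness -/

/-- Labels of the random draws: the `j`-th oracle query of client `i` in iteration `t`, the
perturbation of iteration `t`, and the `l`-th compression by client `i` in iteration `t`. -/
inductive Draw (n : ℕ) : Type
  | query (t : ℕ) (i : Fin n) (j : ℕ)
  | perturbation (t : ℕ)
  | compression (t : ℕ) (i : Fin n) (l : ℕ)

/-- The random draws consumed by a run of the algorithm: oracle samples of client `i` with law
`D i`, perturbations with law `N(0, v I)`, compressor seeds with law `ν`, all mutually
independent. -/
structure Randomness {Ω : Type w} [MeasurableSpace Ω] (P : Measure Ω) {S : Type u}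
    [MeasurableSpace S] {n : ℕ} (D : Fin n → Measure S) {U : Type v} [MeasurableSpace U]
    (ν : Measure U) (d : ℕ) (v : ℝ) where
  sample : ℕ → Fin n → ℕ → Ω → S
  xi : ℕ → Ω → Vec d
  seed : ℕ → Fin n → ℕ → Ω → U
  sample_law : ∀ t i j, HasLaw (sample t i j) (D i) P
  xi_law : ∀ t, HasLaw (xi t) (multivariateGaussian 0 (v • (1 : Matrix (Fin d) (Fin d) ℝ))) P
  seed_law : ∀ t i l, HasLaw (seed t i l) ν P
  sample_measurable : ∀ t i j, Measurable (sample t i j)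
  xi_measurable : ∀ t, Measurable (xi t)
  seed_measurable : ∀ t i l, Measurable (seed t i l)
  independent : iIndep (fun a : Draw n => match a with
    | Draw.query t i j => MeasurableSpace.comap (sample t i j) inferInstance
    | Draw.perturbation t => MeasurableSpace.comap (xi t) inferInstance
    | Draw.compression t i l => MeasurableSpace.comap (seed t i l) inferInstance) P

/-! ### The algorithm -/

/-- The messages `C(v_1), …, C(v_p)` of the fast compressed communication module on input `x`,
where `v_{k+1} = x - ∑ j ≤ k, C(v_j)`; the `k`-th call of the compressor is `c k`. The output of
the module is their sum. -/
def fccMessages {d : ℕ} (c : ℕ → Vec d → Vec d) (x : Vec d) : ℕ → List (Vec d)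
  | 0 => []
  | k + 1 => fccMessages c x k ++ [c k (x - (fccMessages c x k).sum)]

/-- The state before iteration `t`: the model `x_t`, the local errors `e_t^(i)` and
`e_{t-1}^(i)`, the local gradient estimates `g_{t-1}^(i)`, the server's estimate `g_{t-1}`, and,
for each client, the number of stochastic gradient queries it has made and the number of compressed
messages it has sent so far. -/
structure State (n d : ℕ) where
  model : Vec d
  err : Fin n → Vec d
  errPrev : Fin n → Vec d
  est : Fin n → Vec d
  serverEst : Vec d
  queries : Fin n → ℕ
  messages : Fin n → ℕ

/-- The initial state. -/
def State.init {d : ℕ} (n : ℕ) (x₀ : Vec d) : State n d where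
  model := x₀
  err := 0
  errPrev := 0
  est := 0
  serverEst := 0
  queries := 0
  messages := 0

/-- One iteration, with oracle samples `s i j`, perturbation `ξ` and compressor seeds `z i l`. -/
def step {n d : ℕ} {S : Type u} {U : Type v} (η : ℝ) (p : ℕ) (G : Fin n → Vec d → S → Vec d)
    (C : U → Vec d → Vec d) (s : Fin n → ℕ → S) (ξ : Vec d) (z : Fin n → ℕ → U)
    (st : State n d) : State n d :=
  let answers : Fin n → List (Vec d) := fun i => (List.range p).map fun j => G i st.model (s i j)
  let grad : Fin n → Vec d := fun i => (1 / (p : ℝ)) • (answers i).sum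
  let fcc : Fin n → List (Vec d) := fun i =>
    fccMessages (fun l => C (z i l)) (st.err i - st.errPrev i) p
  let fb : Fin n → Vec d := fun i => (fcc i).sum
  let cmp : Fin n → Vec d := fun i => C (z i p) (st.err i + grad i + ξ - st.est i - fb i)
  let est' : Fin n → Vec d := fun i => st.est i + fb i + cmp i
  let upload : Fin n → List (Vec d) := fun i => fcc i ++ [cmp i]
  let serverEst' : Vec d := st.serverEst + (1 / (n : ℝ)) • ∑ i, (upload i).sum
  { model := st.model - η • serverEst'
    err := fun i => st.err i + grad i + ξ - est' i
    errPrev := st.err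
    est := est'
    serverEst := serverEst'
    queries := fun i => st.queries i + (answers i).length
    messages := fun i => st.messages i + (upload i).length }

/-- The state after `t` iterations on the outcome `ω`. -/
def run {Ω : Type w} [MeasurableSpace Ω] {P : Measure Ω} {S : Type u} [MeasurableSpace S]
    {n d : ℕ} {D : Fin n → Measure S} {U : Type v} [MeasurableSpace U] {ν : Measure U} {v : ℝ}
    (R : Randomness P D ν d v) (η : ℝ) (p : ℕ) (G : Fin n → Vec d → S → Vec d)
    (C : U → Vec d → Vec d) (x₀ : Vec d) (ω : Ω) : ℕ → State n d
  | 0 => State.init n x₀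
  | t + 1 => step η p G C (fun i j => R.sample t i j ω) (R.xi t ω) (fun i l => R.seed t i l ω)
      (run R η p G C x₀ ω t)

/-! ### The choice of parameters -/

/-- The effective variance `χ² = σ² log d + r²` of stochastic gradient and perturbation. -/
def effectiveVariance (σ r : ℝ) (d : ℕ) : ℝ :=
  σ ^ 2 * Real.log d + r ^ 2

/-- `p = κ (1/μ) log (1/μ)`, rounded up to a positive integer. -/
def fccExponent (κ μ : ℝ) : ℕ :=
  max 1 ⌈κ * (1 / μ) * Real.log (1 / μ)⌉₊

/-- `η = κ min {μ ε / (L √(μ Φ + χ² ι / (n p))), n p ε² / (χ² L)}`. -/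
def stepSize (κ L Φ χsq ι μ ε : ℝ) (n p : ℕ) : ℝ :=
  κ * min (μ * ε / (L * √(μ * Φ + χsq * ι / (n * p)))) (n * p * ε ^ 2 / (χsq * L))

/-- `T = κ max {Δ / (η ε²), χ² ι / (n p ε²)}`, rounded up. -/
def horizon (κ Δ η χsq ι ε : ℝ) (n p : ℕ) : ℕ :=
  ⌈κ * max (Δ / (η * ε ^ 2)) (χsq * ι / (n * p * ε ^ 2))⌉₊

end PowerEF

end

/-! Write $a^{(i)}_t$ for client $i$'s perturbed gradient estimate. Unrolling the algorithm gives
$g^{(i)}_t=e^{(i)}_t+a^{(i)}_t-e^{(i)}_{t+1}$. Hence the vector fed to the last compressor is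
$e_t+(a_t-a_{t-1})+\delta_t$, where $\delta_t$ is what the $p$ fast rounds lose of $e_t-e_{t-1}$
(`run_err_sq_le`). The errors are therefore driven by increments of the gradient estimates and not
by the gradients themselves, which is why no similarity of the clients is needed. As
$p\gtrsim\mu^{-1}\log\mu^{-1}$, $\delta_t$ is negligible (`fcc_contraction_le`), and `sum_error_le`
gives $\sum\|e_t\|^2\le 24\mu^{-2}\sum\|a_t-a_{t-1}\|^2$. The increments are bounded by Lipschitz
continuity through $\|x_{t+1}-x_t\|$, up to noise; only the first one contains whole gradients, and
it is paid for by $\Phi$.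

The virtual iterates $y_t=x_t-\eta\bar e_t$ satisfy $y_{t+1}=y_t-\eta\bar a_t$, where the bar is the
mean over clients: compression disappears. Descent of $f$ along $y_t$, with the Lipschitz cost of
replacing $x_t$ by $y_t$, bounds $\sum\|\nabla f(x_t)\|^2$ by the initial gap, a martingale and sums
of squared noise (`sum_norm_gradient_sq_le`). This part is pathwise.

Probability enters through three sums: the martingale $\sum\langle-\nabla f(y_t),\bar v_t\rangle$,
the squared mean noise and the averaged squared client noise. Each exceeds its bound with
probability at most $e^{-\iota}$. The sub-Gaussian hypotheses are recast as exponential moments of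
$\|X\|^2$, which bounds sums of conditionally centred vectors without dimensional loss
(`lintegral_exp_norm_sq_sum_le`); a Chernoff argument over time then concludes
(`measure_sum_ge_le_of_cond`). Averaging over $np$ samples yields the linear gain in $n$.

With the chosen parameters the bound is at most a quarter of $\varepsilon^2(T+1)$
(`error_budget_le`), so Markov's inequality for counting makes three quarters of the iterates
stationary. The cost $T(p+1)$ is estimated in `rounds_le`: the two branches of $\eta$ produce the
two terms of the rate. -/

noncomputable section

namespace PowerEF

open scoped ENNReal RealInnerProductSpace

/-! ### Exponential moments of a single norm-sub-Gaussian vector -/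

section ExponentialMoments

/-- The exponential of a real number, as an extended nonnegative real. -/
def expE (x : ℝ) : ℝ≥0∞ := ENNReal.ofReal (Real.exp x)

lemma expE_add (x y : ℝ) : expE (x + y) = expE x * expE y := by
  rw [expE, Real.exp_add, ENNReal.ofReal_mul (Real.exp_nonneg x)]; rfl

lemma expE_mono {x y : ℝ} (h : x ≤ y) : expE x ≤ expE y :=
  ENNReal.ofReal_le_ofReal (Real.exp_le_exp.2 h)

lemma expE_zero : expE 0 = 1 := by simp [expE]

lemma expE_ne_top (x : ℝ) : expE x ≠ ∞ := ENNReal.ofReal_ne_top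

lemma measurable_expE : Measurable expE :=
  ENNReal.measurable_ofReal.comp Real.measurable_exp

/-- `2 (1 + t)⁻³` has integral one over the half line. -/
lemma lintegral_two_mul_inv_cube :
    ∫⁻ t in Set.Ioi (0 : ℝ), ENNReal.ofReal (2 * ((1 + t) ^ 3)⁻¹) = 1 := by
  have hd : ∀ x ∈ Set.Ici (0 : ℝ),
      HasDerivAt (fun t : ℝ => -((1 + t) ^ 2)⁻¹) (2 * ((1 + x) ^ 3)⁻¹) x := by
    intro x hx
    have hx' : (1 + x) ≠ 0 := by have : (0 : ℝ) ≤ x := hx; positivity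
    have h1 : HasDerivAt (fun t : ℝ => (1 + t) ^ 2) (2 * (1 + x)) x := by
      have h := ((hasDerivAt_id x).const_add 1).fun_pow 2
      simpa using h
    have h2 := (h1.inv (pow_ne_zero 2 hx')).neg
    refine h2.congr_deriv ?_
    field_simp
  have hpos : ∀ x ∈ Set.Ioi (0 : ℝ), 0 ≤ 2 * ((1 + x) ^ 3)⁻¹ := by
    intro x hx
    have : (0 : ℝ) < x := hx
    positivity
  have hlim : Filter.Tendsto (fun t : ℝ => -((1 + t) ^ 2)⁻¹) Filter.atTop (nhds 0) := by
    rw [← neg_zero]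
    refine Filter.Tendsto.neg (Filter.Tendsto.inv_tendsto_atTop ?_)
    exact (Filter.tendsto_pow_atTop two_ne_zero).comp
      (Filter.tendsto_atTop_add_const_left _ _ Filter.tendsto_id)
  have hi := integrableOn_Ioi_deriv_of_nonneg' hd hpos hlim
  have he := integral_Ioi_of_hasDerivAt_of_nonneg' hd hpos hlim
  rw [← ofReal_integral_eq_lintegral_ofReal hi
    ((ae_restrict_iff' measurableSet_Ioi).2 (Filter.Eventually.of_forall hpos)), he]
  simp

/-- A sub-Gaussian tail bounds an exponential moment of the square. -/
lemma lintegral_exp_sq_le_two_of_tail {α : Type*} [MeasurableSpace α] (ρ : Measure α)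
    [IsProbabilityMeasure ρ] {Y : α → ℝ} (hY : Measurable Y) (h0 : ∀ a, 0 ≤ Y a) {v : ℝ}
    (hv : 0 < v)
    (tail : ∀ t : ℝ, 0 ≤ t → ρ.real {a | t ≤ Y a} ≤ 2 * Real.exp (-t ^ 2 / (2 * v))) :
    ∫⁻ a, expE (Y a ^ 2 / (6 * v)) ∂ρ ≤ 2 := by
  set f : α → ℝ := fun a => Real.exp (Y a ^ 2 / (6 * v)) - 1 with hf
  have hfm : Measurable f := by fun_prop
  have hf0 : ∀ a, 0 ≤ f a := fun a => by
    have : 0 ≤ Y a ^ 2 / (6 * v) := by positivity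
    simpa [hf] using this
  have h1 : ∫⁻ a, ENNReal.ofReal (f a) ∂ρ ≤ 1 := by
    rw [lintegral_eq_lintegral_meas_le ρ (Filter.Eventually.of_forall hf0) hfm.aemeasurable,
      ← lintegral_two_mul_inv_cube]
    refine setLIntegral_mono (by fun_prop) fun t ht => ?_
    have ht : 0 < t := ht
    have hl : 0 < Real.log (1 + t) := Real.log_pos (by linarith)
    -- The factor 6 makes the tail at this threshold equal to $2(1+t)^{-3}$, whose integral is
    -- exactly 1.
    have hsub : {a | t ≤ f a} ⊆ {a | √(6 * v * Real.log (1 + t)) ≤ Y a} := by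
      intro a ha
      have ha : t ≤ Real.exp (Y a ^ 2 / (6 * v)) - 1 := ha
      refine Real.sqrt_le_iff.2 ⟨h0 a, ?_⟩
      have h3 : Real.log (1 + t) ≤ Y a ^ 2 / (6 * v) :=
        (Real.log_le_iff_le_exp (by linarith)).2 (by linarith)
      rw [le_div_iff₀ (by positivity)] at h3
      linarith
    have h4 := tail _ (Real.sqrt_nonneg (6 * v * Real.log (1 + t)))
    rw [Real.sq_sqrt (by positivity)] at h4
    have h5 : Real.exp (-(6 * v * Real.log (1 + t)) / (2 * v)) = ((1 + t) ^ 3)⁻¹ := by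
      have : -(6 * v * Real.log (1 + t)) / (2 * v) = -((3 : ℕ) * Real.log (1 + t)) := by
        field_simp; push_cast; ring
      rw [this, Real.exp_neg, Real.exp_nat_mul, Real.exp_log (by linarith)]
    rw [h5] at h4
    calc ρ {a | t ≤ f a} ≤ ρ {a | √(6 * v * Real.log (1 + t)) ≤ Y a} := measure_mono hsub
      _ = ENNReal.ofReal (ρ.real {a | √(6 * v * Real.log (1 + t)) ≤ Y a}) := by simp
      _ ≤ _ := ENNReal.ofReal_le_ofReal h4
  calc ∫⁻ a, expE (Y a ^ 2 / (6 * v)) ∂ρ = ∫⁻ a, (ENNReal.ofReal (f a) + 1) ∂ρ := by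
        refine lintegral_congr fun a => ?_
        rw [← ENNReal.ofReal_one, ← ENNReal.ofReal_add (hf0 a) zero_le_one]
        simp [hf, expE]
    _ = ∫⁻ a, ENNReal.ofReal (f a) ∂ρ + 1 := by
        rw [lintegral_add_right _ measurable_const]; simp
    _ ≤ 1 + 1 := by gcongr
    _ = 2 := one_add_one_eq_two

/-- The linear term vanishes in expectation for a centred variable, which leaves a moment of the
square. For $|z|\le1$ the second-order Taylor bound suffices; for larger $|z|$ compare directly. -/
lemma exp_le_add_exp_sq (z : ℝ) : Real.exp z ≤ z + Real.exp (z ^ 2) := by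
  have h1 := Real.add_one_le_exp (z ^ 2)
  rcases le_or_gt |z| 1 with h | h
  · have := (abs_le.1 (Real.abs_exp_sub_one_sub_id_le h)).2
    linarith
  · rcases lt_abs.1 h with h | h
    · have : Real.exp z ≤ Real.exp (z ^ 2) := Real.exp_le_exp.2 (by nlinarith)
      linarith
    · have : Real.exp z ≤ 1 := Real.exp_le_one_iff.2 (by linarith)
      nlinarith

variable {E : Type*} [NormedAddCommGroup E] [InnerProductSpace ℝ E] [CompleteSpace E]
  [MeasurableSpace E] [BorelSpace E]

/-- A centred random vector whose squared norm, divided by `τ`, has a bounded exponential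
moment. -/
structure NormSubG {α : Type*} [MeasurableSpace α] (ρ : Measure α) (X : α → E) (τ : ℝ) :
    Prop where
  pos : 0 < τ
  measurable : Measurable X
  integrable : Integrable X ρ
  mean : ∫ a, X a ∂ρ = 0
  moment : ∫⁻ a, expE (‖X a‖ ^ 2 / τ) ∂ρ ≤ 2

/-- Jensen's inequality for powers of exponential moments. -/
lemma lintegral_exp_mul_le {α : Type*} [MeasurableSpace α] {ρ : Measure α}
    [IsProbabilityMeasure ρ] {Y : α → ℝ} (hY : Measurable Y) (h : ∫⁻ a, expE (Y a) ∂ρ ≤ 2)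
    {s : ℝ} (hs : 0 ≤ s) (hs1 : s ≤ 1) : ∫⁻ a, expE (s * Y a) ∂ρ ≤ expE (s * Real.log 2) := by
  -- Convexity between $Y-\log 2$ and $0$; the shift by $\log 2$ makes the integrated bracket equal
  -- to 1.
  have key : ∀ a, expE (s * Y a) ≤
      expE (s * Real.log 2) * (ENNReal.ofReal (s / 2) * expE (Y a) + ENNReal.ofReal (1 - s)) := by
    intro a
    have hb := convexOn_exp.2 (Set.mem_univ (Y a - Real.log 2)) (Set.mem_univ 0) hs
      (sub_nonneg.2 hs1) (by ring)
    simp only [smul_eq_mul, mul_zero, add_zero, Real.exp_zero, mul_one, Real.exp_sub,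
      Real.exp_log (two_pos : (0:ℝ) < 2)] at hb
    unfold expE
    rw [← ENNReal.ofReal_mul (by positivity), ← ENNReal.ofReal_add (by positivity) (by linarith),
      ← ENNReal.ofReal_mul (by positivity)]
    refine ENNReal.ofReal_le_ofReal ?_
    have : s * Y a = s * Real.log 2 + s * (Y a - Real.log 2) := by ring
    rw [this, Real.exp_add]
    gcongr
    linarith
  have hm : Measurable fun a => expE (Y a) := measurable_expE.comp hY
  calc ∫⁻ a, expE (s * Y a) ∂ρ ≤ ∫⁻ a, expE (s * Real.log 2) *
        (ENNReal.ofReal (s / 2) * expE (Y a) + ENNReal.ofReal (1 - s)) ∂ρ := lintegral_mono key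
    _ = expE (s * Real.log 2) * (ENNReal.ofReal (s / 2) * ∫⁻ a, expE (Y a) ∂ρ +
          ENNReal.ofReal (1 - s)) := by
        rw [lintegral_const_mul _ (by fun_prop), lintegral_add_right _ measurable_const,
          lintegral_const_mul _ hm]
        simp
    _ ≤ expE (s * Real.log 2) * (ENNReal.ofReal (s / 2) * 2 + ENNReal.ofReal (1 - s)) := by
        gcongr
    _ = expE (s * Real.log 2) := by
        have h2 : (2 : ℝ≥0∞) = ENNReal.ofReal 2 := by simp
        rw [h2, ← ENNReal.ofReal_mul (by positivity),
          ← ENNReal.ofReal_add (by positivity) (by linarith)]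
        have : s / 2 * 2 + (1 - s) = 1 := by ring
        rw [this, ENNReal.ofReal_one, mul_one]

omit [CompleteSpace E] in
lemma NormSubG.lintegral_exp_norm_sq {α : Type*} [MeasurableSpace α] {ρ : Measure α}
    [IsProbabilityMeasure ρ] {X : α → E} {τ : ℝ} (h : NormSubG ρ X τ) {l : ℝ} (hl : 0 ≤ l)
    (hl1 : l * τ ≤ 1) : ∫⁻ a, expE (l * ‖X a‖ ^ 2) ∂ρ ≤ expE (l * τ) := by
  have hτ := h.pos
  have hm : Measurable fun a => ‖X a‖ ^ 2 / τ := (h.measurable.norm.pow_const 2).div_const τ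
  have := lintegral_exp_mul_le hm h.moment (s := l * τ) (by positivity) hl1
  calc ∫⁻ a, expE (l * ‖X a‖ ^ 2) ∂ρ = ∫⁻ a, expE (l * τ * (‖X a‖ ^ 2 / τ)) ∂ρ := by
        refine lintegral_congr fun a => ?_
        congr 1; field_simp
    _ ≤ expE (l * τ * Real.log 2) := this
    _ ≤ expE (l * τ) := expE_mono (by
        have := Real.log_two_lt_d9
        have : 0 ≤ l * τ := by positivity
        nlinarith)

/-- Two regimes. For $\|u\|^2\tau\le1$ centring removes the first-order term and the square has a
controlled moment. For larger $u$ centring is not needed: Young's inequality with weight $\tau$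
already gives the right order. -/
lemma NormSubG.lintegral_exp_inner {α : Type*} [MeasurableSpace α] {ρ : Measure α}
    [IsProbabilityMeasure ρ] {X : α → E} {τ : ℝ} (h : NormSubG ρ X τ) (u : E) :
    ∫⁻ a, expE (⟪u, X a⟫) ∂ρ ≤ expE (τ * ‖u‖ ^ 2) := by
  have hτ := h.pos
  have hXn : Measurable fun a => ‖X a‖ := h.measurable.norm
  have hin : ∀ a, ⟪u, X a⟫ ≤ ‖u‖ * ‖X a‖ := fun a => real_inner_le_norm _ _
  rcases le_or_gt (‖u‖ ^ 2 * τ) 1 with hu | hu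
  · have hb := h.lintegral_exp_norm_sq (sq_nonneg ‖u‖) hu
    have hmeas : Measurable fun a => Real.exp (‖u‖ ^ 2 * ‖X a‖ ^ 2) := by fun_prop
    have hint : Integrable (fun a => Real.exp (‖u‖ ^ 2 * ‖X a‖ ^ 2)) ρ := by
      refine ⟨hmeas.aestronglyMeasurable, ?_⟩
      rw [hasFiniteIntegral_iff_ofReal (Filter.Eventually.of_forall fun a => Real.exp_nonneg _)]
      exact hb.trans_lt ENNReal.ofReal_lt_top
    have hi : Integrable (fun a => ⟪u, X a⟫) ρ := h.integrable.const_inner u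
    have h0 : ∫ a, ⟪u, X a⟫ ∂ρ = 0 := by rw [integral_inner h.integrable, h.mean, inner_zero_right]
    have hle : ∀ a, Real.exp ⟪u, X a⟫ ≤ ⟪u, X a⟫ + Real.exp (‖u‖ ^ 2 * ‖X a‖ ^ 2) := by
      intro a
      refine (exp_le_add_exp_sq _).trans ?_
      have : ⟪u, X a⟫ ^ 2 ≤ ‖u‖ ^ 2 * ‖X a‖ ^ 2 := by
        rw [← mul_pow, ← sq_abs]
        exact pow_le_pow_left₀ (abs_nonneg _) (abs_real_inner_le_norm _ _) 2
      linarith [Real.exp_le_exp.2 this]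
    calc ∫⁻ a, expE (⟪u, X a⟫) ∂ρ
        ≤ ∫⁻ a, ENNReal.ofReal (⟪u, X a⟫ + Real.exp (‖u‖ ^ 2 * ‖X a‖ ^ 2)) ∂ρ :=
          lintegral_mono fun a => ENNReal.ofReal_le_ofReal (hle a)
      _ = ENNReal.ofReal (∫ a, (⟪u, X a⟫ + Real.exp (‖u‖ ^ 2 * ‖X a‖ ^ 2)) ∂ρ) :=
          (ofReal_integral_eq_lintegral_ofReal (hi.add hint) (Filter.Eventually.of_forall
            fun a => (Real.exp_nonneg _).trans (hle a))).symm
      _ = ENNReal.ofReal (∫ a, Real.exp (‖u‖ ^ 2 * ‖X a‖ ^ 2) ∂ρ) := by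
          rw [integral_add hi hint, h0, zero_add]
      _ = ∫⁻ a, expE (‖u‖ ^ 2 * ‖X a‖ ^ 2) ∂ρ :=
          ofReal_integral_eq_lintegral_ofReal hint (Filter.Eventually.of_forall
            fun a => Real.exp_nonneg _)
      _ ≤ expE (τ * ‖u‖ ^ 2) := by rwa [mul_comm τ]
  · have hb := h.lintegral_exp_norm_sq (l := 1 / (2 * τ)) (by positivity) (by
      rw [div_mul_eq_mul_div, one_mul, div_le_one (by positivity)]; linarith)
    calc ∫⁻ a, expE (⟪u, X a⟫) ∂ρ
        ≤ ∫⁻ a, expE (τ * ‖u‖ ^ 2 / 2) * expE (1 / (2 * τ) * ‖X a‖ ^ 2) ∂ρ := by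
          refine lintegral_mono fun a => ?_
          rw [← expE_add]
          refine expE_mono ((hin a).trans ?_)
          have h1 : 0 ≤ (τ * ‖u‖ - ‖X a‖) ^ 2 / (2 * τ) := by positivity
          have h2 : (τ * ‖u‖ - ‖X a‖) ^ 2 / (2 * τ) =
            τ * ‖u‖ ^ 2 / 2 + 1 / (2 * τ) * ‖X a‖ ^ 2 - ‖u‖ * ‖X a‖ := by field_simp; ring
          linarith
      _ = expE (τ * ‖u‖ ^ 2 / 2) * ∫⁻ a, expE (1 / (2 * τ) * ‖X a‖ ^ 2) ∂ρ :=
          lintegral_const_mul _ (measurable_expE.comp (by fun_prop))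
      _ ≤ expE (τ * ‖u‖ ^ 2 / 2) * expE (1 / (2 * τ) * τ) := by gcongr
      _ ≤ expE (τ * ‖u‖ ^ 2) := by
          rw [← expE_add]
          refine expE_mono ?_
          have : 1 / (2 * τ) * τ = 1 / 2 := by field_simp
          nlinarith

/-- The joint exponential moment of a linear functional and the squared norm. -/
lemma NormSubG.lintegral_exp {α : Type*} [MeasurableSpace α] {ρ : Measure α}
    [IsProbabilityMeasure ρ] {X : α → E} {τ : ℝ} (h : NormSubG ρ X τ) (u : E) {l : ℝ}
    (hl : 0 ≤ l) (hl1 : 2 * l * τ ≤ 1) :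
    ∫⁻ a, expE (⟪u, X a⟫ + l * ‖X a‖ ^ 2) ∂ρ ≤ expE (2 * τ * ‖u‖ ^ 2 + l * τ) := by
  have hXn : Measurable fun a => ‖X a‖ := h.measurable.norm
  have hi : Measurable fun a => ⟪(2 : ℝ) • u, X a⟫ :=
    (innerSL ℝ ((2 : ℝ) • u)).continuous.measurable.comp h.measurable
  have h1 := h.lintegral_exp_inner ((2 : ℝ) • u)
  have h2 := h.lintegral_exp_norm_sq (l := 2 * l) (by positivity) hl1
  set A := 2 * τ * ‖u‖ ^ 2 with hA
  set B := l * τ with hB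
  have hA2 : τ * ‖(2 : ℝ) • u‖ ^ 2 = 2 * A := by rw [norm_smul, hA]; norm_num; ring
  have hB2 : 2 * l * τ = 2 * B := by rw [hB]; ring
  rw [hA2] at h1
  rw [hB2] at h2
  -- A Cauchy–Schwarz step by midpoint convexity of `exp`; the shifts $\pm(B-A)$ balance the two
  -- halves, so that each integrates to at most $e^{A+B}$.
  have key : ∀ a, expE (⟪u, X a⟫ + l * ‖X a‖ ^ 2) ≤ ENNReal.ofReal (1 / 2) *
      (expE (B - A) * expE (⟪(2 : ℝ) • u, X a⟫) + expE (A - B) * expE (2 * l * ‖X a‖ ^ 2)) := by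
    intro a
    have hb := convexOn_exp.2 (Set.mem_univ (B - A + ⟪(2 : ℝ) • u, X a⟫))
      (Set.mem_univ (A - B + 2 * l * ‖X a‖ ^ 2)) 
      (one_half_pos (α := ℝ)).le (one_half_pos (α := ℝ)).le (by norm_num)
    simp only [smul_eq_mul] at hb
    rw [← expE_add, ← expE_add]
    unfold expE
    rw [← ENNReal.ofReal_add (by positivity) (by positivity), ← ENNReal.ofReal_mul (by norm_num)]
    refine ENNReal.ofReal_le_ofReal ?_
    rw [mul_add]
    have e : ⟪u, X a⟫ + l * ‖X a‖ ^ 2 = 1 / 2 * (B - A + ⟪(2 : ℝ) • u, X a⟫) +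
        1 / 2 * (A - B + 2 * l * ‖X a‖ ^ 2) := by
      rw [real_inner_smul_left]; ring
    rw [e]
    exact hb
  calc ∫⁻ a, expE (⟪u, X a⟫ + l * ‖X a‖ ^ 2) ∂ρ
      ≤ ∫⁻ a, ENNReal.ofReal (1 / 2) * (expE (B - A) * expE (⟪(2 : ℝ) • u, X a⟫) +
          expE (A - B) * expE (2 * l * ‖X a‖ ^ 2)) ∂ρ := lintegral_mono key
    _ = ENNReal.ofReal (1 / 2) * (expE (B - A) * ∫⁻ a, expE (⟪(2 : ℝ) • u, X a⟫) ∂ρ +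
          expE (A - B) * ∫⁻ a, expE (2 * l * ‖X a‖ ^ 2) ∂ρ) := by
        have m1 : Measurable fun a => expE (⟪(2 : ℝ) • u, X a⟫) := measurable_expE.comp hi
        have m2 : Measurable fun a => expE (2 * l * ‖X a‖ ^ 2) :=
          measurable_expE.comp (by fun_prop)
        have n1 : Measurable fun a => expE (B - A) * expE (⟪(2 : ℝ) • u, X a⟫) := m1.const_mul _
        have n2 : Measurable fun a => expE (A - B) * expE (2 * l * ‖X a‖ ^ 2) := m2.const_mul _
        rw [lintegral_const_mul' _ _ ENNReal.ofReal_ne_top, lintegral_add_left n1,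
          lintegral_const_mul _ m1, lintegral_const_mul _ m2]
    _ ≤ ENNReal.ofReal (1 / 2) * (expE (B - A) * expE (2 * A) + expE (A - B) * expE (2 * B)) := by
        gcongr
    _ = expE (A + B) := by
        rw [← expE_add, ← expE_add]
        have e1 : B - A + 2 * A = A + B := by ring
        have e2 : A - B + 2 * B = A + B := by ring
        rw [e1, e2, ← two_mul, ← mul_assoc]
        have : ENNReal.ofReal (1 / 2) * 2 = 1 := by
          have h2 : (2 : ℝ≥0∞) = ENNReal.ofReal 2 := by simp
          rw [h2, ← ENNReal.ofReal_mul (by norm_num)]; norm_num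
        rw [this, one_mul]

end ExponentialMoments

/-! ### Sums of conditionally sub-Gaussian vectors and a Chernoff bound -/

section Conditional

variable {E : Type*} [NormedAddCommGroup E] [InnerProductSpace ℝ E] [CompleteSpace E]
  [MeasurableSpace E] [BorelSpace E] [SecondCountableTopology E]
  {Ω : Type*}

/-- Conditionally on `𝓖`, the random vector `X` is centred and norm-sub-Gaussian. The bound on the
conditional exponential moments is expressed by integrating against `𝓖`-measurable weights. -/
def CondSubG {mΩ : MeasurableSpace Ω} (P : Measure Ω) (𝓖 : MeasurableSpace Ω) (X : Ω → E) (τ : ℝ) : Prop :=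
  ∀ (W : Ω → ℝ≥0∞) (u : Ω → E), Measurable[𝓖] W → Measurable[𝓖] u →
    ∀ l : ℝ, 0 ≤ l → 2 * l * τ ≤ 1 →
      ∫⁻ ω, W ω * expE (⟪u ω, X ω⟫ + l * ‖X ω‖ ^ 2) ∂P ≤
        ∫⁻ ω, W ω * expE (2 * τ * ‖u ω‖ ^ 2 + l * τ) ∂P

/-- A norm-sub-Gaussian function of fresh randomness, with a parameter from the past. -/
lemma condSubG_of_indep {𝓖 mΩ : MeasurableSpace Ω} {P : Measure Ω} [IsProbabilityMeasure P]
    (h𝓖 : 𝓖 ≤ mΩ) {β γ : Type*} [MeasurableSpace β] [MeasurableSpace γ] {Y : Ω → β}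
    {ρ : Measure β} [IsProbabilityMeasure ρ] (hlaw : HasLaw Y ρ P) (hYm : Measurable Y)
    (hind : Indep 𝓖 (MeasurableSpace.comap Y inferInstance) P) {H : Ω → γ}
    (hH : Measurable[𝓖] H) {F : γ → β → E} (hF : Measurable (Function.uncurry F)) {τ : ℝ}
    (hsub : ∀ h, NormSubG ρ (F h) τ) : CondSubG P 𝓖 (fun ω => F (H ω) (Y ω)) τ := by
  intro W u hW hu l hl hl1
  -- By independence, the weight, direction and parameter from the past have a product law jointly
  -- with the fresh draw. Tonelli then reduces the claim to the unconditional bound with these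
  -- frozen.
  have hK𝓖 : Measurable[𝓖] fun ω => (W ω, u ω, H ω) := hW.prodMk (hu.prodMk hH)
  have hK : Measurable fun ω => (W ω, u ω, H ω) := hK𝓖.mono h𝓖 le_rfl
  have hIF : IndepFun (fun ω => (W ω, u ω, H ω)) Y P :=
    indep_of_indep_of_le_left hind hK𝓖.comap_le
  have hprod := (indepFun_iff_map_prod_eq_prod_map_map hK.aemeasurable hYm.aemeasurable).1 hIF
  rw [hlaw.map_eq] at hprod
  have hFq : Measurable fun q : (ℝ≥0∞ × E × γ) × β => F q.1.2.2 q.2 :=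
    hF.comp (measurable_fst.snd.snd.prodMk measurable_snd)
  have hΨ : Measurable fun q : (ℝ≥0∞ × E × γ) × β =>
      q.1.1 * expE (⟪q.1.2.1, F q.1.2.2 q.2⟫ + l * ‖F q.1.2.2 q.2‖ ^ 2) :=
    measurable_fst.fst.mul (measurable_expE.comp
      ((measurable_fst.snd.fst.inner hFq).add ((hFq.norm.pow_const 2).const_mul l)))
  have hΞ : Measurable fun k : ℝ≥0∞ × E × γ => k.1 * expE (2 * τ * ‖k.2.1‖ ^ 2 + l * τ) :=
    measurable_fst.mul (measurable_expE.comp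
      (((measurable_snd.fst.norm.pow_const 2).const_mul _).add_const _))
  calc ∫⁻ ω, W ω * expE (⟪u ω, F (H ω) (Y ω)⟫ + l * ‖F (H ω) (Y ω)‖ ^ 2) ∂P
      = ∫⁻ q : (ℝ≥0∞ × E × γ) × β, q.1.1 * expE (⟪q.1.2.1, F q.1.2.2 q.2⟫ +
          l * ‖F q.1.2.2 q.2‖ ^ 2) ∂(P.map fun ω => ((W ω, u ω, H ω), Y ω)) := by
        rw [lintegral_map hΨ (hK.prodMk hYm)]
    _ = ∫⁻ k, ∫⁻ y, k.1 * expE (⟪k.2.1, F k.2.2 y⟫ + l * ‖F k.2.2 y‖ ^ 2) ∂ρ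
          ∂(P.map fun ω => (W ω, u ω, H ω)) := by
        rw [hprod, lintegral_prod _ hΨ.aemeasurable]
    _ ≤ ∫⁻ k, k.1 * expE (2 * τ * ‖k.2.1‖ ^ 2 + l * τ) ∂(P.map fun ω => (W ω, u ω, H ω)) := by
        refine lintegral_mono fun k => ?_
        have hm := (hsub k.2.2).measurable
        have hme : Measurable fun y => expE (⟪k.2.1, F k.2.2 y⟫ + l * ‖F k.2.2 y‖ ^ 2) :=
          measurable_expE.comp ((measurable_const.inner hm).add ((hm.norm.pow_const 2).const_mul l))
        rw [lintegral_const_mul _ hme]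
        gcongr
        exact (hsub k.2.2).lintegral_exp k.2.1 hl hl1
    _ = ∫⁻ ω, W ω * expE (2 * τ * ‖u ω‖ ^ 2 + l * τ) ∂P := lintegral_map hΞ hK

-- A past-measurable exponent can be absorbed into the weight; this lets summands be peeled off one
-- at a time.
omit [CompleteSpace E] [BorelSpace E] [SecondCountableTopology E] in
lemma CondSubG.add_const_weight {𝓖 mΩ : MeasurableSpace Ω} {P : Measure Ω} {X : Ω → E}
    {τ : ℝ} (h : CondSubG P 𝓖 X τ) {W : Ω → ℝ≥0∞} {u : Ω → E} {r : Ω → ℝ} (hW : Measurable[𝓖] W)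
    (hu : Measurable[𝓖] u) (hr : Measurable[𝓖] r) {l : ℝ} (hl : 0 ≤ l) (hl1 : 2 * l * τ ≤ 1) :
    ∫⁻ ω, W ω * expE (r ω + (⟪u ω, X ω⟫ + l * ‖X ω‖ ^ 2)) ∂P ≤
      ∫⁻ ω, W ω * expE (r ω + (2 * τ * ‖u ω‖ ^ 2 + l * τ)) ∂P := by
  have := h (fun ω => W ω * expE (r ω)) u (hW.mul (measurable_expE.comp hr)) hu l hl hl1
  simpa only [expE_add (r _), mul_assoc] using this

section Sum

variable {κ : Type*} [DecidableEq κ] {mΩ : MeasurableSpace Ω} {P : Measure Ω} {𝓖 : Finset κ → MeasurableSpace Ω}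
  {X : κ → Ω → E} {τ : κ → ℝ}

omit [CompleteSpace E] in
/-- Exponential moments of linear functionals of a sum of conditionally sub-Gaussian vectors. -/
lemma lintegral_exp_inner_sum_le (hmono : Monotone 𝓖)
    (hX : ∀ B a, a ∈ B → Measurable[𝓖 B] (X a))
    (hsub : ∀ B a, a ∉ B → CondSubG P (𝓖 B) (X a) (τ a)) (A : Finset κ) {u : Ω → E}
    (hu : Measurable[𝓖 ∅] u) {W : Ω → ℝ≥0∞} (hW : Measurable[𝓖 ∅] W) :
    ∫⁻ ω, W ω * expE (⟪u ω, ∑ a ∈ A, X a ω⟫) ∂P ≤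
      ∫⁻ ω, W ω * expE (2 * (∑ a ∈ A, τ a) * ‖u ω‖ ^ 2) ∂P := by
  induction A using Finset.induction_on generalizing W with
  | empty => simp
  | insert a B ha ih =>
    have hle : 𝓖 ∅ ≤ 𝓖 B := hmono (Finset.empty_subset B)
    have hS : Measurable[𝓖 B] fun ω => ∑ b ∈ B, X b ω :=
      @Finset.measurable_fun_sum _ _ _ _ _ _ (𝓖 B) _ _ fun b hb => hX B b hb
    have hr : Measurable[𝓖 B] fun ω => ⟪u ω, ∑ b ∈ B, X b ω⟫ := (hu.mono hle le_rfl).inner hS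
    have h1 := (hsub B a ha).add_const_weight (hW.mono hle le_rfl) (hu.mono hle le_rfl) hr le_rfl
      (by norm_num)
    -- The summand peeled off leaves a factor that depends on $u$ alone. It is known before all
    -- draws and joins the weight, which is why the induction is over all $W$.
    have hW' : Measurable[𝓖 ∅] fun ω => W ω * expE (2 * τ a * ‖u ω‖ ^ 2) :=
      
      hW.mul (measurable_expE.comp ((by fun_prop : Measurable fun v : E =>
        2 * τ a * ‖v‖ ^ 2).comp hu))
    have h2 := ih hW'
    calc ∫⁻ ω, W ω * expE (⟪u ω, ∑ b ∈ insert a B, X b ω⟫) ∂P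
        = ∫⁻ ω, W ω * expE (⟪u ω, ∑ b ∈ B, X b ω⟫ + (⟪u ω, X a ω⟫ + 0 * ‖X a ω‖ ^ 2)) ∂P := by
          refine lintegral_congr fun ω => ?_
          rw [Finset.sum_insert ha, inner_add_right]; congr 2; ring
      _ ≤ _ := h1
      _ = ∫⁻ ω, W ω * expE (2 * τ a * ‖u ω‖ ^ 2) * expE (⟪u ω, ∑ b ∈ B, X b ω⟫) ∂P := by
          refine lintegral_congr fun ω => ?_
          rw [mul_assoc (W ω), ← expE_add]; congr 2; ring
      _ ≤ _ := h2
      _ = _ := by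
          refine lintegral_congr fun ω => ?_
          rw [mul_assoc (W ω), ← expE_add, Finset.sum_insert ha]; congr 2; ring

omit [CompleteSpace E] in
/-- Exponential moments of the squared norm of a sum of conditionally sub-Gaussian vectors; the
bound does not depend on the dimension. -/
lemma lintegral_exp_norm_sq_sum_le (hmono : Monotone 𝓖)
    (hX : ∀ B a, a ∈ B → Measurable[𝓖 B] (X a)) (hτ : ∀ a, 0 ≤ τ a)
    (hsub : ∀ B a, a ∉ B → CondSubG P (𝓖 B) (X a) (τ a)) {ϑ : ℝ} (hϑ : 0 < ϑ) (A : Finset κ)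
    {θ : ℝ} (hθ : ϑ + ∑ a ∈ A, τ a ≤ θ) {W : Ω → ℝ≥0∞} (hW : Measurable[𝓖 ∅] W) :
    ∫⁻ ω, W ω * expE (‖∑ a ∈ A, X a ω‖ ^ 2 / (8 * θ)) ∂P ≤
      expE ((∑ a ∈ A, τ a) / (8 * ϑ)) * ∫⁻ ω, W ω ∂P := by
  induction A using Finset.induction_on generalizing θ with
  | empty => simp [expE_zero]
  | insert a B ha ih =>
    rw [Finset.sum_insert ha] at hθ
    have hB0 : 0 ≤ ∑ b ∈ B, τ b := Finset.sum_nonneg fun b _ => hτ b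
    have ha0 := hτ a
    have hθ' : ϑ + ∑ b ∈ B, τ b ≤ θ - τ a := by linarith
    have hpos : 0 < θ - τ a := by linarith
    have hθ0 : 0 < θ := by linarith
    have hle : 𝓖 ∅ ≤ 𝓖 B := hmono (Finset.empty_subset B)
    have hS : Measurable[𝓖 B] fun ω => ∑ b ∈ B, X b ω :=
      @Finset.measurable_fun_sum _ _ _ _ _ _ (𝓖 B) _ _ fun b hb => hX B b hb
    set l : ℝ := 1 / (8 * θ) with hl
    have hl0 : 0 ≤ l := by positivity
    have hlτ : 2 * l * τ a ≤ 1 := by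
      rw [hl, mul_one_div, div_mul_eq_mul_div, div_le_one (by positivity)]; linarith
    have hr : Measurable[𝓖 B] fun ω => l * ‖∑ b ∈ B, X b ω‖ ^ 2 :=
      (by fun_prop : Measurable fun v : E => l * ‖v‖ ^ 2).comp hS
    have hu : Measurable[𝓖 B] fun ω => (2 * l) • ∑ b ∈ B, X b ω := 
      (measurable_const_smul (2 * l)).comp hS
    have h1 := (hsub B a ha).add_const_weight (hW.mono hle le_rfl) hu hr hl0 hlτ
    calc ∫⁻ ω, W ω * expE (‖∑ b ∈ insert a B, X b ω‖ ^ 2 / (8 * θ)) ∂P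
        = ∫⁻ ω, W ω * expE (l * ‖∑ b ∈ B, X b ω‖ ^ 2 +
            (⟪(2 * l) • ∑ b ∈ B, X b ω, X a ω⟫ + l * ‖X a ω‖ ^ 2)) ∂P := by
          refine lintegral_congr fun ω => ?_
          rw [Finset.sum_insert ha, add_comm, norm_add_sq_real, real_inner_smul_left]
          congr 2; rw [hl]; ring
      _ ≤ _ := h1
      _ ≤ ∫⁻ ω, expE (τ a / (8 * ϑ)) *
            (W ω * expE (‖∑ b ∈ B, X b ω‖ ^ 2 / (8 * (θ - τ a)))) ∂P := by
          refine lintegral_mono fun ω => ?_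
          rw [mul_left_comm, ← expE_add]
          refine mul_le_mul_right (expE_mono ?_) _
          have e1 : l * τ a ≤ τ a / (8 * ϑ) := by
            rw [hl, div_mul_eq_mul_div, one_mul]
            exact div_le_div_of_nonneg_left ha0 (by positivity) (by linarith)
          -- This recursion closes the induction: removing a summand worsens the coefficient
          -- $1/(8\theta)$ to at most $1/(8(\theta-\tau_a))$. The reserve $\vartheta$ keeps the
          -- denominators positive down to the empty sum.
          have e2 : l + 8 * τ a * l ^ 2 ≤ 1 / (8 * (θ - τ a)) := by
            rw [hl, le_div_iff₀ (by positivity)]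
            have : (1 / (8 * θ) + 8 * τ a * (1 / (8 * θ)) ^ 2) * (8 * (θ - τ a)) =
              1 - (τ a / θ) ^ 2 := by field_simp; ring
            rw [this]
            linarith [sq_nonneg (τ a / θ)]
          have e3 : 2 * τ a * ‖(2 * l) • ∑ b ∈ B, X b ω‖ ^ 2 =
              8 * τ a * l ^ 2 * ‖∑ b ∈ B, X b ω‖ ^ 2 := by
            rw [norm_smul, mul_pow, Real.norm_eq_abs, sq_abs]; ring
          rw [e3]
          have e4 := mul_le_mul_of_nonneg_right e2 (sq_nonneg ‖∑ b ∈ B, X b ω‖)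
          rw [one_div_mul_eq_div] at e4
          linarith
      _ = expE (τ a / (8 * ϑ)) *
            ∫⁻ ω, W ω * expE (‖∑ b ∈ B, X b ω‖ ^ 2 / (8 * (θ - τ a))) ∂P :=
          lintegral_const_mul' _ _ (expE_ne_top _)
      _ ≤ expE (τ a / (8 * ϑ)) * (expE ((∑ b ∈ B, τ b) / (8 * ϑ)) * ∫⁻ ω, W ω ∂P) := by
          gcongr
          exact ih hθ'
      _ = _ := by
          rw [← mul_assoc, ← expE_add, Finset.sum_insert ha]; congr 2; ring

end Sum

/-- A sum of adapted variables with bounded conditional exponential moments exceeds its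
compensator by `x` with probability at most `exp (-x)`. -/
lemma measure_sum_ge_le_of_cond {mΩ : MeasurableSpace Ω} {P : Measure Ω} [IsProbabilityMeasure P]
    {𝓖 : ℕ → MeasurableSpace Ω} (h𝓖 : ∀ t, 𝓖 t ≤ mΩ) (hmono : Monotone 𝓖) {Z : ℕ → Ω → ℝ}
    (hZ : ∀ t, Measurable[𝓖 (t + 1)] (Z t)) {b : ℝ}
    (hb : ∀ t (W : Ω → ℝ≥0∞), Measurable[𝓖 t] W →
      ∫⁻ ω, W ω * expE (Z t ω) ∂P ≤ expE b * ∫⁻ ω, W ω ∂P) (N : ℕ) (x : ℝ) :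
    P {ω | b * N + x ≤ ∑ t ∈ Finset.range N, Z t ω} ≤ expE (-x) := by
  have hm : ∀ N, Measurable[𝓖 N] fun ω => ∑ t ∈ Finset.range N, Z t ω := fun N =>
    @Finset.measurable_fun_sum _ _ _ _ _ _ (𝓖 N) _ _ fun t ht =>
      (hZ t).mono (hmono (Finset.mem_range.1 ht)) le_rfl
  -- The exponential of the partial sum serves as the past-measurable weight for the next term.
  have key : ∀ N : ℕ, ∫⁻ ω, expE (∑ t ∈ Finset.range N, Z t ω) ∂P ≤ expE (b * N) := by
    intro N
    induction N with
    | zero => simp [expE_zero]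
    | succ N ih =>
      calc ∫⁻ ω, expE (∑ t ∈ Finset.range (N + 1), Z t ω) ∂P
          = ∫⁻ ω, expE (∑ t ∈ Finset.range N, Z t ω) * expE (Z N ω) ∂P := by
            refine lintegral_congr fun ω => ?_
            rw [Finset.sum_range_succ, expE_add]
        _ ≤ expE b * ∫⁻ ω, expE (∑ t ∈ Finset.range N, Z t ω) ∂P :=
            hb N _ (measurable_expE.comp (hm N))
        _ ≤ expE b * expE (b * N) := by gcongr
        _ = expE (b * (N + 1 : ℕ)) := by rw [← expE_add]; congr 1; push_cast; ring
  have hmeas : Measurable fun ω => expE (∑ t ∈ Finset.range N, Z t ω) :=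
    measurable_expE.comp ((hm N).mono (h𝓖 N) le_rfl)
  calc P {ω | b * N + x ≤ ∑ t ∈ Finset.range N, Z t ω}
      ≤ P {ω | expE (b * N + x) ≤ expE (∑ t ∈ Finset.range N, Z t ω)} :=
        measure_mono fun ω h => expE_mono h
    _ ≤ (∫⁻ ω, expE (∑ t ∈ Finset.range N, Z t ω) ∂P) / expE (b * N + x) :=
        meas_ge_le_lintegral_div hmeas.aemeasurable
          (by simp [expE, Real.exp_pos]) (expE_ne_top _)
    _ ≤ expE (b * N) / expE (b * N + x) := by gcongr; exact key N
    _ = expE (-x) := by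
        rw [ENNReal.div_eq_inv_mul, expE, expE, expE,
          ← ENNReal.ofReal_inv_of_pos (Real.exp_pos _), ← ENNReal.ofReal_mul (by positivity),
          ← Real.exp_neg, ← Real.exp_add]
        congr 2; ring

end Conditional

/-! ### Oracle deviations and Gaussian perturbations are norm-sub-Gaussian -/

section SubGaussianExamples

lemma integrable_of_exp_moment {α E : Type*} [MeasurableSpace α] [NormedAddCommGroup E]
    {ρ : Measure α} {X : α → E} {τ : ℝ} (hτ : 0 < τ) (hX : AEStronglyMeasurable X ρ)
    (h : ∫⁻ a, expE (‖X a‖ ^ 2 / τ) ∂ρ ≤ 2) : Integrable X ρ := by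
  refine ⟨hX, ?_⟩
  rw [hasFiniteIntegral_iff_norm]
  calc ∫⁻ a, ENNReal.ofReal ‖X a‖ ∂ρ
      ≤ ∫⁻ a, ENNReal.ofReal (1 + τ) * expE (‖X a‖ ^ 2 / τ) ∂ρ := by
        refine lintegral_mono fun a => ?_
        rw [expE, ← ENNReal.ofReal_mul (by positivity)]
        refine ENNReal.ofReal_le_ofReal ?_
        have h1 := Real.add_one_le_exp (‖X a‖ ^ 2 / τ)
        have h2 : (1 + τ) * (‖X a‖ ^ 2 / τ + 1) ≤ (1 + τ) * Real.exp (‖X a‖ ^ 2 / τ) := by gcongr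
        have h3 : (1 + τ) * (‖X a‖ ^ 2 / τ + 1) = ‖X a‖ ^ 2 / τ + ‖X a‖ ^ 2 + (1 + τ) := by
          field_simp
        have h4 : 0 ≤ ‖X a‖ ^ 2 / τ := by positivity
        nlinarith [sq_nonneg (‖X a‖ - 1)]
    _ = ENNReal.ofReal (1 + τ) * ∫⁻ a, expE (‖X a‖ ^ 2 / τ) ∂ρ :=
        lintegral_const_mul' _ _ ENNReal.ofReal_ne_top
    _ ≤ ENNReal.ofReal (1 + τ) * 2 := by gcongr
    _ < ∞ := ENNReal.mul_lt_top ENNReal.ofReal_lt_top (by simp)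

lemma NormSubG.const_smul {α E : Type*} [MeasurableSpace α] [NormedAddCommGroup E]
    [InnerProductSpace ℝ E] [CompleteSpace E] [MeasurableSpace E] [BorelSpace E]
    [SecondCountableTopology E] {ρ : Measure α}
    {X : α → E} {τ : ℝ} (h : NormSubG ρ X τ) {c : ℝ} (hc : 0 < c) :
    NormSubG ρ (fun a => c • X a) (c ^ 2 * τ) where
  pos := by have := h.pos; positivity
  measurable := h.measurable.const_smul c
  integrable := h.integrable.smul c
  mean := by rw [integral_smul, h.mean, smul_zero]
  moment := by
    refine le_of_eq_of_le (lintegral_congr fun a => ?_) h.moment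
    congr 1
    have := h.pos
    rw [norm_smul, Real.norm_of_nonneg hc.le, mul_pow]
    field_simp

section Oracle

variable {d : ℕ} {S : Type*} [MeasurableSpace S] {D : Measure S} [IsProbabilityMeasure D]
  {G : Vec d → S → Vec d} {h : Vec d → ℝ} {lip σ : ℝ}

omit [IsProbabilityMeasure D] in
lemma IsStochasticGradient.measurable_apply (hG : IsStochasticGradient D G h lip σ) (x : Vec d) :
    Measurable (G x) :=
  hG.measurable.comp (measurable_const.prodMk measurable_id)

lemma IsStochasticGradient.moment (hG : IsStochasticGradient D G h lip σ) (hσ : 0 < σ)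
    (x : Vec d) : ∫⁻ s, expE (‖G x s - ∇ h x‖ ^ 2 / (6 * σ ^ 2)) ∂D ≤ 2 :=
  lintegral_exp_sq_le_two_of_tail D ((hG.measurable_apply x).sub_const _).norm
    (fun _ => norm_nonneg _) (by positivity) (hG.tail x)

lemma IsStochasticGradient.integrable (hG : IsStochasticGradient D G h lip σ) (hσ : 0 < σ)
    (x : Vec d) : Integrable (G x) D := by
  have h1 := integrable_of_exp_moment (by positivity)
    ((hG.measurable_apply x).sub_const (∇ h x)).aestronglyMeasurable (hG.moment hσ x)
  refine (h1.add (integrable_const (∇ h x))).congr (Filter.Eventually.of_forall fun s => ?_)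
  simp

/-- The deviation of an oracle answer from the gradient is norm-sub-Gaussian. -/
lemma IsStochasticGradient.normSubG (hG : IsStochasticGradient D G h lip σ) (hσ : 0 < σ)
    (x : Vec d) : NormSubG D (fun s => G x s - ∇ h x) (6 * σ ^ 2) where
  pos := by positivity
  measurable := (hG.measurable_apply x).sub_const _
  integrable := (hG.integrable hσ x).sub (integrable_const _)
  mean := by rw [integral_sub (hG.integrable hσ x) (integrable_const _), hG.unbiased x]; simp
  moment := hG.moment hσ x

/-- The gradient inherits the Lipschitz constant of the oracle. -/
lemma IsStochasticGradient.norm_gradient_sub_le (hG : IsStochasticGradient D G h lip σ)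
    (hσ : 0 < σ) (x y : Vec d) : ‖∇ h x - ∇ h y‖ ≤ lip * ‖x - y‖ := by
  rw [← hG.unbiased x, ← hG.unbiased y, ← integral_sub (hG.integrable hσ x) (hG.integrable hσ y)]
  have := norm_integral_le_of_norm_le_const (μ := D) (f := fun s => G x s - G y s)
    (C := lip * ‖x - y‖) (hG.lipschitz.mono fun s hs => hs x y)
  simpa using this

lemma continuous_of_norm_sub_le {g : Vec d → Vec d} {l : ℝ}
    (hg : ∀ x y, ‖g x - g y‖ ≤ l * ‖x - y‖) : Continuous g := by
  refine (LipschitzWith.of_dist_le_mul (K := l.toNNReal) fun x y => ?_).continuous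
  rw [dist_eq_norm, dist_eq_norm]
  exact (hg x y).trans (mul_le_mul_of_nonneg_right (Real.le_coe_toNNReal l) (norm_nonneg _))

lemma IsStochasticGradient.measurable_gradient (hG : IsStochasticGradient D G h lip σ)
    (hσ : 0 < σ) : Measurable (∇ h) :=
  (continuous_of_norm_sub_le (hG.norm_gradient_sub_le hσ)).measurable

end Oracle

/-- A centred real Gaussian has a sub-Gaussian tail. -/
lemma gaussianReal_abs_tail {v : NNReal} {w : ℝ} (hvw : v ≤ w) (hw : 0 < w) {t : ℝ} (ht : 0 ≤ t) :
    (gaussianReal 0 v).real {x | t ≤ |x|} ≤ 2 * Real.exp (-t ^ 2 / (2 * w)) := by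
  -- Passing to a positive proxy $w\ge v$ includes the degenerate Gaussian $v=0$, that is, the case
  -- $r=0$.
  have hs : HasSubgaussianMGF (fun x : ℝ => x) w.toNNReal (gaussianReal 0 v) := by
    refine ⟨fun t => integrable_exp_mul_gaussianReal t, fun t => ?_⟩
    rw [mgf_fun_id_gaussianReal, Real.coe_toNNReal _ hw.le]
    refine Real.exp_le_exp.2 ?_
    rw [zero_mul, zero_add]
    gcongr
  have h1 := hs.measure_ge_le ht
  have h2 := hs.neg.measure_ge_le ht
  rw [Real.coe_toNNReal _ hw.le] at h1 h2
  have hsub : {x : ℝ | t ≤ |x|} ⊆ {x | t ≤ x} ∪ {x | t ≤ (-fun x : ℝ => x) x} :=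
    fun x (hx : t ≤ |x|) => le_abs.1 hx
  calc (gaussianReal 0 v).real {x | t ≤ |x|}
      ≤ (gaussianReal 0 v).real ({x | t ≤ x} ∪ {x | t ≤ (-fun x : ℝ => x) x}) :=
        measureReal_mono hsub
    _ ≤ _ := measureReal_union_le _ _
    _ ≤ _ := by linarith

/-- An isotropic Gaussian vector is norm-sub-Gaussian with the parameter of its total variance. -/
lemma normSubG_multivariateGaussian {d : ℕ} (hd : 0 < d) {v w : ℝ} (hv : 0 ≤ v) (hvw : v ≤ w)
    (hw : 0 < w) : NormSubG (multivariateGaussian (0 : Vec d)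
      (v • (1 : Matrix (Fin d) (Fin d) ℝ))) (fun x => x) (6 * (d * w)) := by
  have hS : (v • (1 : Matrix (Fin d) (Fin d) ℝ)).PosSemidef := Matrix.PosSemidef.one.smul hv
  have hd0 : (0 : ℝ) < d := by exact_mod_cast hd
  have hmom : ∫⁻ x, expE (‖x‖ ^ 2 / (6 * (d * w))) ∂(multivariateGaussian (0 : Vec d)
      (v • (1 : Matrix (Fin d) (Fin d) ℝ))) ≤ 2 := by
    have hk : ∀ k : Fin d, ∫⁻ x, expE (x k ^ 2 / (6 * w)) ∂(multivariateGaussian (0 : Vec d)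
        (v • (1 : Matrix (Fin d) (Fin d) ℝ))) ≤ 2 := by
      intro k
      have hp := measurePreserving_eval_multivariateGaussian (μ := (0 : Vec d)) hS (i := k)
      have hvar : (v • (1 : Matrix (Fin d) (Fin d) ℝ)) k k = v := by simp
      rw [hvar, show (0 : Vec d) k = 0 from rfl] at hp
      have h2 := lintegral_exp_sq_le_two_of_tail (gaussianReal 0 v.toNNReal)
        (Y := fun x : ℝ => |x|) measurable_id.abs (fun _ => abs_nonneg _) hw
        (fun t ht => gaussianReal_abs_tail (by rwa [Real.coe_toNNReal _ hv]) hw ht)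
      simp only [sq_abs] at h2
      rw [← hp.lintegral_comp (f := fun y : ℝ => expE (y ^ 2 / (6 * w)))
        (measurable_expE.comp (by fun_prop))] at h2
      exact h2
    -- $\|x\|^2/(6dw)$ is the average of the $x_k^2/(6w)$, so Jensen reduces to one-dimensional
    -- marginals; independence of the coordinates plays no role.
    have hjensen : ∀ x : Vec d, expE (‖x‖ ^ 2 / (6 * (d * w))) ≤
        ∑ k, ENNReal.ofReal (1 / d) * expE (x k ^ 2 / (6 * w)) := by
      intro x
      have := convexOn_exp.map_sum_le (t := Finset.univ) (w := fun _ : Fin d => 1 / (d : ℝ))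
        (p := fun k => x k ^ 2 / (6 * w)) (fun _ _ => by positivity)
        (by simp [hd0.ne']) (fun _ _ => Set.mem_univ _)
      simp only [smul_eq_mul] at this
      unfold expE
      simp only [← ENNReal.ofReal_mul (one_div_nonneg.2 hd0.le)]
      rw [← ENNReal.ofReal_sum_of_nonneg fun k _ => by positivity]
      refine ENNReal.ofReal_le_ofReal (le_of_eq_of_le ?_ this)
      rw [EuclideanSpace.real_norm_sq_eq, ← Finset.mul_sum, ← Finset.sum_div]
      congr 1
      field_simp
    calc _ ≤ ∫⁻ x, ∑ k, ENNReal.ofReal (1 / d) * expE (x k ^ 2 / (6 * w))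
            ∂(multivariateGaussian (0 : Vec d) (v • (1 : Matrix (Fin d) (Fin d) ℝ))) :=
          lintegral_mono hjensen
      _ = ∑ k, ENNReal.ofReal (1 / d) * ∫⁻ x, expE (x k ^ 2 / (6 * w))
            ∂(multivariateGaussian (0 : Vec d) (v • (1 : Matrix (Fin d) (Fin d) ℝ))) := by
          rw [lintegral_finsetSum]
          · exact Finset.sum_congr rfl fun k _ => lintegral_const_mul' _ _ ENNReal.ofReal_ne_top
          · intro k _
            exact (measurable_expE.comp (by fun_prop)).const_mul _
      _ ≤ ∑ k : Fin d, ENNReal.ofReal (1 / d) * 2 := by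
          gcongr with k
          exact hk k
      _ = 2 := by
          rw [Finset.sum_const, Finset.card_univ, Fintype.card_fin, nsmul_eq_mul, ← mul_assoc,
            ← ENNReal.ofReal_natCast, ← ENNReal.ofReal_mul hd0.le, mul_one_div_cancel hd0.ne',
            ENNReal.ofReal_one, one_mul]
  exact
    { pos := by positivity
      measurable := measurable_id
      integrable := integrable_of_exp_moment (by positivity)
        measurable_id.aestronglyMeasurable hmom
      mean := integral_id_multivariateGaussian
      moment := hmom }

end SubGaussianExamples

/-! ### Measurability of one iteration -/

section Measurability

lemma sum_map_range {M : Type*} [AddCommMonoid M] (g : ℕ → M) (p : ℕ) :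
    ((List.range p).map g).sum = ∑ j ∈ Finset.range p, g j := by
  induction p with
  | zero => simp
  | succ p ih => rw [List.range_succ, List.map_append, List.sum_append, ih,
      Finset.sum_range_succ]; simp

lemma fccMessages_sum_succ {d : ℕ} (c : ℕ → Vec d → Vec d) (x : Vec d) (k : ℕ) :
    (fccMessages c x (k + 1)).sum =
      (fccMessages c x k).sum + c k (x - (fccMessages c x k).sum) := by
  simp [fccMessages]

/-- All components of a random state are measurable. -/
structure State.IsMeasurable {n d : ℕ} {Ω : Type*} (m : MeasurableSpace Ω)
    (st : Ω → State n d) : Prop where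
  model : Measurable fun ω => (st ω).model
  err : ∀ i, Measurable fun ω => (st ω).err i
  errPrev : ∀ i, Measurable fun ω => (st ω).errPrev i
  est : ∀ i, Measurable fun ω => (st ω).est i
  serverEst : Measurable fun ω => (st ω).serverEst

variable {n d : ℕ} {Ω S U : Type*} {m : MeasurableSpace Ω} [MeasurableSpace S] [MeasurableSpace U]

lemma measurable_fccMessages_sum {C : U → Vec d → Vec d} (hC : Measurable (Function.uncurry C))
    {z : ℕ → Ω → U} (hz : ∀ l, Measurable (z l)) {x : Ω → Vec d} (hx : Measurable x) (k : ℕ) :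
    Measurable fun ω => (fccMessages (fun l => C (z l ω)) (x ω) k).sum := by
  induction k with
  | zero => simp [fccMessages]
  | succ k ih =>
    simp only [fccMessages_sum_succ]
    exact ih.add (hC.comp ((hz k).prodMk (hx.sub ih)))

lemma State.IsMeasurable.step {G : Fin n → Vec d → S → Vec d} {C : U → Vec d → Vec d}
    (hG : ∀ i, Measurable (Function.uncurry (G i))) (hC : Measurable (Function.uncurry C))
    {s : Fin n → ℕ → Ω → S} (hs : ∀ i j, Measurable (s i j)) {ξ : Ω → Vec d} (hξ : Measurable ξ)
    {z : Fin n → ℕ → Ω → U} (hz : ∀ i l, Measurable (z i l)) {st : Ω → State n d}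
    (hst : State.IsMeasurable m st) (η : ℝ) (p : ℕ) :
    State.IsMeasurable m fun ω =>
      PowerEF.step η p G C (fun i j => s i j ω) (ξ ω) (fun i l => z i l ω) (st ω) := by
  have hgrad : ∀ i, Measurable fun ω => (1 / (p : ℝ)) •
      ((List.range p).map fun j => G i (st ω).model (s i j ω)).sum := fun i => by
    simp only [sum_map_range]
    exact (Finset.measurable_fun_sum _ fun j _ =>
      (hG i).comp (hst.model.prodMk (hs i j))).const_smul (1 / (p : ℝ))
  have hfb : ∀ i, Measurable fun ω => (fccMessages (fun l => C (z i l ω))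
      ((st ω).err i - (st ω).errPrev i) p).sum := fun i =>
    measurable_fccMessages_sum hC (hz i) ((hst.err i).sub (hst.errPrev i)) p
  have hin : ∀ i, Measurable fun ω => (st ω).err i + (1 / (p : ℝ)) •
      ((List.range p).map fun j => G i (st ω).model (s i j ω)).sum + ξ ω := fun i =>
    ((hst.err i).add (hgrad i)).add hξ
  have hcmp : ∀ i, Measurable fun ω => C (z i p ω) ((st ω).err i + (1 / (p : ℝ)) •
      ((List.range p).map fun j => G i (st ω).model (s i j ω)).sum + ξ ω - (st ω).est i -
      (fccMessages (fun l => C (z i l ω)) ((st ω).err i - (st ω).errPrev i) p).sum) := fun i =>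
    hC.comp ((hz i p).prodMk (((hin i).sub (hst.est i)).sub (hfb i)))
  have hest := fun i => ((hst.est i).add (hfb i)).add (hcmp i)
  have hserver := hst.serverEst.add
    ((Finset.measurable_fun_sum Finset.univ fun i _ => (hfb i).add (hcmp i)).const_smul
      (1 / (n : ℝ)))
  refine ⟨?_, fun i => (hin i).sub (hest i), hst.err, hest, ?_⟩
  · simp only [PowerEF.step, List.sum_append, List.sum_singleton]
    exact hst.model.sub (hserver.const_smul η)
  · simp only [PowerEF.step, List.sum_append, List.sum_singleton]
    exact hserver

end Measurability

/-! ### The filtration generated by the random draws -/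

section History

variable {Ω : Type w} [mΩ : MeasurableSpace Ω] {P : Measure Ω} {S : Type u} [MeasurableSpace S]
  {n d : ℕ} {D : Fin n → Measure S} {U : Type v} [MeasurableSpace U] {ν : Measure U} {v : ℝ}
  (R : Randomness P D ν d v)

/-- The σ-algebra generated by one random draw. -/
@[reducible] def Randomness.drawSigma : Draw n → MeasurableSpace Ω
  | Draw.query t i j => MeasurableSpace.comap (R.sample t i j) inferInstance
  | Draw.perturbation t => MeasurableSpace.comap (R.xi t) inferInstance
  | Draw.compression t i l => MeasurableSpace.comap (R.seed t i l) inferInstance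

/-- The σ-algebra generated by a set of random draws. -/
@[reducible] def Randomness.sigma (A : Set (Draw n)) : MeasurableSpace Ω := ⨆ a ∈ A, R.drawSigma a

lemma Randomness.drawSigma_le (a : Draw n) : R.drawSigma a ≤ mΩ := by
  cases a with
  | query t i j => exact (R.sample_measurable t i j).comap_le
  | perturbation t => exact (R.xi_measurable t).comap_le
  | compression t i l => exact (R.seed_measurable t i l).comap_le

lemma Randomness.iIndep_drawSigma : iIndep R.drawSigma P :=
  R.independent

lemma Randomness.sigma_le (A : Set (Draw n)) : R.sigma A ≤ mΩ :=
  iSup₂_le fun a _ => R.drawSigma_le a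

lemma Randomness.sigma_mono {A B : Set (Draw n)} (h : A ⊆ B) : R.sigma A ≤ R.sigma B :=
  biSup_mono h

lemma Randomness.drawSigma_le_sigma {A : Set (Draw n)} {a : Draw n} (h : a ∈ A) :
    R.drawSigma a ≤ R.sigma A :=
  le_iSup₂_of_le a h le_rfl

lemma Randomness.indep_sigma_drawSigma {A : Set (Draw n)} {a : Draw n} (h : a ∉ A) :
    Indep (R.sigma A) (R.drawSigma a) P := by
  have := indep_iSup_of_disjoint R.drawSigma_le R.iIndep_drawSigma
    (Set.disjoint_singleton_right.2 h)
  simpa [Randomness.sigma] using this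

/-- The iteration in which a draw is made. -/
def Draw.time : Draw n → ℕ
  | Draw.query t _ _ => t
  | Draw.perturbation t => t
  | Draw.compression t _ _ => t

/-- The draws made before iteration `t`. -/
def history (n t : ℕ) : Set (Draw n) := {a | a.time < t}

lemma history_mono {s t : ℕ} (h : s ≤ t) : history n s ⊆ history n t :=
  fun _ ha => lt_of_lt_of_le ha h

/-- The state before iteration $t$ uses only earlier draws, so the draws of iteration $t$ are
independent of the point at which the oracles are queried. -/
lemma Randomness.isMeasurable_run {η : ℝ} {p : ℕ} {G : Fin n → Vec d → S → Vec d}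
    {C : U → Vec d → Vec d} (hG : ∀ i, Measurable (Function.uncurry (G i)))
    (hC : Measurable (Function.uncurry C)) (x₀ : Vec d) (t : ℕ) :
    State.IsMeasurable (R.sigma (history n t)) fun ω => run R η p G C x₀ ω t := by
  induction t with
  | zero =>
    exact ⟨measurable_const, fun _ => measurable_const, fun _ => measurable_const,
      fun _ => measurable_const, measurable_const⟩
  | succ t ih =>
    have hle := R.sigma_mono (history_mono (n := n) t.le_succ)
    have hmem : ∀ a : Draw n, a.time = t → R.drawSigma a ≤ R.sigma (history n (t + 1)) :=
      fun a ha => R.drawSigma_le_sigma (show a.time < t + 1 by omega)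
    have ih' : State.IsMeasurable (R.sigma (history n (t + 1)))
        fun ω => run R η p G C x₀ ω t :=
      ⟨ih.model.mono hle le_rfl, fun i => (ih.err i).mono hle le_rfl,
        fun i => (ih.errPrev i).mono hle le_rfl, fun i => (ih.est i).mono hle le_rfl,
        ih.serverEst.mono hle le_rfl⟩
    exact State.IsMeasurable.step hG hC (s := fun i j => R.sample t i j)
      (fun i j => measurable_iff_comap_le.2 (hmem (Draw.query t i j) rfl))
      (measurable_iff_comap_le.2 (hmem (Draw.perturbation t) rfl))
      (z := fun i l => R.seed t i l)
      (fun i l => measurable_iff_comap_le.2 (hmem (Draw.compression t i l) rfl)) ih' η p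

end History

/-! ### Concentration of the gradient noise -/

section Noise

variable {Ω : Type w} [mΩ : MeasurableSpace Ω] {P : Measure Ω} {S : Type u} [MeasurableSpace S]
  {n d : ℕ} {D : Fin n → Measure S} {U : Type v} [MeasurableSpace U] {ν : Measure U} {v : ℝ}
  (R : Randomness P D ν d v)

/-- The perturbation (`none`) and the oracle queries (`some (i, j)`) of iteration `t`. -/
def gradientDraw (t : ℕ) : Option (Fin n × ℕ) → Draw n
  | none => Draw.perturbation t
  | some (i, j) => Draw.query t i j

lemma gradientDraw_time (t : ℕ) (a : Option (Fin n × ℕ)) : (gradientDraw t a).time = t := by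
  rcases a with _ | ⟨i, j⟩ <;> rfl

lemma gradientDraw_injective (t : ℕ) : Function.Injective (gradientDraw (n := n) t) := by
  rintro (_ | ⟨i, j⟩) (_ | ⟨i', j'⟩) h <;> simp_all [gradientDraw]

/-- The draws before iteration `t` and some of the draws of iteration `t`. -/
def partialHistory (t : ℕ) (B : Finset (Option (Fin n × ℕ))) : Set (Draw n) :=
  history n t ∪ gradientDraw t '' B

lemma partialHistory_mono (t : ℕ) : Monotone (partialHistory (n := n) t) := fun _ _ h =>
  Set.union_subset_union_right _ (Set.image_mono (Finset.coe_subset.2 h))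

lemma history_subset_partialHistory (t : ℕ) (B : Finset (Option (Fin n × ℕ))) :
    history n t ⊆ partialHistory t B := Set.subset_union_left

lemma partialHistory_subset_history_succ (t : ℕ) (B : Finset (Option (Fin n × ℕ))) :
    partialHistory t B ⊆ history n (t + 1) := by
  refine Set.union_subset (history_mono t.le_succ) ?_
  rintro _ ⟨a, -, rfl⟩
  exact (gradientDraw_time t a).trans_lt t.lt_succ_self

lemma gradientDraw_notMem {t : ℕ} {B : Finset (Option (Fin n × ℕ))} {a : Option (Fin n × ℕ)}
    (ha : a ∉ B) : gradientDraw t a ∉ partialHistory t B := by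
  rintro (h | ⟨b, hb, hab⟩)
  · exact absurd (gradientDraw_time t a) (ne_of_lt h)
  · exact ha (gradientDraw_injective t hab ▸ hb)

lemma sigma_history_mono : Monotone fun t => R.sigma (history n t) := fun _ _ h =>
  R.sigma_mono (history_mono h)

variable (η : ℝ) (p : ℕ) (G : Fin n → Vec d → S → Vec d) (C : U → Vec d → Vec d)
  (f : Fin n → Vec d → ℝ) (x₀ : Vec d)

/-- The contribution of one draw to the noise in iteration `t`; deviations of oracle answers are
scaled by `c`. -/
def drawNoise (c : ℝ) (t : ℕ) : Option (Fin n × ℕ) → Ω → Vec d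
  | none => fun ω => R.xi t ω
  | some (i, j) => fun ω => c • (G i (run R η p G C x₀ ω t).model (R.sample t i j ω) -
      ∇ (f i) (run R η p G C x₀ ω t).model)

/-- The noise in the gradient estimate of client `i` in iteration `t`. -/
def clientNoise (i : Fin n) (t : ℕ) (ω : Ω) : Vec d :=
  (1 / (p : ℝ)) • ∑ j ∈ Finset.range p, G i (run R η p G C x₀ ω t).model (R.sample t i j ω) +
    R.xi t ω - ∇ (f i) (run R η p G C x₀ ω t).model

/-- The average of the noise over all clients. -/
def meanNoise (t : ℕ) (ω : Ω) : Vec d :=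
  (1 / (n : ℝ)) • ∑ i, clientNoise R η p G C f x₀ i t ω

/-- The draws that enter the gradient estimate of client `i`. -/
def clientDraws (i : Fin n) : Finset (Option (Fin n × ℕ)) :=
  Finset.insertNone ({i} ×ˢ Finset.range p)

/-- The draws that enter the gradient estimates of all clients. -/
def allDraws (n p : ℕ) : Finset (Option (Fin n × ℕ)) :=
  Finset.insertNone (Finset.univ ×ˢ Finset.range p)

variable {p}

lemma clientNoise_eq_sum (hp : 0 < p) (i : Fin n) (t : ℕ) (ω : Ω) :
    clientNoise R η p G C f x₀ i t ω =
      ∑ a ∈ clientDraws p i, drawNoise R η p G C f x₀ (1 / p) t a ω := by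
  have hp' : (p : ℝ) ≠ 0 := by positivity
  rw [clientDraws, Finset.sum_insertNone, Finset.sum_product, Finset.sum_singleton]
  simp only [drawNoise, clientNoise]
  rw [← Finset.smul_sum, Finset.sum_sub_distrib, smul_sub, Finset.sum_const, Finset.card_range,
    ← Nat.cast_smul_eq_nsmul ℝ, smul_smul, one_div_mul_cancel hp', one_smul]
  abel

lemma meanNoise_eq_sum (hn : 0 < n) (hp : 0 < p) (t : ℕ) (ω : Ω) :
    meanNoise R η p G C f x₀ t ω =
      ∑ a ∈ allDraws n p, drawNoise R η p G C f x₀ (1 / (n * p)) t a ω := by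
  have hp' : (p : ℝ) ≠ 0 := by positivity
  have hn' : (n : ℝ) ≠ 0 := by positivity
  rw [meanNoise, allDraws, Finset.sum_insertNone, Finset.sum_product]
  have hc : ∀ i, clientNoise R η p G C f x₀ i t ω = R.xi t ω +
      ∑ j ∈ Finset.range p, drawNoise R η p G C f x₀ (1 / p) t (some (i, j)) ω := fun i => by
    rw [clientNoise_eq_sum _ _ _ _ _ _ hp, clientDraws, Finset.sum_insertNone,
      Finset.sum_product, Finset.sum_singleton]
    rfl
  simp only [hc, Finset.sum_add_distrib, smul_add]
  congr 1
  · rw [Finset.sum_const, Finset.card_univ, Fintype.card_fin, ← Nat.cast_smul_eq_nsmul ℝ,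
      smul_smul, one_div_mul_cancel hn', one_smul]
    rfl
  · simp only [Finset.smul_sum, drawNoise, smul_smul]
    simp only [one_div, mul_inv]

/-- The norm-sub-Gaussian parameters of the contributions of the draws. -/
def drawParam (n : ℕ) (c σ τ : ℝ) : Option (Fin n × ℕ) → ℝ
  | none => τ
  | some _ => c ^ 2 * (6 * σ ^ 2)

lemma drawParam_nonneg {c σ τ : ℝ} (hτ : 0 ≤ τ) (a : Option (Fin n × ℕ)) :
    0 ≤ drawParam n c σ τ a := by
  cases a with
  | none => exact hτ
  | some _ => simp only [drawParam]; positivity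

lemma sum_drawParam_clientDraws (hp : 0 < p) (σ τ : ℝ) (i : Fin n) :
    ∑ a ∈ clientDraws p i, drawParam n (1 / p) σ τ a = τ + 6 * σ ^ 2 / p := by
  have hp' : (p : ℝ) ≠ 0 := by positivity
  rw [clientDraws, Finset.sum_insertNone]
  simp only [drawParam, Finset.sum_const, Finset.card_product, Finset.card_singleton, one_mul,
    Finset.card_range, nsmul_eq_mul]
  field_simp

lemma sum_drawParam_allDraws (hn : 0 < n) (hp : 0 < p) (σ τ : ℝ) :
    ∑ a ∈ allDraws n p, drawParam n (1 / (n * p)) σ τ a = τ + 6 * σ ^ 2 / (n * p) := by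
  have hp' : (p : ℝ) ≠ 0 := by positivity
  have hn' : (n : ℝ) ≠ 0 := by positivity
  rw [allDraws, Finset.sum_insertNone]
  simp only [drawParam, Finset.sum_const, Finset.card_product, Finset.card_univ,
    Fintype.card_fin, Finset.card_range, nsmul_eq_mul, Nat.cast_mul]
  field_simp

variable {G C f x₀ η} {R} [IsProbabilityMeasure P] [∀ i, IsProbabilityMeasure (D i)]
  {lip : Fin n → ℝ} {σ : ℝ}

section Concentration

variable (hσ : 0 < σ) (hG : ∀ i, IsStochasticGradient (D i) (G i) (f i) (lip i) σ)
  (hC : Measurable (Function.uncurry C)) {τ : ℝ}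
  (hτ : NormSubG (multivariateGaussian 0 (v • (1 : Matrix (Fin d) (Fin d) ℝ)))
    (fun x : Vec d => x) τ)

include hσ hG hC

omit [IsProbabilityMeasure P] in
lemma measurable_drawNoise (c : ℝ) (t : ℕ) {B : Finset (Option (Fin n × ℕ))}
    {a : Option (Fin n × ℕ)} (ha : a ∈ B) :
    Measurable[R.sigma (partialHistory t B)] (drawNoise R η p G C f x₀ c t a) := by
  have hmem : R.drawSigma (gradientDraw t a) ≤ R.sigma (partialHistory t B) :=
    R.drawSigma_le_sigma (Or.inr ⟨a, ha, rfl⟩)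
  have hx : Measurable[R.sigma (partialHistory t B)] fun ω => (run R η p G C x₀ ω t).model :=
    (R.isMeasurable_run (fun i => (hG i).measurable) hC x₀ t).model.mono
      (R.sigma_mono (history_subset_partialHistory t B)) le_rfl
  rcases a with _ | ⟨i, j⟩
  · exact measurable_iff_comap_le.2 hmem
  · have hs : Measurable[R.sigma (partialHistory t B)] (R.sample t i j) :=
      measurable_iff_comap_le.2 hmem
    have hF : Measurable fun q : Vec d × S => c • (G i q.1 q.2 - ∇ (f i) q.1) :=
      ((hG i).measurable.sub (((hG i).measurable_gradient hσ).comp measurable_fst)).const_smul c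
    exact hF.comp (hx.prodMk hs)

omit [IsProbabilityMeasure P] in
lemma measurable_noise_sum (c : ℝ) (t : ℕ) (A : Finset (Option (Fin n × ℕ))) :
    Measurable[R.sigma (history n (t + 1))]
      fun ω => ∑ a ∈ A, drawNoise R η p G C f x₀ c t a ω :=
  @Finset.measurable_fun_sum _ _ _ _ _ _ (R.sigma (history n (t + 1))) _ _ fun _ ha =>
    (measurable_drawNoise hσ hG hC c t ha).mono
      (R.sigma_mono (partialHistory_subset_history_succ t A)) le_rfl

include hτ

/-- The draw for `a` lies outside the partial history, whereas the query point is measurable with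
respect to it. Draws of the same iteration can thus be revealed one by one in any order. -/
lemma condSubG_drawNoise {c : ℝ} (hc : 0 < c) (t : ℕ) {B : Finset (Option (Fin n × ℕ))}
    {a : Option (Fin n × ℕ)} (ha : a ∉ B) :
    CondSubG P (R.sigma (partialHistory t B)) (drawNoise R η p G C f x₀ c t a)
      (drawParam n c σ τ a) := by
  have hind := R.indep_sigma_drawSigma (gradientDraw_notMem (t := t) ha)
  have hx : Measurable[R.sigma (partialHistory t B)] fun ω => (run R η p G C x₀ ω t).model :=
    (R.isMeasurable_run (fun i => (hG i).measurable) hC x₀ t).model.mono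
      (R.sigma_mono (history_subset_partialHistory t B)) le_rfl
  rcases a with _ | ⟨i, j⟩
  · exact condSubG_of_indep (R.sigma_le _) (R.xi_law t) (R.xi_measurable t) hind hx
      (F := fun _ y => y) measurable_snd fun _ => hτ
  · exact condSubG_of_indep (R.sigma_le _) (R.sample_law t i j) (R.sample_measurable t i j) hind hx
      (F := fun x s => c • (G i x s - ∇ (f i) x))
      (((hG i).measurable.sub (((hG i).measurable_gradient hσ).comp measurable_fst)).const_smul c)
      fun x => ((hG i).normSubG hσ x).const_smul hc

/-- The sum bound is applied with reserve $\Theta$ and final parameter $2\Theta$; since the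
parameters add up to at most $\Theta$, the price is at most a factor $e$. -/
lemma lintegral_exp_norm_sq_noise_le {c : ℝ} (hc : 0 < c) (t : ℕ)
    (A : Finset (Option (Fin n × ℕ))) {Θ : ℝ} (hΘ : 0 < Θ)
    (hA : ∑ a ∈ A, drawParam n c σ τ a ≤ Θ) {W : Ω → ℝ≥0∞}
    (hW : Measurable[R.sigma (history n t)] W) :
    ∫⁻ ω, W ω * expE (‖∑ a ∈ A, drawNoise R η p G C f x₀ c t a ω‖ ^ 2 / (16 * Θ)) ∂P ≤
      expE 1 * ∫⁻ ω, W ω ∂P := by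
  have h := lintegral_exp_norm_sq_sum_le (P := P) (𝓖 := fun B => R.sigma (partialHistory t B))
    (fun _ _ h => R.sigma_mono (partialHistory_mono t h))
    (fun B a ha => measurable_drawNoise (η := η) (p := p) (x₀ := x₀) hσ hG hC c t ha)
    (drawParam_nonneg hτ.pos.le)
    (fun B a ha => condSubG_drawNoise (η := η) (p := p) (x₀ := x₀) hσ hG hC hτ hc t ha)
    hΘ A (θ := 2 * Θ) (by linarith)
    (hW.mono (R.sigma_mono (history_subset_partialHistory t ∅)) le_rfl)
  calc _ = ∫⁻ ω, W ω *
        expE (‖∑ a ∈ A, drawNoise R η p G C f x₀ c t a ω‖ ^ 2 / (8 * (2 * Θ))) ∂P := by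
        refine lintegral_congr fun ω => ?_
        congr 3; ring
    _ ≤ _ := h
    _ ≤ _ := by
        gcongr
        refine expE_mono ?_
        rw [div_le_one (by positivity)]
        linarith

lemma lintegral_exp_inner_noise_le {c : ℝ} (hc : 0 < c) (t : ℕ)
    (A : Finset (Option (Fin n × ℕ))) {Θ : ℝ} (hA : ∑ a ∈ A, drawParam n c σ τ a ≤ Θ)
    {W : Ω → ℝ≥0∞} (hW : Measurable[R.sigma (history n t)] W) {u : Ω → Vec d}
    (hu : Measurable[R.sigma (history n t)] u) :
    ∫⁻ ω, W ω * expE (⟪u ω, ∑ a ∈ A, drawNoise R η p G C f x₀ c t a ω⟫) ∂P ≤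
      ∫⁻ ω, W ω * expE (2 * Θ * ‖u ω‖ ^ 2) ∂P := by
  have hle := R.sigma_mono (history_subset_partialHistory (n := n) t ∅)
  refine (lintegral_exp_inner_sum_le (P := P) (𝓖 := fun B => R.sigma (partialHistory t B))
    (fun _ _ h => R.sigma_mono (partialHistory_mono t h))
    (fun B a ha => measurable_drawNoise (η := η) (p := p) (x₀ := x₀) hσ hG hC c t ha)
    (fun B a ha => condSubG_drawNoise (η := η) (p := p) (x₀ := x₀) hσ hG hC hτ hc t ha)
    A (hu.mono hle le_rfl) (hW.mono hle le_rfl)).trans (lintegral_mono fun ω => ?_)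
  refine mul_le_mul_right (expE_mono ?_) _
  gcongr

/-- High-probability bound for the squared norms of the mean noise. -/
lemma measure_sum_norm_sq_meanNoise (hn : 0 < n) (hp : 0 < p) {Θ : ℝ}
    (hΘ : τ + 6 * σ ^ 2 / (n * p) ≤ Θ) (N : ℕ) (ι : ℝ) :
    P {ω | 16 * Θ * (N + ι) ≤ ∑ t ∈ Finset.range N, ‖meanNoise R η p G C f x₀ t ω‖ ^ 2} ≤
      expE (-ι) := by
  have hΘ0 : 0 < Θ := by have := hτ.pos; exact lt_of_lt_of_le (by positivity) hΘ
  have hc : (0 : ℝ) < 1 / (n * p) := by positivity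
  refine (measure_mono ?_).trans (measure_sum_ge_le_of_cond (P := P)
    (𝓖 := fun t => R.sigma (history n t)) (fun t => R.sigma_le _)
    (sigma_history_mono R) (Z := fun t ω =>
      ‖∑ a ∈ allDraws n p, drawNoise R η p G C f x₀ (1 / (n * p)) t a ω‖ ^ 2 / (16 * Θ))
    (fun t => (by fun_prop : Measurable fun y : Vec d => ‖y‖ ^ 2 / (16 * Θ)).comp
      (measurable_noise_sum hσ hG hC _ t _)) (b := 1)
    (fun t W hW => lintegral_exp_norm_sq_noise_le hσ hG hC hτ hc t _ hΘ0
      ((sum_drawParam_allDraws hn hp σ τ).trans_le hΘ) hW) N ι)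
  intro ω hω
  simp only [Set.mem_ofPred_eq, meanNoise_eq_sum _ _ _ _ _ _ hn hp] at hω ⊢
  rw [← Finset.sum_div, le_div_iff₀ (by positivity)]
  linarith

/-- High-probability bound for the squared norms of the noise of the clients. -/
lemma measure_sum_norm_sq_clientNoise (hn : 0 < n) (hp : 0 < p) {Θ : ℝ}
    (hΘ : τ + 6 * σ ^ 2 / p ≤ Θ) (N : ℕ) (ι : ℝ) :
    P {ω | 16 * Θ * (N + ι) ≤ ∑ t ∈ Finset.range N,
      (1 / (n : ℝ)) * ∑ i, ‖clientNoise R η p G C f x₀ i t ω‖ ^ 2} ≤ expE (-ι) := by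
  have hΘ0 : 0 < Θ := by have := hτ.pos; exact lt_of_lt_of_le (by positivity) hΘ
  have hn0 : (0 : ℝ) < n := by positivity
  have hc : (0 : ℝ) < 1 / p := by positivity
  set X : Fin n → ℕ → Ω → Vec d := fun i t ω =>
    ∑ a ∈ clientDraws p i, drawNoise R η p G C f x₀ (1 / p) t a ω with hX
  have hXm : ∀ i t, Measurable[R.sigma (history n (t + 1))] (X i t) := fun i t =>
    measurable_noise_sum hσ hG hC _ t _
  have hYm : ∀ i t, Measurable[R.sigma (history n (t + 1))]
      fun ω => ‖X i t ω‖ ^ 2 / (16 * Θ) := fun i t =>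
    (by fun_prop : Measurable fun y : Vec d => ‖y‖ ^ 2 / (16 * Θ)).comp (hXm i t)
  have hZm : ∀ t, Measurable[R.sigma (history n (t + 1))]
      fun ω => ∑ i, (1 / (n : ℝ)) * (‖X i t ω‖ ^ 2 / (16 * Θ)) := fun t =>
    @Finset.measurable_fun_sum _ _ _ _ _ _ (R.sigma (history n (t + 1))) _ _ fun i _ =>
      (measurable_const_mul (1 / (n : ℝ))).comp (hYm i t)
  have hstep : ∀ t (W : Ω → ℝ≥0∞), Measurable[R.sigma (history n t)] W →
      ∫⁻ ω, W ω * expE (∑ i, (1 / (n : ℝ)) * (‖X i t ω‖ ^ 2 / (16 * Θ))) ∂P ≤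
        expE 1 * ∫⁻ ω, W ω ∂P := by
    intro t W hW
    -- All clients share the perturbation, so their noises are dependent. Jensen over the clients
    -- needs only the individual moments.
    have hjensen : ∀ ω, expE (∑ i, (1 / (n : ℝ)) * (‖X i t ω‖ ^ 2 / (16 * Θ))) ≤
        ∑ i, ENNReal.ofReal (1 / n) * expE (‖X i t ω‖ ^ 2 / (16 * Θ)) := by
      intro ω
      have := convexOn_exp.map_sum_le (t := Finset.univ) (w := fun _ : Fin n => 1 / (n : ℝ))
        (p := fun i => ‖X i t ω‖ ^ 2 / (16 * Θ)) (fun _ _ => by positivity)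
        (by simp [hn0.ne']) (fun _ _ => Set.mem_univ _)
      simp only [smul_eq_mul] at this
      unfold expE
      simp only [← ENNReal.ofReal_mul (one_div_nonneg.2 hn0.le)]
      rw [← ENNReal.ofReal_sum_of_nonneg fun k _ => by positivity]
      exact ENNReal.ofReal_le_ofReal this
    have hWm : Measurable W := hW.mono (R.sigma_le _) le_rfl
    have hem : ∀ i, Measurable fun ω => expE (‖X i t ω‖ ^ 2 / (16 * Θ)) := fun i =>
      measurable_expE.comp ((hYm i t).mono (R.sigma_le _) le_rfl)
    calc _ ≤ ∫⁻ ω, ∑ i, ENNReal.ofReal (1 / n) * (W ω * expE (‖X i t ω‖ ^ 2 / (16 * Θ))) ∂P := by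
          refine lintegral_mono fun ω => ?_
          refine (mul_le_mul_right (hjensen ω) _).trans_eq ?_
          rw [Finset.mul_sum]
          exact Finset.sum_congr rfl fun i _ => mul_left_comm _ _ _
      _ = ∑ i, ENNReal.ofReal (1 / n) * ∫⁻ ω, W ω * expE (‖X i t ω‖ ^ 2 / (16 * Θ)) ∂P := by
          have hm : ∀ i ∈ Finset.univ, Measurable fun ω =>
              ENNReal.ofReal (1 / n) * (W ω * expE (‖X i t ω‖ ^ 2 / (16 * Θ))) :=
            fun i _ => (hWm.mul (hem i)).const_mul _
          rw [lintegral_finsetSum _ hm]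
          exact Finset.sum_congr rfl fun i _ => lintegral_const_mul' _ _ ENNReal.ofReal_ne_top
      _ ≤ ∑ _i : Fin n, ENNReal.ofReal (1 / n) * (expE 1 * ∫⁻ ω, W ω ∂P) := by
          gcongr with i
          exact lintegral_exp_norm_sq_noise_le hσ hG hC hτ hc t _ hΘ0
            ((sum_drawParam_clientDraws hp σ τ i).trans_le hΘ) hW
      _ = _ := by
          rw [Finset.sum_const, Finset.card_univ, Fintype.card_fin, nsmul_eq_mul, ← mul_assoc,
            ← ENNReal.ofReal_natCast, ← ENNReal.ofReal_mul hn0.le, mul_one_div_cancel hn0.ne',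
            ENNReal.ofReal_one, one_mul]
  refine (measure_mono ?_).trans (measure_sum_ge_le_of_cond (P := P)
    (𝓖 := fun t => R.sigma (history n t)) (fun t => R.sigma_le _)
    (sigma_history_mono R) hZm (b := 1) hstep N ι)
  intro ω hω
  simp only [Set.mem_ofPred_eq, clientNoise_eq_sum _ _ _ _ _ _ hp] at hω ⊢
  simp only [← Finset.mul_sum, ← Finset.sum_div, mul_div_assoc'] at hω ⊢
  rw [le_div_iff₀ (by positivity)]
  linarith

/-- High-probability bound for the martingale formed with the mean noise. -/
lemma measure_sum_inner_meanNoise (hn : 0 < n) (hp : 0 < p) {Θ : ℝ}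
    (hΘ : τ + 6 * σ ^ 2 / (n * p) ≤ Θ) {u : ℕ → Ω → Vec d}
    (hu : ∀ t, Measurable[R.sigma (history n t)] (u t)) (N : ℕ) (ι : ℝ) :
    P {ω | 8 * Θ * ι + 1 / 4 * ∑ t ∈ Finset.range N, ‖u t ω‖ ^ 2 ≤
      ∑ t ∈ Finset.range N, ⟪u t ω, meanNoise R η p G C f x₀ t ω⟫} ≤ expE (-ι) := by
  have hΘ0 : 0 < Θ := by have := hτ.pos; exact lt_of_lt_of_le (by positivity) hΘ
  have hc : (0 : ℝ) < 1 / (n * p) := by positivity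
  set X : ℕ → Ω → Vec d := fun t ω =>
    ∑ a ∈ allDraws n p, drawNoise R η p G C f x₀ (1 / (n * p)) t a ω with hX
  -- This value solves $2\Theta l^2=l/4$: the compensator of $\langle lu_t,X_t\rangle$ is exactly
  -- $l/4\,\|u_t\|^2$, so the drift $b$ below is 0.
  set l : ℝ := 1 / (8 * Θ) with hl
  have hl0 : 0 < l := by positivity
  have hum : ∀ t, Measurable[R.sigma (history n (t + 1))] (u t) := fun t =>
    (hu t).mono (R.sigma_mono (history_mono t.le_succ)) le_rfl
  have hq : Measurable fun y : Vec d => -(l / 4 * ‖y‖ ^ 2) := by fun_prop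
  have hXm : ∀ t, Measurable[R.sigma (history n (t + 1))] (X t) := fun t =>
    measurable_noise_sum hσ hG hC _ t _
  have hZm : ∀ t, Measurable[R.sigma (history n (t + 1))]
      fun ω => -(l / 4 * ‖u t ω‖ ^ 2) + ⟪l • u t ω, X t ω⟫ := by
    intro t
    have h1 := hq.comp (hum t)
    have h2 : Measurable[R.sigma (history n (t + 1))] fun ω => l • u t ω :=
      (measurable_const_smul l).comp (hum t)
    exact h1.add (h2.inner (hXm t))
  have hstep : ∀ t (W : Ω → ℝ≥0∞), Measurable[R.sigma (history n t)] W →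
      ∫⁻ ω, W ω * expE (-(l / 4 * ‖u t ω‖ ^ 2) + ⟪l • u t ω, X t ω⟫) ∂P ≤
        expE 0 * ∫⁻ ω, W ω ∂P := by
    intro t W hW
    have hW' : Measurable[R.sigma (history n t)] fun ω => W ω * expE (-(l / 4 * ‖u t ω‖ ^ 2)) :=
      hW.mul ((measurable_expE.comp (by fun_prop :
        Measurable fun y : Vec d => -(l / 4 * ‖y‖ ^ 2))).comp (hu t))
    have hu' : Measurable[R.sigma (history n t)] fun ω => l • u t ω :=
      (measurable_const_smul l).comp (hu t)
    have h := lintegral_exp_inner_noise_le (η := η) (p := p) (x₀ := x₀) hσ hG hC hτ hc t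
      (allDraws n p) ((sum_drawParam_allDraws hn hp σ τ).trans_le hΘ) hW' hu'
    rw [expE_zero, one_mul]
    calc _ = ∫⁻ ω, W ω * expE (-(l / 4 * ‖u t ω‖ ^ 2)) * expE (⟪l • u t ω, X t ω⟫) ∂P := by
          refine lintegral_congr fun ω => ?_
          rw [expE_add, mul_assoc]
      _ ≤ _ := h
      _ = ∫⁻ ω, W ω ∂P := by
          refine lintegral_congr fun ω => ?_
          rw [mul_assoc, ← expE_add, norm_smul, mul_pow, Real.norm_eq_abs, sq_abs]
          have : -(l / 4 * ‖u t ω‖ ^ 2) + 2 * Θ * (l ^ 2 * ‖u t ω‖ ^ 2) = 0 := by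
            rw [hl]; field_simp; ring
          rw [this, expE_zero, mul_one]
  refine (measure_mono ?_).trans (measure_sum_ge_le_of_cond (P := P)
    (𝓖 := fun t => R.sigma (history n t)) (fun t => R.sigma_le _)
    (sigma_history_mono R) hZm (b := 0) hstep N ι)
  intro ω hω
  simp only [Set.mem_ofPred_eq, meanNoise_eq_sum _ _ _ _ _ _ hn hp] at hω ⊢
  rw [Finset.sum_add_distrib, Finset.sum_neg_distrib, ← Finset.mul_sum]
  simp only [real_inner_smul_left]
  rw [← Finset.mul_sum]
  have := mul_le_mul_of_nonneg_left hω hl0.le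
  have e : l * (8 * Θ * ι + 1 / 4 * ∑ t ∈ Finset.range N, ‖u t ω‖ ^ 2) =
      ι + l / 4 * ∑ t ∈ Finset.range N, ‖u t ω‖ ^ 2 := by
    rw [hl]; field_simp
  linarith

end Concentration

end Noise

/-! ### Smoothness and the recursion for compression errors -/

section Deterministic

/-- The quadratic upper bound for a function with Lipschitz gradient. -/
lemma IsSmooth.le_quadratic {d : ℕ} {F : Vec d → ℝ} {L : ℝ} (hF : IsSmooth F L) (x y : Vec d) :
    F y ≤ F x + ⟪∇ F x, y - x⟫ + L / 2 * ‖y - x‖ ^ 2 := by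
  set w := y - x with hw
  -- The gap to the quadratic majorant along the segment; the Lipschitz gradient makes its
  -- derivative nonpositive on the unit interval.
  set φ : ℝ → ℝ := fun s => F (x + s • w) - s * ⟪∇ F x, w⟫ - L / 2 * s ^ 2 * ‖w‖ ^ 2 with hφ
  have hd : ∀ s, HasDerivAt φ (⟪∇ F (x + s • w), w⟫ - ⟪∇ F x, w⟫ - L * s * ‖w‖ ^ 2) s := by
    intro s
    have h1 : HasDerivAt (fun s : ℝ => x + s • w) w s := by
      have h := ((hasDerivAt_id s).smul_const w).const_add x
      rw [one_smul] at h
      exact h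
    have h2 : HasDerivAt (fun s => F (x + s • w)) ⟪∇ F (x + s • w), w⟫ s := by
      have hg := (hF.1 (x + s • w)).hasGradientAt.hasFDerivAt.comp_hasDerivAt s h1
      exact hg.congr_deriv (by simp)
    have h3 : HasDerivAt (fun s : ℝ => s * ⟪∇ F x, w⟫) ⟪∇ F x, w⟫ s := by
      have h := (hasDerivAt_id s).mul_const ⟪∇ F x, w⟫
      rw [one_mul] at h
      exact h
    have h4 : HasDerivAt (fun s : ℝ => L / 2 * s ^ 2 * ‖w‖ ^ 2) (L * s * ‖w‖ ^ 2) s := by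
      have h := ((hasDerivAt_pow 2 s).const_mul (L / 2)).mul_const (‖w‖ ^ 2)
      refine h.congr_deriv ?_
      push_cast; ring
    exact (h2.sub h3).sub h4
  have hanti : AntitoneOn φ (Set.Icc 0 1) := by
    refine antitoneOn_of_deriv_nonpos (convex_Icc 0 1)
      (fun s _ => (hd s).continuousAt.continuousWithinAt)
      (fun s _ => (hd s).differentiableAt.differentiableWithinAt) fun s hs => ?_
    rw [interior_Icc] at hs
    rw [(hd s).deriv, ← inner_sub_left]
    have h1 := real_inner_le_norm (∇ F (x + s • w) - ∇ F x) w
    have h2 := hF.2 (x + s • w) x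
    rw [add_sub_cancel_left, norm_smul, Real.norm_of_nonneg hs.1.le] at h2
    have h3 := mul_le_mul_of_nonneg_right h2 (norm_nonneg w)
    nlinarith
  have h := hanti (Set.left_mem_Icc.2 zero_le_one) (Set.right_mem_Icc.2 zero_le_one) zero_le_one
  have e0 : φ 0 = F x := by simp [hφ]
  have e1 : φ 1 = F y - ⟪∇ F x, w⟫ - L / 2 * ‖w‖ ^ 2 := by
    simp only [hφ, one_smul, one_mul, one_pow, mul_one, hw, add_sub_cancel]
  linarith

variable {E : Type*} [NormedAddCommGroup E] [InnerProductSpace ℝ E]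

lemma norm_add_sq_le_two (x y : E) : ‖x + y‖ ^ 2 ≤ 2 * ‖x‖ ^ 2 + 2 * ‖y‖ ^ 2 := by
  have := parallelogram_law_with_norm ℝ x y
  nlinarith [sq_nonneg ‖x - y‖]

lemma norm_sub_sq_le_two (x y : E) : ‖x - y‖ ^ 2 ≤ 2 * ‖x‖ ^ 2 + 2 * ‖y‖ ^ 2 := by
  rw [sub_eq_add_neg, ← norm_neg y]
  exact norm_add_sq_le_two x (-y)

omit [InnerProductSpace ℝ E] in
lemma norm_add_add_sq_le (x y z : E) :
    ‖x + y + z‖ ^ 2 ≤ 3 * ‖x‖ ^ 2 + 3 * ‖y‖ ^ 2 + 3 * ‖z‖ ^ 2 := by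
  have h : ‖x + y + z‖ ≤ ‖x‖ + ‖y‖ + ‖z‖ := norm_add₃_le
  have h2 := pow_le_pow_left₀ (norm_nonneg _) h 2
  nlinarith [sq_nonneg (‖x‖ - ‖y‖), sq_nonneg (‖x‖ - ‖z‖), sq_nonneg (‖y‖ - ‖z‖)]

lemma norm_mean_sq_le {n : ℕ} (hn : 0 < n) (v : Fin n → E) :
    ‖(1 / (n : ℝ)) • ∑ i, v i‖ ^ 2 ≤ (1 / (n : ℝ)) * ∑ i, ‖v i‖ ^ 2 := by
  have hn0 : (0 : ℝ) < n := by positivity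
  have h1 : ‖∑ i, v i‖ ^ 2 ≤ n * ∑ i, ‖v i‖ ^ 2 := by
    calc ‖∑ i, v i‖ ^ 2 ≤ (∑ i, ‖v i‖) ^ 2 :=
          pow_le_pow_left₀ (norm_nonneg _) (norm_sum_le _ _) 2
      _ ≤ n * ∑ i, ‖v i‖ ^ 2 := by
          simpa using sq_sum_le_card_mul_sum_sq (s := Finset.univ) (f := fun i => ‖v i‖)
  rw [norm_smul, mul_pow, Real.norm_of_nonneg (by positivity)]
  calc (1 / (n : ℝ)) ^ 2 * ‖∑ i, v i‖ ^ 2 ≤ (1 / (n : ℝ)) ^ 2 * (n * ∑ i, ‖v i‖ ^ 2) := by gcongr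
    _ = _ := by field_simp

/-- The previous term of a sequence, starting from zero. -/
def prevTerm (e : ℕ → E) : ℕ → E
  | 0 => 0
  | t + 1 => e t

/-- One step of error feedback with fast compressed communication. -/
lemma error_step {μ q : ℝ} (hμ : 0 < μ) (hμ1 : μ ≤ 1) (hq : 96 * (q * (1 - μ)) ≤ μ ^ 2)
    {e' e b δ e₀ : E} (h1 : ‖e'‖ ^ 2 ≤ (1 - μ) * ‖e + b + δ‖ ^ 2)
    (h2 : ‖δ‖ ^ 2 ≤ q * ‖e - e₀‖ ^ 2) :
    ‖e'‖ ^ 2 ≤ (1 - 3 * μ / 8) * ‖e‖ ^ 2 + μ / 8 * ‖e₀‖ ^ 2 + 6 / μ * ‖b‖ ^ 2 := by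
  have hs : ‖e - e₀‖ ^ 2 ≤ 2 * ‖e‖ ^ 2 + 2 * ‖e₀‖ ^ 2 := norm_sub_sq_le_two _ _
  have hv : ‖b + δ‖ ^ 2 ≤ 2 * ‖b‖ ^ 2 + 2 * ‖δ‖ ^ 2 := norm_add_sq_le_two _ _
  have h1μ : 0 ≤ 1 - μ := by linarith
  -- Young's weight $\mu/2$ spends only half of the contraction: $(1-\mu)(1+\mu/2)\le1-\mu/2$.
  have hyoung : ‖e + (b + δ)‖ ^ 2 ≤ (1 + μ / 2) * ‖e‖ ^ 2 + (1 + 2 / μ) * ‖b + δ‖ ^ 2 := by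
    have ht := pow_le_pow_left₀ (norm_nonneg _) (norm_add_le e (b + δ)) 2
    have hz : 0 ≤ (μ * ‖e‖ - 2 * ‖b + δ‖) ^ 2 / (2 * μ) := by positivity
    have he : (μ * ‖e‖ - 2 * ‖b + δ‖) ^ 2 / (2 * μ) =
        μ / 2 * ‖e‖ ^ 2 + 2 / μ * ‖b + δ‖ ^ 2 - 2 * ‖e‖ * ‖b + δ‖ := by field_simp; ring
    nlinarith
  rw [add_assoc] at h1
  have hA : (1 - μ) * ((1 + μ / 2) * ‖e‖ ^ 2) ≤ (1 - μ / 2) * ‖e‖ ^ 2 := by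
    have : (1 - μ) * (1 + μ / 2) ≤ 1 - μ / 2 := by nlinarith
    nlinarith [sq_nonneg ‖e‖]
  have hB : (1 - μ) * ((1 + 2 / μ) * ‖b + δ‖ ^ 2) ≤ 3 / μ * (1 - μ) * ‖b + δ‖ ^ 2 := by
    have : 1 + 2 / μ ≤ 3 / μ := by
      rw [← sub_nonneg]
      have : 3 / μ - (1 + 2 / μ) = (1 - μ) / μ := by field_simp; ring
      rw [this]; positivity
    have h0 : 0 ≤ (1 - μ) * ‖b + δ‖ ^ 2 := by positivity
    nlinarith
  have hC : 3 / μ * (1 - μ) * ‖b + δ‖ ^ 2 ≤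
      6 / μ * ‖b‖ ^ 2 + μ / 8 * (‖e‖ ^ 2 + ‖e₀‖ ^ 2) := by
    have hδ : ‖b + δ‖ ^ 2 ≤ 2 * ‖b‖ ^ 2 + 2 * ‖δ‖ ^ 2 := hv
    have e1 : 3 / μ * (1 - μ) * ‖b + δ‖ ^ 2 ≤ 3 / μ * (1 - μ) * (2 * ‖b‖ ^ 2 + 2 * ‖δ‖ ^ 2) :=
      mul_le_mul_of_nonneg_left hδ (by positivity)
    have e2 : 3 / μ * (1 - μ) * (2 * ‖b‖ ^ 2) ≤ 6 / μ * ‖b‖ ^ 2 := by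
      have : 3 / μ * (1 - μ) * (2 * ‖b‖ ^ 2) = 6 / μ * ‖b‖ ^ 2 - 6 * ‖b‖ ^ 2 := by
        field_simp; ring
      nlinarith [sq_nonneg ‖b‖]
    -- Here the accuracy of the fast rounds is used: after multiplication by $6/\mu$ the residual
    -- costs only $\mu/8$ on each of $\|e\|^2$ and $\|e_0\|^2$.
    have e3 : (1 - μ) * ‖δ‖ ^ 2 ≤ μ ^ 2 / 48 * (‖e‖ ^ 2 + ‖e₀‖ ^ 2) := by
      by_cases hq0 : 0 ≤ q
      · have a1 : (1 - μ) * ‖δ‖ ^ 2 ≤ (1 - μ) * (q * (2 * ‖e‖ ^ 2 + 2 * ‖e₀‖ ^ 2)) := by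
          refine mul_le_mul_of_nonneg_left (h2.trans ?_) h1μ
          exact mul_le_mul_of_nonneg_left hs hq0
        have a2 : 0 ≤ ‖e‖ ^ 2 + ‖e₀‖ ^ 2 := by positivity
        nlinarith
      · have a1 : ‖δ‖ ^ 2 ≤ 0 := h2.trans (mul_nonpos_of_nonpos_of_nonneg (by linarith) (sq_nonneg _))
        have a2 : 0 ≤ μ ^ 2 / 48 * (‖e‖ ^ 2 + ‖e₀‖ ^ 2) := by positivity
        nlinarith
    have e4 : 3 / μ * (1 - μ) * (2 * ‖δ‖ ^ 2) ≤ μ / 8 * (‖e‖ ^ 2 + ‖e₀‖ ^ 2) := by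
      calc 3 / μ * (1 - μ) * (2 * ‖δ‖ ^ 2) = 6 / μ * ((1 - μ) * ‖δ‖ ^ 2) := by ring
        _ ≤ 6 / μ * (μ ^ 2 / 48 * (‖e‖ ^ 2 + ‖e₀‖ ^ 2)) := by gcongr
        _ = _ := by field_simp; ring
    nlinarith
  nlinarith [mul_le_mul_of_nonneg_left hyoung h1μ]

/-- The accumulated compression errors are controlled by the accumulated increments. -/
lemma sum_error_le {μ q : ℝ} (hμ : 0 < μ) (hμ1 : μ ≤ 1) (hq : 96 * (q * (1 - μ)) ≤ μ ^ 2)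
    {e b δ : ℕ → E} (h0 : e 0 = 0)
    (h1 : ∀ t, ‖e (t + 1)‖ ^ 2 ≤ (1 - μ) * ‖e t + b t + δ t‖ ^ 2)
    (h2 : ∀ t, ‖δ t‖ ^ 2 ≤ q * ‖e t - prevTerm e t‖ ^ 2) (N : ℕ) :
    ∑ t ∈ Finset.range N, ‖e t‖ ^ 2 ≤ 24 / μ ^ 2 * ∑ t ∈ Finset.range N, ‖b t‖ ^ 2 := by
  set s := ∑ t ∈ Finset.range N, ‖e t‖ ^ 2
  set B := ∑ t ∈ Finset.range N, ‖b t‖ ^ 2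
  have hsucc : ∑ t ∈ Finset.range N, ‖e (t + 1)‖ ^ 2 = s + ‖e N‖ ^ 2 := by
    have := Finset.sum_range_succ' (fun t => ‖e t‖ ^ 2) N
    rw [Finset.sum_range_succ, h0, norm_zero] at this
    simp only [s]
    linarith
  have hprev : ∑ t ∈ Finset.range N, ‖prevTerm e t‖ ^ 2 ≤ s := by
    rcases N with _ | N
    · simp [s]
    · rw [Finset.sum_range_succ']
      simp only [prevTerm, norm_zero, s]
      rw [Finset.sum_range_succ]
      nlinarith [sq_nonneg ‖e N‖]
  have hsum : ∑ t ∈ Finset.range N, ‖e (t + 1)‖ ^ 2 ≤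
      (1 - 3 * μ / 8) * s + μ / 8 * ∑ t ∈ Finset.range N, ‖prevTerm e t‖ ^ 2 + 6 / μ * B := by
    simp only [s, B]
    rw [Finset.mul_sum, Finset.mul_sum, Finset.mul_sum, ← Finset.sum_add_distrib,
      ← Finset.sum_add_distrib]
    exact Finset.sum_le_sum fun t _ => error_step hμ hμ1 hq (h1 t) (h2 t)
  -- Of the contraction $3\mu/8$, the shifted sum takes back $\mu/8$.
  have hfin : μ / 4 * s ≤ 6 / μ * B := by nlinarith [sq_nonneg ‖e N‖]
  have : s = 4 / μ * (μ / 4 * s) := by field_simp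
  rw [this]
  calc 4 / μ * (μ / 4 * s) ≤ 4 / μ * (6 / μ * B) := by gcongr
    _ = _ := by field_simp; ring

end Deterministic

/-! ### Descent along the virtual iterates -/

section Convergence

/-- The average of finitely many vectors. -/
def mean {n d : ℕ} (v : Fin n → Vec d) : Vec d := (1 / (n : ℝ)) • ∑ i, v i

lemma mean_add {n d : ℕ} (v w : Fin n → Vec d) :
    mean (fun i => v i + w i) = mean v + mean w := by
  simp only [mean, Finset.sum_add_distrib, smul_add]

lemma mean_sub {n d : ℕ} (v w : Fin n → Vec d) :
    mean (fun i => v i - w i) = mean v - mean w := by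
  simp only [mean, Finset.sum_sub_distrib, smul_sub]

/-- The average of the squared norms of finitely many vectors. -/
def meanSq {n d : ℕ} (v : Fin n → Vec d) : ℝ := (1 / (n : ℝ)) * ∑ i, ‖v i‖ ^ 2

lemma meanSq_nonneg {n d : ℕ} (v : Fin n → Vec d) : 0 ≤ meanSq v := by
  unfold meanSq; positivity

lemma norm_mean_sq_le_meanSq {n d : ℕ} (hn : 0 < n) (v : Fin n → Vec d) :
    ‖mean v‖ ^ 2 ≤ meanSq v := norm_mean_sq_le hn v

lemma meanSq_add_le {n d : ℕ} (v w : Fin n → Vec d) :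
    meanSq (fun i => v i + w i) ≤ 2 * meanSq v + 2 * meanSq w := by
  unfold meanSq
  have h := Finset.sum_le_sum fun i (_ : i ∈ Finset.univ) => norm_add_sq_le_two (v i) (w i)
  rw [Finset.sum_add_distrib, ← Finset.mul_sum, ← Finset.mul_sum] at h
  have := mul_le_mul_of_nonneg_left h (show (0 : ℝ) ≤ 1 / n by positivity)
  linarith

/-- The increments of the gradient estimates, averaged over the clients. -/
lemma meanSq_increment_le {n d : ℕ} {g : Fin n → Vec d → Vec d} {lip : Fin n → ℝ}
    (hlip : ∀ i x y, ‖g i x - g i y‖ ≤ lip i * ‖x - y‖) {Lt : ℝ}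
    (hLt : (1 / (n : ℝ)) * ∑ i, lip i ^ 2 ≤ Lt ^ 2) (x y : Vec d) (v w : Fin n → Vec d) :
    meanSq (fun i => g i x + v i - (g i y + w i)) ≤
      3 * (Lt ^ 2 * ‖x - y‖ ^ 2) + 3 * meanSq v + 3 * meanSq w := by
  have h : ∀ i ∈ Finset.univ, ‖g i x + v i - (g i y + w i)‖ ^ 2 ≤
      3 * (lip i ^ 2 * ‖x - y‖ ^ 2) + 3 * ‖v i‖ ^ 2 + 3 * ‖w i‖ ^ 2 := by
    intro i _
    have e : g i x + v i - (g i y + w i) = (g i x - g i y) + v i + -w i := by abel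
    have h1 := norm_add_add_sq_le (g i x - g i y) (v i) (-w i)
    have h2 := pow_le_pow_left₀ (norm_nonneg _) (hlip i x y) 2
    rw [mul_pow] at h2
    rw [e]
    rw [norm_neg] at h1
    linarith
  have hs := Finset.sum_le_sum h
  simp only [Finset.sum_add_distrib, ← Finset.mul_sum, ← Finset.sum_mul] at hs
  have h3 := mul_le_mul_of_nonneg_left hs (show (0 : ℝ) ≤ 1 / n by positivity)
  have h4 := mul_le_mul_of_nonneg_right hLt (sq_nonneg ‖x - y‖)
  unfold meanSq
  linarith

set_option maxHeartbeats 1000000 in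
/-- The deterministic part of the analysis: the squared gradient norms along a trajectory with
error feedback, in terms of the accumulated noise. -/
theorem sum_norm_gradient_sq_le {n d : ℕ} (hn : 0 < n) {F : Vec d → ℝ} {L : ℝ}
    (hF : IsSmooth F L) (hL : 0 < L) {fmin : ℝ} (hmin : ∀ x, fmin ≤ F x)
    {g : Fin n → Vec d → Vec d} (hg : ∀ x, ∇ F x = mean fun i => g i x) {lip : Fin n → ℝ}
    (hlip : ∀ i x y, ‖g i x - g i y‖ ≤ lip i * ‖x - y‖) {Lt : ℝ}
    (hLt : (1 / (n : ℝ)) * ∑ i, lip i ^ 2 ≤ Lt ^ 2) {μ q : ℝ} (hμ : 0 < μ) (hμ1 : μ ≤ 1)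
    (hq : 96 * (q * (1 - μ)) ≤ μ ^ 2) {η : ℝ} (hη : 0 < η) (hη1 : 8 * (L * η) ≤ 1)
    (hη2 : 864 * (Lt ^ 2 * η ^ 2) ≤ μ ^ 2) {x : ℕ → Vec d} {e a v δ : Fin n → ℕ → Vec d}
    (ha : ∀ i t, a i t = g i (x t) + v i t) (he0 : ∀ i, e i 0 = 0)
    (h1 : ∀ i t, ‖e i (t + 1)‖ ^ 2 ≤
      (1 - μ) * ‖e i t + (a i t - prevTerm (a i) t) + δ i t‖ ^ 2)
    (h2 : ∀ i t, ‖δ i t‖ ^ 2 ≤ q * ‖e i t - prevTerm (e i) t‖ ^ 2)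
    (hx : ∀ t, x (t + 1) = x t - η • mean fun i => e i t + a i t - e i (t + 1))
    {y : ℕ → Vec d} (hy : ∀ t, y t = x t - η • mean fun i => e i t) {Φ m : ℝ}
    (hΦ : meanSq (fun i => g i (x 0)) ≤ Φ) (N : ℕ)
    (hm : ∑ t ∈ Finset.range N, ⟪-∇ F (y t), mean fun i => v i t⟫ ≤
      m + 1 / 4 * ∑ t ∈ Finset.range N, ‖-∇ F (y t)‖ ^ 2) :
    η / 4 * ∑ t ∈ Finset.range N, ‖∇ F (x t)‖ ^ 2 ≤ F (x 0) - fmin + η * m +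
      L ^ 2 * η ^ 3 * (48 * Φ + 144 * ∑ t ∈ Finset.range N, meanSq fun i => v i t) / μ ^ 2 +
      (L * η ^ 2 + L ^ 2 * η ^ 3 / 2) *
        ∑ t ∈ Finset.range N, ‖mean fun i => v i t‖ ^ 2 := by
  set D := ∑ t ∈ Finset.range N, ‖∇ F (x t)‖ ^ 2 with hD
  set Z := ∑ t ∈ Finset.range N, ‖mean fun i => v i t‖ ^ 2 with hZ
  set V := ∑ t ∈ Finset.range N, meanSq fun i => v i t with hV
  set Q := ∑ t ∈ Finset.range N, meanSq fun i => e i t with hQ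
  set B := ∑ t ∈ Finset.range N, meanSq fun i => a i t - prevTerm (a i) t with hB
  set Y := ∑ t ∈ Finset.range N, ‖∇ F (y t)‖ ^ 2 with hY
  have hn0 : (0 : ℝ) < n := by positivity
  have hQ0 : 0 ≤ Q := Finset.sum_nonneg fun _ _ => meanSq_nonneg _
  have hD0 : 0 ≤ D := Finset.sum_nonneg fun _ _ => sq_nonneg _
  have hZ0 : 0 ≤ Z := Finset.sum_nonneg fun _ _ => sq_nonneg _
  have hV0 : 0 ≤ V := Finset.sum_nonneg fun _ _ => meanSq_nonneg _
  have hΦ0 : 0 ≤ Φ := (meanSq_nonneg _).trans hΦ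
  have hma : ∀ t, (mean fun i => a i t) = ∇ F (x t) + mean fun i => v i t := fun t => by
    simp only [ha, mean_add, hg]
  -- The correction by $\eta\bar e_t$ telescopes against the errors in the update of $x$: the
  -- virtual iterates follow uncompressed stochastic gradient descent, with gradients taken at
  -- $x_t$.
  have hystep : ∀ t, y (t + 1) = y t - η • (∇ F (x t) + mean fun i => v i t) := by
    intro t
    rw [hy, hy, hx, ← hma, mean_sub, mean_add, smul_sub, smul_add]
    abel
  -- compression errors in terms of the increments
  have hQB : Q ≤ 24 / μ ^ 2 * B := by
    have hi := fun i => sum_error_le hμ hμ1 hq (he0 i) (h1 i) (h2 i) N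
    have hs := Finset.sum_le_sum fun i (_ : i ∈ Finset.univ) => hi i
    rw [← Finset.mul_sum, Finset.sum_comm, Finset.sum_comm (s := Finset.univ)] at hs
    simp only [hQ, hB, meanSq, ← Finset.mul_sum]
    have := mul_le_mul_of_nonneg_left hs (show (0 : ℝ) ≤ 1 / n by positivity)
    linarith
  have hxstep : ∀ t, ‖x (t + 1) - x t‖ ^ 2 ≤ 3 * η ^ 2 * (2 * ‖∇ F (x t)‖ ^ 2 +
      2 * ‖mean fun i => v i t‖ ^ 2 + meanSq (fun i => e i t) +
      meanSq (fun i => e i (t + 1))) := by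
    intro t
    have he : x (t + 1) - x t = (-η) • ((∇ F (x t) + mean fun i => v i t) + (mean fun i => e i t) +
        -mean fun i => e i (t + 1)) := by
      rw [hx, mean_sub, mean_add, hma, neg_smul]
      simp only [smul_add, smul_sub, smul_neg]
      abel
    rw [he, norm_smul, mul_pow, Real.norm_eq_abs, abs_neg, sq_abs]
    have t1 := norm_add_add_sq_le (∇ F (x t) + mean fun i => v i t) (mean fun i => e i t)
      (-mean fun i => e i (t + 1))
    have t2 := norm_add_sq_le_two (∇ F (x t)) (mean fun i => v i t)
    have t3 := norm_mean_sq_le_meanSq hn fun i => e i t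
    have t4 := norm_mean_sq_le_meanSq hn fun i => e i (t + 1)
    rw [norm_neg] at t1
    rw [show 3 * η ^ 2 * (2 * ‖∇ F (x t)‖ ^ 2 + 2 * ‖mean fun i => v i t‖ ^ 2 +
      meanSq (fun i => e i t) + meanSq (fun i => e i (t + 1))) = η ^ 2 * (3 * (2 * ‖∇ F (x t)‖ ^ 2 +
      2 * ‖mean fun i => v i t‖ ^ 2 + meanSq (fun i => e i t) +
      meanSq (fun i => e i (t + 1)))) by ring]
    refine mul_le_mul_of_nonneg_left ?_ (sq_nonneg η)
    linarith
  have hBle : B ≤ 2 * Φ + 6 * V + 18 * (Lt ^ 2 * η ^ 2) * (D + Z + Q) := by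
    rcases N with _ | K
    · simp only [hB, hV, hD, hZ, hQ, Finset.sum_range_zero]
      linarith
    -- `prevTerm` starts at zero, so the first increment is the full estimate at $x_0$. This is the
    -- only appearance of the clients' own gradient norms.
    have hzero : meanSq (fun i => a i 0 - prevTerm (a i) 0) ≤
        2 * Φ + 2 * meanSq (fun i => v i 0) := by
      simp only [prevTerm, sub_zero, ha]
      exact (meanSq_add_le _ _).trans (by linarith)
    have hsucc : ∀ t ∈ Finset.range K, meanSq (fun i => a i (t + 1) - prevTerm (a i) (t + 1)) ≤
        9 * (Lt ^ 2 * η ^ 2) * (2 * ‖∇ F (x t)‖ ^ 2 + 2 * ‖mean fun i => v i t‖ ^ 2 +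
          meanSq (fun i => e i t) + meanSq (fun i => e i (t + 1))) +
        3 * meanSq (fun i => v i (t + 1)) + 3 * meanSq (fun i => v i t) := by
      intro t _
      simp only [prevTerm, ha]
      have t1 := meanSq_increment_le hlip hLt (x (t + 1)) (x t) (fun i => v i (t + 1))
        (fun i => v i t)
      have t2 := mul_le_mul_of_nonneg_left (hxstep t) (sq_nonneg Lt)
      linarith
    have hs := Finset.sum_le_sum hsucc
    simp only [Finset.sum_add_distrib, ← Finset.mul_sum] at hs
    have b1 : B = ∑ t ∈ Finset.range K, meanSq (fun i => a i (t + 1) - prevTerm (a i) (t + 1)) +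
        meanSq (fun i => a i 0 - prevTerm (a i) 0) := Finset.sum_range_succ' _ _
    have v1 : V = ∑ t ∈ Finset.range K, meanSq (fun i => v i (t + 1)) +
        meanSq (fun i => v i 0) := Finset.sum_range_succ' _ _
    have q1 : Q = ∑ t ∈ Finset.range K, meanSq (fun i => e i (t + 1)) +
        meanSq (fun i => e i 0) := Finset.sum_range_succ' _ _
    have v2 : V = ∑ t ∈ Finset.range K, meanSq (fun i => v i t) +
        meanSq (fun i => v i K) := Finset.sum_range_succ _ _
    have q2 : Q = ∑ t ∈ Finset.range K, meanSq (fun i => e i t) +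
        meanSq (fun i => e i K) := Finset.sum_range_succ _ _
    have d2 : D = ∑ t ∈ Finset.range K, ‖∇ F (x t)‖ ^ 2 + ‖∇ F (x K)‖ ^ 2 :=
      Finset.sum_range_succ _ _
    have z2 : Z = ∑ t ∈ Finset.range K, ‖mean fun i => v i t‖ ^ 2 + ‖mean fun i => v i K‖ ^ 2 :=
      Finset.sum_range_succ _ _
    have n1 := meanSq_nonneg fun i => v i K
    have n2 := meanSq_nonneg fun i => e i K
    have n3 := meanSq_nonneg fun i => e i 0
    have n4 := meanSq_nonneg fun i => v i 0
    have n5 := sq_nonneg ‖∇ F (x K)‖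
    have n6 := sq_nonneg ‖mean fun i => v i K‖
    have hc : 0 ≤ 9 * (Lt ^ 2 * η ^ 2) := by positivity
    have hmain : 9 * (Lt ^ 2 * η ^ 2) * (2 * ∑ t ∈ Finset.range K, ‖∇ F (x t)‖ ^ 2 +
        2 * ∑ t ∈ Finset.range K, ‖mean fun i => v i t‖ ^ 2 +
        ∑ t ∈ Finset.range K, meanSq (fun i => e i t) +
        ∑ t ∈ Finset.range K, meanSq (fun i => e i (t + 1))) ≤
        9 * (Lt ^ 2 * η ^ 2) * (2 * D + 2 * Z + Q + Q) :=
      mul_le_mul_of_nonneg_left (by linarith) hc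
    linarith
  -- The two bounds are circular in `Q`. As $24\cdot18=432$ is half of 864, the step-size condition
  -- gives the feedback coefficient 1/2, and `Q` is absorbed on the left.
  have hQle : Q ≤ (96 * Φ + 288 * V) / μ ^ 2 + D + Z := by
    have t1 : 24 / μ ^ 2 * B ≤
        24 / μ ^ 2 * (2 * Φ + 6 * V + 18 * (Lt ^ 2 * η ^ 2) * (D + Z + Q)) := by gcongr
    have t2 : 24 / μ ^ 2 * (18 * (Lt ^ 2 * η ^ 2) * (D + Z + Q)) ≤ 1 / 2 * (D + Z + Q) := by
      rw [← mul_assoc]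
      refine mul_le_mul_of_nonneg_right ?_ (by positivity)
      rw [div_mul_eq_mul_div, div_le_iff₀ (by positivity)]
      linarith
    have t3 : 24 / μ ^ 2 * (2 * Φ + 6 * V) = (96 * Φ + 288 * V) / μ ^ 2 / 2 := by ring
    rw [mul_add, t3] at t1
    linarith
  -- descent along the virtual iterates
  have hdesc : ∀ t, F (y (t + 1)) ≤ F (y t) - η / 2 * ‖∇ F (y t)‖ ^ 2 - η / 2 * ‖∇ F (x t)‖ ^ 2 +
      L ^ 2 * η ^ 3 / 2 * meanSq (fun i => e i t) + η * ⟪-∇ F (y t), mean fun i => v i t⟫ +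
      L * η ^ 2 * (‖∇ F (x t)‖ ^ 2 + ‖mean fun i => v i t‖ ^ 2) := by
    intro t
    have t1 := hF.le_quadratic (y t) (y (t + 1))
    have hyy : y (t + 1) - y t = (-η) • (∇ F (x t) + mean fun i => v i t) := by
      rw [hystep, neg_smul]; abel
    rw [hyy, inner_smul_right, inner_add_right, norm_smul, mul_pow, Real.norm_eq_abs, abs_neg,
      sq_abs] at t1
    have t2 := norm_add_sq_le_two (∇ F (x t)) (mean fun i => v i t)
    -- Polarisation turns $-\langle\nabla F(y_t),\nabla F(x_t)\rangle$ into minus half of both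
    -- squares, plus half of the squared difference. The $y$-square later absorbs the martingale's
    -- quadratic term, the $x$-square is the quantity to be bounded.
    have t3 := norm_sub_sq_real (∇ F (y t)) (∇ F (x t))
    have t4 : ‖∇ F (y t) - ∇ F (x t)‖ ^ 2 ≤ L ^ 2 * η ^ 2 * meanSq (fun i => e i t) := by
      have s1 := hF.2 (y t) (x t)
      have s2 : y t - x t = (-η) • mean fun i => e i t := by rw [hy, neg_smul]; abel
      rw [s2, norm_smul, Real.norm_eq_abs, abs_neg, abs_of_pos hη] at s1
      have s3 := pow_le_pow_left₀ (norm_nonneg _) s1 2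
      have s4 := mul_le_mul_of_nonneg_left (norm_mean_sq_le_meanSq hn fun i => e i t)
        (show 0 ≤ L ^ 2 * η ^ 2 by positivity)
      calc _ ≤ _ := s3
        _ = L ^ 2 * η ^ 2 * ‖mean fun i => e i t‖ ^ 2 := by ring
        _ ≤ _ := s4
    have t5 := mul_le_mul_of_nonneg_left t4 (show 0 ≤ η / 2 by positivity)
    have t6 := mul_le_mul_of_nonneg_left t2 (show 0 ≤ L / 2 * η ^ 2 by positivity)
    rw [t3] at t5
    rw [inner_neg_left]
    linarith
  have htel : F (y N) ≤ F (y 0) - η / 2 * Y - η / 2 * D + L ^ 2 * η ^ 3 / 2 * Q +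
      η * ∑ t ∈ Finset.range N, ⟪-∇ F (y t), mean fun i => v i t⟫ + L * η ^ 2 * (D + Z) := by
    have hs := Finset.sum_le_sum fun t (_ : t ∈ Finset.range N) =>
      (show F (y (t + 1)) - F (y t) ≤ L ^ 2 * η ^ 3 / 2 * meanSq (fun i => e i t) +
        η * ⟪-∇ F (y t), mean fun i => v i t⟫ +
        L * η ^ 2 * (‖∇ F (x t)‖ ^ 2 + ‖mean fun i => v i t‖ ^ 2) -
        η / 2 * (‖∇ F (y t)‖ ^ 2 + ‖∇ F (x t)‖ ^ 2) by linarith [hdesc t])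
    rw [Finset.sum_range_sub (fun t => F (y t))] at hs
    simp only [Finset.sum_add_distrib, Finset.sum_sub_distrib, ← Finset.mul_sum] at hs
    linarith
  have hy0 : y 0 = x 0 := by
    have : (mean fun i => e i 0) = 0 := by simp [mean, he0]
    rw [hy, this, smul_zero, sub_zero]
  have hY' : ∑ t ∈ Finset.range N, ‖-∇ F (y t)‖ ^ 2 = Y := by simp only [norm_neg, hY]
  have hY0 : 0 ≤ Y := Finset.sum_nonneg fun _ _ => sq_nonneg _
  rw [hY'] at hm
  rw [hy0] at htel
  have hm' := mul_le_mul_of_nonneg_left hm hη.le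
  have hQ' := mul_le_mul_of_nonneg_left hQle (show 0 ≤ L ^ 2 * η ^ 3 / 2 by positivity)
  have hYη : 0 ≤ η * Y := by positivity
  -- The error terms take back $\eta/8+\eta/128$ of the available $\eta/2$, more than enough to keep
  -- $\eta/4$.
  have c1 : L * η ^ 2 * D ≤ η / 8 * D := by
    refine mul_le_mul_of_nonneg_right ?_ hD0
    linarith [mul_le_mul_of_nonneg_left hη1 hη.le]
  have c2 : L ^ 2 * η ^ 3 / 2 * D ≤ η / 128 * D := by
    refine mul_le_mul_of_nonneg_right ?_ hD0
    have h64 : 64 * (L * η) ^ 2 ≤ 1 := by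
      have := pow_le_pow_left₀ (show 0 ≤ 8 * (L * η) by positivity) hη1 2
      linarith
    linarith [mul_le_mul_of_nonneg_left h64 hη.le]
  have hηD : 0 ≤ η * D := by positivity
  have hmN := hmin (y N)
  have e1 : L ^ 2 * η ^ 3 / 2 * ((96 * Φ + 288 * V) / μ ^ 2 + D + Z) =
    L ^ 2 * η ^ 3 * (48 * Φ + 144 * V) / μ ^ 2 + L ^ 2 * η ^ 3 / 2 * D +
      L ^ 2 * η ^ 3 / 2 * Z := by ring
  rw [e1] at hQ'
  linarith

/-- If the average of the squared gradient norms is small, most points are nearly stationary. -/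
lemma three_quarters_le_ncard {d : ℕ} {F : Vec d → ℝ} {ε : ℝ} (hε : 0 < ε) (x : ℕ → Vec d)
    (T : ℕ) (h : 4 * ∑ t ∈ Finset.range (T + 1), ‖∇ F (x t)‖ ^ 2 ≤ ε ^ 2 * (T + 1)) :
    (3 / 4 : ℝ) * (T + 1) ≤ (Set.ncard {t : ℕ | t ≤ T ∧ IsFOSP F ε (x t)} : ℝ) := by
  classical
  set A := (Finset.range (T + 1)).filter fun t => IsFOSP F ε (x t) with hA
  set A' := (Finset.range (T + 1)).filter fun t => ¬ IsFOSP F ε (x t) with hA'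
  have hset : {t : ℕ | t ≤ T ∧ IsFOSP F ε (x t)} = (A : Set ℕ) := by
    ext t
    simp [hA]
  rw [hset, Set.ncard_coe_finset]
  have hcard : A.card + A'.card = T + 1 := by
    rw [hA, hA', Finset.card_filter_add_card_filter_not, Finset.card_range]
  have hcard' : (A.card : ℝ) + A'.card = T + 1 := by exact_mod_cast hcard
  have hsum : ε ^ 2 * A'.card ≤ ∑ t ∈ Finset.range (T + 1), ‖∇ F (x t)‖ ^ 2 := by
    calc ε ^ 2 * A'.card = ∑ _t ∈ A', ε ^ 2 := by rw [Finset.sum_const, nsmul_eq_mul, mul_comm]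
      _ ≤ ∑ t ∈ A', ‖∇ F (x t)‖ ^ 2 := by
          refine Finset.sum_le_sum fun t ht => ?_
          have := not_le.1 (Finset.mem_filter.1 ht).2
          exact pow_le_pow_left₀ hε.le this.le 2
      _ ≤ _ := Finset.sum_le_sum_of_subset_of_nonneg (Finset.filter_subset _ _)
          fun _ _ _ => sq_nonneg _
  have hε2 : 0 < ε ^ 2 := by positivity
  have : 4 * (A'.card : ℝ) ≤ T + 1 := by
    by_contra hlt
    push Not at hlt
    nlinarith
  linarith

end Convergence

/-! ### Consequences of the parameter choice -/

section Parameters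

lemma one_le_fccExponent (κ μ : ℝ) : 1 ≤ fccExponent κ μ := le_max_left _ _

lemma le_fccExponent (κ μ : ℝ) : κ * (1 / μ) * Real.log (1 / μ) ≤ fccExponent κ μ := by
  rw [fccExponent, Nat.cast_max]
  exact (Nat.le_ceil _).trans (le_max_right _ _)

lemma fccExponent_le {μ : ℝ} (hμ : 0 < μ) (hμ1 : μ ≤ 1) :
    (fccExponent 97 μ : ℝ) ≤ 99 * (1 + Real.log (1 / μ)) / μ := by
  have hl : 0 ≤ Real.log (1 / μ) := Real.log_nonneg (by rwa [le_div_iff₀ hμ, one_mul])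
  have h0 : 0 ≤ 97 * (1 / μ) * Real.log (1 / μ) := by positivity
  have h1 := (Nat.ceil_lt_add_one h0).le
  have h2 : (1 : ℝ) ≤ 1 / μ := by rwa [le_div_iff₀ hμ, one_mul]
  have h3 : 99 * (1 + Real.log (1 / μ)) / μ =
      97 * (1 / μ) * Real.log (1 / μ) + 2 * (1 / μ) * Real.log (1 / μ) + 99 * (1 / μ) := by ring
  have h4 : 0 ≤ 2 * (1 / μ) * Real.log (1 / μ) := by positivity
  rw [fccExponent, Nat.cast_max, Nat.cast_one, h3]
  exact max_le (by linarith) (by linarith)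

lemma one_sub_le_log_inv {μ : ℝ} (hμ : 0 < μ) : 1 - μ ≤ Real.log (1 / μ) := by
  have := Real.log_le_sub_one_of_pos hμ
  rw [one_div, Real.log_inv]
  linarith

/-- The logarithm degenerates as $\mu\to1$, but there rounding up to 1 suffices; for $\mu<1/2$ the
logarithm is at least $1-\mu\ge1/2$. It makes the per-client noise $1/p$ of order $\mu$. -/
lemma one_le_two_mul_fccExponent {μ : ℝ} (hμ : 0 < μ) : 1 ≤ 2 * μ * fccExponent 97 μ := by
  have h1 : (1 : ℝ) ≤ fccExponent 97 μ := by exact_mod_cast one_le_fccExponent 97 μ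
  have h2 := mul_le_mul_of_nonneg_left (le_fccExponent 97 μ) hμ.le
  have h3 : μ * (97 * (1 / μ) * Real.log (1 / μ)) = 97 * Real.log (1 / μ) := by field_simp
  have h4 := one_sub_le_log_inv hμ
  rcases le_or_gt (1 / 2) μ with h | h
  · nlinarith
  · linarith

/-- The fast communication module contracts strongly enough for error feedback. -/
lemma fcc_contraction_le {μ : ℝ} (hμ : 0 < μ) (hμ1 : μ ≤ 1) :
    96 * ((1 - μ) ^ fccExponent 97 μ * (1 - μ)) ≤ μ ^ 2 := by
  have h1 : (1 - μ) ^ fccExponent 97 μ ≤ μ ^ 97 := by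
    calc (1 - μ) ^ fccExponent 97 μ ≤ Real.exp (-μ) ^ fccExponent 97 μ :=
          pow_le_pow_left₀ (by linarith) (Real.one_sub_le_exp_neg μ) _
      _ = Real.exp (-(μ * fccExponent 97 μ)) := by rw [← Real.exp_nat_mul]; congr 1; ring
      _ ≤ Real.exp ((97 : ℕ) * Real.log μ) := by
          refine Real.exp_le_exp.2 ?_
          have h2 := mul_le_mul_of_nonneg_left (le_fccExponent 97 μ) hμ.le
          have h3 : μ * (97 * (1 / μ) * Real.log (1 / μ)) = -(97 * Real.log μ) := by
            rw [one_div, Real.log_inv]; field_simp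
          push_cast
          linarith
      _ = μ ^ 97 := by rw [Real.exp_nat_mul, Real.exp_log hμ]
  -- The exponent splits as $97=2+95$: a geometric sum of 96 terms, each at least $\mu^{95}$,
  -- absorbs the factor 96 uniformly in $\mu$.
  have h2 : 96 * μ ^ 95 * (1 - μ) ≤ 1 := by
    have hs : 96 * μ ^ 95 ≤ ∑ j ∈ Finset.range 96, μ ^ j := by
      have : ∑ _j ∈ Finset.range 96, μ ^ 95 ≤ ∑ j ∈ Finset.range 96, μ ^ j :=
        Finset.sum_le_sum fun j hj =>
          pow_le_pow_of_le_one hμ.le hμ1 (by have := Finset.mem_range.1 hj; omega)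
      simpa using this
    have hg := geom_sum_mul μ 96
    have hp : 0 ≤ μ ^ 96 := by positivity
    have := mul_le_mul_of_nonneg_right hs (show 0 ≤ 1 - μ by linarith)
    linarith
  have h3 : 0 ≤ 1 - μ := by linarith
  calc 96 * ((1 - μ) ^ fccExponent 97 μ * (1 - μ)) ≤ 96 * (μ ^ 97 * (1 - μ)) := by gcongr
    _ = μ ^ 2 * (96 * μ ^ 95 * (1 - μ)) := by ring
    _ ≤ μ ^ 2 * 1 := by gcongr
    _ = μ ^ 2 := mul_one _

set_option maxHeartbeats 1000000 in
/-- The total of the terms that bound the sum of the squared gradient norms. -/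
lemma error_budget_le {L s χ Δ Φ K ι μ ε η κ T p np : ℝ} (hL : 0 < L) (hs : 0 < s)
    (hΦ : 0 < Φ) (hK : 0 < K) (hι : 0 < ι) (hμ : 0 < μ) (hμ1 : μ ≤ 1) (hε : 0 < ε)
    (hη : 0 < η) (hκ : 0 < κ) (hT : 0 < T) (hp0 : 0 < p) (hnp : 0 < np)
    (hκ1 : κ ≤ 1) (hκ2 : κ * K ^ 3 ≤ Δ * L * √Φ) (hκ3 : 4423680 * s * (1 + ι) * κ ≤ Φ)
    (hκ4 : 61440 * (1 + ι) * κ ≤ 1) (hη1 : L * η * √Φ ≤ κ * (√μ * ε))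
    (hη2 : χ * L * η ≤ κ * (np * ε ^ 2)) (hLη : 8 * (L * η) ≤ 1) (hχ : s ≤ 2 * χ)
    (hp : 1 ≤ 2 * μ * p) (hT1 : 15360 * Δ ≤ T * (η * ε ^ 2))
    (hT2 : 15360 * (χ * ι) ≤ T * (np * ε ^ 2)) (hεK : ε ≤ K * √μ) :
    Δ + η * (8 * (12 * s / np) * ι) +
      L ^ 2 * η ^ 3 * (48 * Φ + 144 * (16 * (12 * s / p) * (T + 1 + ι))) / μ ^ 2 +
      (L * η ^ 2 + L ^ 2 * η ^ 3 / 2) * (16 * (12 * s / np) * (T + 1 + ι)) ≤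
      η / 16 * (ε ^ 2 * (T + 1)) := by
  -- The target $\eta\varepsilon^2(T+1)/16$ is split evenly over five terms, hence the share 1/80
  -- for each.
  have hsμ : 0 < √μ := Real.sqrt_pos.2 hμ
  have hsΦ : 0 < √Φ := Real.sqrt_pos.2 hΦ
  have hμsq : √μ ^ 2 = μ := Real.sq_sqrt hμ.le
  have hΦsq : √Φ ^ 2 = Φ := Real.sq_sqrt hΦ.le
  have hN : T + 1 + ι ≤ (1 + ι) * (T + 1) := by
    have : 0 ≤ ι * T := by positivity
    linarith
  have hηε : 0 < η * ε ^ 2 := by positivity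
  have hLΦ : L ^ 2 * η ^ 2 * Φ ≤ κ ^ 2 * (μ * ε ^ 2) := by
    have h := pow_le_pow_left₀ (by positivity) hη1 2
    calc L ^ 2 * η ^ 2 * Φ = (L * η * √Φ) ^ 2 := by rw [mul_pow, hΦsq]; ring
      _ ≤ _ := h
      _ = κ ^ 2 * (μ * ε ^ 2) := by rw [mul_pow, mul_pow, hμsq]
  -- the initial gap
  have g1 : Δ ≤ η * ε ^ 2 * (T + 1) / 80 := by
    have : 0 ≤ T * (η * ε ^ 2) := by positivity
    linarith
  -- the martingale
  have g2 : η * (8 * (12 * s / np) * ι) ≤ η * ε ^ 2 * (T + 1) / 80 := by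
    have h : s * ι / np ≤ T * ε ^ 2 / 7680 := by
      rw [div_le_div_iff₀ hnp (by norm_num)]
      have := mul_le_mul_of_nonneg_right hχ hι.le
      linarith
    have e : η * (8 * (12 * s / np) * ι) = η * (96 * (s * ι / np)) := by ring
    rw [e]
    have := mul_le_mul_of_nonneg_left h hη.le
    linarith
  -- the initial gradients
  have g3 : L ^ 2 * η ^ 3 * (48 * Φ) / μ ^ 2 ≤ η * ε ^ 2 * (T + 1) / 80 := by
    have hε3 : ε ^ 3 ≤ K ^ 3 * (√μ * μ) := by
      calc ε ^ 3 ≤ (K * √μ) ^ 3 := pow_le_pow_left₀ hε.le hεK 3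
        _ = K ^ 3 * (√μ * √μ ^ 2) := by ring
        _ = _ := by rw [hμsq]
    -- `a1` and `a2` combine into $T\mu^2\ge15360$: the small step size forces a long horizon, and
    -- $\varepsilon\le K\sqrt\mu$ expresses it in $\mu$. The one-time cost of the initial gradients
    -- is thus spread over many iterations.
    have a1 : 15360 * (κ * K ^ 3) ≤ T * (κ * (√μ * ε) * ε ^ 2) := by
      calc 15360 * (κ * K ^ 3) ≤ 15360 * (Δ * L * √Φ) := by gcongr
        _ = 15360 * Δ * (L * √Φ) := by ring
        _ ≤ T * (η * ε ^ 2) * (L * √Φ) := by gcongr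
        _ = T * (L * η * √Φ * ε ^ 2) := by ring
        _ ≤ _ := by gcongr
    have a2 : T * (κ * (√μ * ε) * ε ^ 2) ≤ κ * K ^ 3 * (T * μ ^ 2) := by
      calc T * (κ * (√μ * ε) * ε ^ 2) = T * κ * √μ * ε ^ 3 := by ring
        _ ≤ T * κ * √μ * (K ^ 3 * (√μ * μ)) := by gcongr
        _ = κ * K ^ 3 * (T * (√μ ^ 2 * μ)) := by ring
        _ = _ := by rw [hμsq]; ring
    have a3 : 15360 ≤ T * μ ^ 2 := by
      have h : 0 < κ * K ^ 3 := by positivity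
      refine le_of_mul_le_mul_left ?_ h
      linarith
    have a4 : T * μ ^ 2 ≤ T * μ := by
      have : μ ^ 2 ≤ μ := pow_le_of_le_one hμ.le hμ1 two_ne_zero
      gcongr
    have hκsq : κ ^ 2 ≤ 1 := pow_le_one₀ hκ.le hκ1
    rw [div_le_iff₀ (by positivity)]
    calc L ^ 2 * η ^ 3 * (48 * Φ) = 48 * η * (L ^ 2 * η ^ 2 * Φ) := by ring
      _ ≤ 48 * η * (κ ^ 2 * (μ * ε ^ 2)) := by gcongr
      _ ≤ 48 * η * (1 * (μ * ε ^ 2)) := by gcongr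
      _ = η * ε ^ 2 * μ / 80 * 3840 := by ring
      _ ≤ η * ε ^ 2 * μ / 80 * (T * μ) := by gcongr; linarith
      _ ≤ η * ε ^ 2 * μ / 80 * ((T + 1) * μ) := by gcongr; linarith
      _ = _ := by ring
  -- the noise in the compression errors
  have g4 : L ^ 2 * η ^ 3 * (144 * (16 * (12 * s / p) * (T + 1 + ι))) / μ ^ 2 ≤
      η * ε ^ 2 * (T + 1) / 80 := by
    -- This factor $\mu$ and the $\mu$ in $L^2\eta^2\Phi\le\kappa^2\mu\varepsilon^2$ together cancel
    -- the $\mu^{-2}$ of the compression error.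
    have hip : 1 / p ≤ 2 * μ := by rwa [div_le_iff₀ hp0]
    have hκs : 55296 * s * (1 + ι) * κ ^ 2 ≤ Φ / 80 := by
      have : κ ^ 2 ≤ κ := pow_le_of_le_one hκ.le hκ1 two_ne_zero
      have h1 := mul_le_mul_of_nonneg_left this (show 0 ≤ 55296 * s * (1 + ι) by positivity)
      linarith
    rw [div_le_iff₀ (by positivity)]
    refine le_of_mul_le_mul_right ?_ hΦ
    calc L ^ 2 * η ^ 3 * (144 * (16 * (12 * s / p) * (T + 1 + ι))) * Φ
        = 27648 * η * s * (T + 1 + ι) * (1 / p) * (L ^ 2 * η ^ 2 * Φ) := by ring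
      _ ≤ 27648 * η * s * ((1 + ι) * (T + 1)) * (2 * μ) * (κ ^ 2 * (μ * ε ^ 2)) := by gcongr
      _ = η * ε ^ 2 * (T + 1) * μ ^ 2 * (55296 * s * (1 + ι) * κ ^ 2) := by ring
      _ ≤ η * ε ^ 2 * (T + 1) * μ ^ 2 * (Φ / 80) := by gcongr
      _ = _ := by ring
  -- the mean noise
  have g5 : (L * η ^ 2 + L ^ 2 * η ^ 3 / 2) * (16 * (12 * s / np) * (T + 1 + ι)) ≤
      η * ε ^ 2 * (T + 1) / 80 := by
    have h1 : L * η ^ 2 + L ^ 2 * η ^ 3 / 2 ≤ 2 * η * (L * η) := by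
      have := mul_le_mul_of_nonneg_left hLη (show 0 ≤ η * (L * η) by positivity)
      have h2 : 0 < η * (L * η) := by positivity
      linarith
    have h2 : L * η * s / np ≤ 2 * (κ * ε ^ 2) := by
      rw [div_le_iff₀ hnp]
      have := mul_le_mul_of_nonneg_left hχ (show 0 ≤ L * η by positivity)
      linarith
    calc (L * η ^ 2 + L ^ 2 * η ^ 3 / 2) * (16 * (12 * s / np) * (T + 1 + ι))
        ≤ 2 * η * (L * η) * (16 * (12 * s / np) * ((1 + ι) * (T + 1))) := by gcongr
      _ = 384 * η * (1 + ι) * (T + 1) * (L * η * s / np) := by ring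
      _ ≤ 384 * η * (1 + ι) * (T + 1) * (2 * (κ * ε ^ 2)) := by gcongr
      _ = η * ε ^ 2 * (T + 1) / 80 * (61440 * (1 + ι) * κ) := by ring
      _ ≤ η * ε ^ 2 * (T + 1) / 80 * 1 := by gcongr
      _ = _ := mul_one _
  rw [mul_add, add_div]
  linarith

set_option maxHeartbeats 1000000 in
/-- The bound for the number of rounds. -/
lemma rounds_le {L s χ Δ Φ K ι μ ε η c T p n ld Λ : ℝ} (hL : 0 < L) (hs : 0 < s) (hΔ : 0 < Δ)
    (hΦ : 0 < Φ) (hK : 0 < K) (hι : 0 < ι) (hμ : 0 < μ) (hμ1 : μ ≤ 1) (hε : 0 < ε)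
    (hc : 0 < c) (hn : 1 ≤ n) (hp0 : 1 ≤ p) (hχ0 : 0 < χ) (hχ : χ ≤ s * ld) (hld : 1 ≤ ld)
    (hΛ : 1 ≤ Λ) (hp : 1 ≤ 2 * μ * p) (hpΛ : p ≤ 99 * Λ / μ) (hεK : ε ≤ K * √μ)
    (hη : η = c / (1 + ι) * min (μ * ε / (L * √(μ * Φ + χ * ι / (n * p))))
      (n * p * ε ^ 2 / (χ * L)))
    (hT : T ≤ 15360 * max (Δ / (η * ε ^ 2)) (χ * ι / (n * p * ε ^ 2)) + 1) :
    T * (p + 1) ≤ 2 * (15360 * (Δ * L / c * (99 * (1 + Φ + 2 * s) + s) + s * K ^ 2) +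
      99 * K ^ 3) * (ld * (1 + ι) * Λ) ^ 2 *
        (1 / (n * ε ^ 4) + 1 / (μ ^ (3 / 2 : ℝ) * ε ^ 3)) := by
  have hsμ : 0 < √μ := Real.sqrt_pos.2 hμ
  have hμsq : √μ ^ 2 = μ := Real.sq_sqrt hμ.le
  have hsμ1 : √μ ≤ 1 := Real.sqrt_le_one.2 hμ1
  have hμ32 : μ ^ (3 / 2 : ℝ) = μ * √μ := by
    rw [Real.sqrt_eq_rpow, show (3 / 2 : ℝ) = 1 + 1 / 2 by norm_num, Real.rpow_add hμ,
      Real.rpow_one]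
  have hn0 : 0 < n := by linarith
  have hp1 : 0 < p := by linarith
  rw [hμ32]
  set X := 1 / (n * ε ^ 4) with hX
  set Y := 1 / (μ * √μ * ε ^ 3) with hY
  have hX0 : 0 < X := by positivity
  have hY0 : 0 < Y := by positivity
  set A := ld * (1 + ι) * Λ with hA
  have hι1 : 1 ≤ 1 + ι := by linarith
  have hli : 1 ≤ ld * (1 + ι) := one_le_mul_of_one_le_of_one_le hld hι1
  have hA1 : 1 ≤ A := one_le_mul_of_one_le_of_one_le hli hΛ
  have hldA : ld * (1 + ι) ≤ A := le_mul_of_one_le_right (by positivity) hΛ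
  have hιA : 1 + ι ≤ A := (le_mul_of_one_le_left (by positivity) hld).trans hldA
  have hlA : ld ≤ A := (le_mul_of_one_le_right (by positivity) hι1).trans hldA
  have hΛA : Λ ≤ A := le_mul_of_one_le_left (by positivity) hli
  have hAA : A ≤ A ^ 2 := le_self_pow₀ hA1 two_ne_zero
  set W := √(μ * Φ + χ * ι / (n * p)) with hW
  have hWpos : 0 < W := Real.sqrt_pos.2 (by positivity)
  have hη0 : 0 < η := by rw [hη]; positivity
  have hip : 1 / p ≤ 2 * μ := by rwa [div_le_iff₀ hp1]
  -- Both summands under the root are of order $\mu$, the second because $1/p\le2\mu$; this saves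
  -- $\sqrt\mu$ and leads to $\mu^{-1.5}$.
  have hWle : W ≤ √μ * (1 + Φ + 2 * s) * (ld * (1 + ι)) := by
    have h1 : χ * ι / (n * p) ≤ 2 * μ * (χ * ι) := by
      calc χ * ι / (n * p) = χ * ι * (1 / p) * (1 / n) := by field_simp
        _ ≤ χ * ι * (2 * μ) * 1 := by
            gcongr
            rwa [div_le_one hn0]
        _ = _ := by ring
    have h2 : χ * ι ≤ s * (ld * (1 + ι)) := by
      calc χ * ι ≤ s * ld * (1 + ι) := by gcongr; linarith
        _ = _ := by ring
    have h3 : Φ + 2 * (χ * ι) ≤ (Φ + 2 * s) * (ld * (1 + ι)) := by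
      have := le_mul_of_one_le_right hΦ.le hli
      linarith
    have h4 : √(Φ + 2 * (χ * ι)) ≤ 1 + (Φ + 2 * (χ * ι)) := by
      have h0 : 0 ≤ Φ + 2 * (χ * ι) := by positivity
      rw [Real.sqrt_le_left (by positivity)]
      linarith [sq_nonneg (Φ + 2 * (χ * ι))]
    calc W ≤ √(μ * (Φ + 2 * (χ * ι))) := Real.sqrt_le_sqrt (by linarith)
      _ = √μ * √(Φ + 2 * (χ * ι)) := Real.sqrt_mul hμ.le _
      _ ≤ √μ * ((1 + Φ + 2 * s) * (ld * (1 + ι))) := by gcongr; linarith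
      _ = _ := by ring
  -- The reciprocal of the minimum is at most the sum of the reciprocals, so the two branches can be
  -- costed separately.
  have hinv : 1 / η ≤ (1 + ι) / c * (L * W / (μ * ε) + χ * L / (n * p * ε ^ 2)) := by
    set a := μ * ε / (L * W) with ha
    set b := n * p * ε ^ 2 / (χ * L) with hb
    have ha0 : 0 < a := by positivity
    have hb0 : 0 < b := by positivity
    have hm : 1 / min a b ≤ 1 / a + 1 / b := by
      rcases min_choice a b with h | h <;> rw [h]
      · have : 0 < 1 / b := by positivity
        linarith
      · have : 0 < 1 / a := by positivity
        linarith
    have ea : 1 / a = L * W / (μ * ε) := by rw [ha, one_div_div]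
    have eb : 1 / b = χ * L / (n * p * ε ^ 2) := by rw [hb, one_div_div]
    calc 1 / η = (1 + ι) / c * (1 / min a b) := by
          rw [hη]; field_simp
      _ ≤ (1 + ι) / c * (1 / a + 1 / b) := by gcongr
      _ = _ := by rw [ea, eb]
  have hpA1 : p * (Δ / (η * ε ^ 2)) ≤ Δ * L / c * (99 * (1 + Φ + 2 * s) + s) * A ^ 2 * (X + Y) := by
    have t1 : p * W / (μ * ε ^ 3) ≤ 99 * (1 + Φ + 2 * s) * A * Y := by
      calc p * W / (μ * ε ^ 3)
          ≤ (99 * Λ / μ) * (√μ * (1 + Φ + 2 * s) * (ld * (1 + ι))) / (μ * ε ^ 3) := by gcongr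
        _ = 99 * (1 + Φ + 2 * s) * A * (√μ / (μ * μ * ε ^ 3)) := by rw [hA]; field_simp
        _ = 99 * (1 + Φ + 2 * s) * A * Y := by
            congr 1
            rw [hY, div_eq_div_iff (by positivity) (by positivity)]
            calc √μ * (μ * √μ * ε ^ 3) = μ * √μ ^ 2 * ε ^ 3 := by ring
              _ = _ := by rw [hμsq]; ring
    -- In this branch $p$ has cancelled: larger batches permit a proportionally larger step.
    have t2 : χ / (n * ε ^ 4) ≤ s * A * X := by
      calc χ / (n * ε ^ 4) = χ * X := by rw [hX]; ring
        _ ≤ s * A * X := by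
            refine mul_le_mul_of_nonneg_right (hχ.trans ?_) hX0.le
            gcongr
    calc p * (Δ / (η * ε ^ 2)) = p * Δ / ε ^ 2 * (1 / η) := by field_simp
      _ ≤ p * Δ / ε ^ 2 * ((1 + ι) / c * (L * W / (μ * ε) + χ * L / (n * p * ε ^ 2))) := by gcongr
      _ = Δ * L / c * (1 + ι) * (p * W / (μ * ε ^ 3) + χ / (n * ε ^ 4)) := by field_simp
      _ ≤ Δ * L / c * A * (99 * (1 + Φ + 2 * s) * A * Y + s * A * X) := by gcongr
      _ = Δ * L / c * A ^ 2 * (99 * (1 + Φ + 2 * s) * Y + s * X) := by ring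
      _ ≤ Δ * L / c * A ^ 2 * ((99 * (1 + Φ + 2 * s) + s) * (X + Y)) := by
          gcongr
          have h1 : 0 < s * Y := by positivity
          have h2 : 0 < (1 + Φ + 2 * s) * X := by positivity
          linarith
      _ = _ := by ring
  have hε2 : ε ^ 2 ≤ K ^ 2 := by
    have : ε ≤ K := hεK.trans (mul_le_of_le_one_right hK.le hsμ1)
    exact pow_le_pow_left₀ hε.le this 2
  have hpA2 : p * (χ * ι / (n * p * ε ^ 2)) ≤ s * K ^ 2 * A ^ 2 * (X + Y) := by
    calc p * (χ * ι / (n * p * ε ^ 2)) = χ * ι * ε ^ 2 * X := by rw [hX]; field_simp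
      _ ≤ s * ld * (1 + ι) * K ^ 2 * X := by gcongr; linarith
      _ = s * K ^ 2 * (ld * (1 + ι)) * X := by ring
      _ ≤ s * K ^ 2 * A ^ 2 * (X + Y) := by
          gcongr
          · exact hldA.trans hAA
          · linarith
  -- Rounding $T$ up costs one extra iteration of about $p$ queries. It is absorbed in the second
  -- rate term through $\varepsilon\le K\sqrt\mu$.
  have hp3 : p ≤ 99 * K ^ 3 * A ^ 2 * (X + Y) := by
    have h1 : 1 / μ ≤ K ^ 3 * Y := by
      rw [hY, mul_one_div, div_le_div_iff₀ hμ (by positivity)]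
      have h3 : ε ^ 3 ≤ K ^ 3 * √μ ^ 3 := by
        rw [← mul_pow]; exact pow_le_pow_left₀ hε.le hεK 3
      have h4 : √μ * √μ ^ 3 ≤ 1 := by
        rw [← pow_succ']
        exact pow_le_one₀ hsμ.le hsμ1
      calc 1 * (μ * √μ * ε ^ 3) ≤ 1 * (μ * √μ * (K ^ 3 * √μ ^ 3)) := by gcongr
        _ = K ^ 3 * μ * (√μ * √μ ^ 3) := by ring
        _ ≤ K ^ 3 * μ * 1 := by gcongr
        _ = K ^ 3 * μ := mul_one _
    calc p ≤ 99 * Λ / μ := hpΛ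
      _ = 99 * Λ * (1 / μ) := by ring
      _ ≤ 99 * A ^ 2 * (K ^ 3 * Y) := by
          gcongr
          exact hΛA.trans hAA
      _ ≤ 99 * A ^ 2 * (K ^ 3 * (X + Y)) := by gcongr; linarith
      _ = _ := by ring
  have hB1 : 0 < Δ / (η * ε ^ 2) := by positivity
  have hB2 : 0 < χ * ι / (n * p * ε ^ 2) := by positivity
  have hT' : T ≤ 15360 * (Δ / (η * ε ^ 2) + χ * ι / (n * p * ε ^ 2)) + 1 := by
    have : max (Δ / (η * ε ^ 2)) (χ * ι / (n * p * ε ^ 2)) ≤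
        Δ / (η * ε ^ 2) + χ * ι / (n * p * ε ^ 2) := max_le (by linarith) (by linarith)
    linarith
  calc T * (p + 1) ≤ (15360 * (Δ / (η * ε ^ 2) + χ * ι / (n * p * ε ^ 2)) + 1) * (2 * p) := by
        gcongr
        linarith
    _ = 2 * (15360 * (p * (Δ / (η * ε ^ 2)) + p * (χ * ι / (n * p * ε ^ 2))) + p) := by ring
    _ ≤ 2 * (15360 * (Δ * L / c * (99 * (1 + Φ + 2 * s) + s) * A ^ 2 * (X + Y) +
          s * K ^ 2 * A ^ 2 * (X + Y)) + 99 * K ^ 3 * A ^ 2 * (X + Y)) := by gcongr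
    _ = _ := by ring

end Parameters

/-! ### Algebra of the run: errors, estimates and counters -/

section Algorithm

lemma gradient_globalObjective {n d : ℕ} {f : Fin n → Vec d → ℝ}
    (hf : ∀ i, Differentiable ℝ (f i)) (x : Vec d) :
    ∇ (globalObjective f) x = mean fun i => ∇ (f i) x := by
  refine HasGradientAt.gradient ?_
  rw [hasGradientAt_iff_hasFDerivAt]
  have h := (HasFDerivAt.fun_sum (u := Finset.univ) fun i _ =>
    (hf i x).hasGradientAt.hasFDerivAt).const_mul (1 / (n : ℝ))
  refine h.congr_fderiv ?_
  simp [mean]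

/-- Every call compresses the current remainder, so the contraction factors multiply. -/
lemma norm_sub_fccMessages_sum_sq_le {d : ℕ} {c : ℕ → Vec d → Vec d} {μ : ℝ} (hμ1 : μ ≤ 1)
    (hc : ∀ l x, ‖x - c l x‖ ^ 2 ≤ (1 - μ) * ‖x‖ ^ 2) (x : Vec d) (k : ℕ) :
    ‖x - (fccMessages c x k).sum‖ ^ 2 ≤ (1 - μ) ^ k * ‖x‖ ^ 2 := by
  induction k with
  | zero => simp [fccMessages]
  | succ k ih =>
    rw [fccMessages_sum_succ, ← sub_sub, pow_succ' (1 - μ), mul_assoc]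
    exact (hc k _).trans (mul_le_mul_of_nonneg_left ih (by linarith))

lemma length_fccMessages {d : ℕ} (c : ℕ → Vec d → Vec d) (x : Vec d) (k : ℕ) :
    (fccMessages c x k).length = k := by
  induction k with
  | zero => rfl
  | succ k ih => simp [fccMessages, ih]

variable {Ω : Type w} [mΩ : MeasurableSpace Ω] {P : Measure Ω} {S : Type u} [MeasurableSpace S]
  {n d : ℕ} {D : Fin n → Measure S} {U : Type v} [MeasurableSpace U] {ν : Measure U} {v : ℝ}
  (R : Randomness P D ν d v) (η : ℝ) (p : ℕ) (G : Fin n → Vec d → S → Vec d)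
  (C : U → Vec d → Vec d) (f : Fin n → Vec d → ℝ) (x₀ : Vec d) (ω : Ω)

lemma run_queries (i : Fin n) (t : ℕ) : (run R η p G C x₀ ω t).queries i = t * p := by
  induction t with
  | zero => simp [run, State.init]
  | succ t ih => simp [run, step, ih, add_mul]

lemma run_messages (i : Fin n) (t : ℕ) : (run R η p G C x₀ ω t).messages i = t * (p + 1) := by
  induction t with
  | zero => simp [run, State.init]
  | succ t ih => simp [run, step, ih, length_fccMessages, add_mul]

/-- The perturbed gradient estimate of client `i` in iteration `t`. -/
def clientEstimate (i : Fin n) (t : ℕ) : Vec d :=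
  (1 / (p : ℝ)) • ∑ j ∈ Finset.range p, G i (run R η p G C x₀ ω t).model (R.sample t i j ω) +
    R.xi t ω

lemma clientEstimate_eq (i : Fin n) (t : ℕ) : clientEstimate R η p G C x₀ ω i t =
    ∇ (f i) (run R η p G C x₀ ω t).model + clientNoise R η p G C f x₀ i t ω := by
  simp only [clientEstimate, clientNoise]
  abel

lemma run_errPrev (i : Fin n) (t : ℕ) : (run R η p G C x₀ ω t).errPrev i =
    prevTerm (fun s => (run R η p G C x₀ ω s).err i) t := by
  cases t <;> rfl

lemma run_err_succ (i : Fin n) (t : ℕ) : (run R η p G C x₀ ω (t + 1)).err i =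
    (run R η p G C x₀ ω t).err i + clientEstimate R η p G C x₀ ω i t -
      (run R η p G C x₀ ω (t + 1)).est i := by
  simp only [run, step, clientEstimate, sum_map_range]
  abel

/-- Solves the error update for the estimate. Substituting it into the compressor input turns $a_t$
into the increment $a_t-a_{t-1}$. -/
lemma run_est (i : Fin n) (t : ℕ) : (run R η p G C x₀ ω t).est i =
    prevTerm (fun s => (run R η p G C x₀ ω s).err i) t +
      prevTerm (clientEstimate R η p G C x₀ ω i) t - (run R η p G C x₀ ω t).err i := by
  cases t with
  | zero => simp [run, State.init, prevTerm]
  | succ t =>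
    rw [run_err_succ]
    simp only [prevTerm]
    abel

lemma run_serverEst (t : ℕ) : (run R η p G C x₀ ω t).serverEst =
    mean fun i => (run R η p G C x₀ ω t).est i := by
  induction t with
  | zero => simp [run, State.init, mean]
  | succ t ih =>
    simp only [run, step, List.sum_append, List.sum_singleton]
    rw [ih]
    simp only [mean, ← smul_add, ← Finset.sum_add_distrib, add_assoc]

lemma run_model_succ (t : ℕ) : (run R η p G C x₀ ω (t + 1)).model =
    (run R η p G C x₀ ω t).model - η • mean fun i => (run R η p G C x₀ ω t).err i +
      clientEstimate R η p G C x₀ ω i t - (run R η p G C x₀ ω (t + 1)).err i := by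
  have h : (run R η p G C x₀ ω (t + 1)).model = (run R η p G C x₀ ω t).model -
      η • (run R η p G C x₀ ω (t + 1)).serverEst := rfl
  rw [h, run_serverEst]
  congr 3
  funext i
  rw [run_err_succ]
  abel

/-- The part of the last change of the error that is lost by the fast communication module. -/
def fccResidual (i : Fin n) (t : ℕ) : Vec d :=
  (run R η p G C x₀ ω t).err i - prevTerm (fun s => (run R η p G C x₀ ω s).err i) t -
    (fccMessages (fun l => C (R.seed t i l ω)) ((run R η p G C x₀ ω t).err i -
      prevTerm (fun s => (run R η p G C x₀ ω s).err i) t) p).sum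

variable {C ω} {μ : ℝ} (hμ1 : μ ≤ 1)
  (hC : ∀ t i l x, ‖x - C (R.seed t i l ω) x‖ ^ 2 ≤ (1 - μ) * ‖x‖ ^ 2)

include hC

/-- The new error is the compressor's residual on `u`; rewriting the previous estimate by `run_est`
exposes `u` as old error, increment and residual of the fast rounds. -/
lemma run_err_sq_le (i : Fin n) (t : ℕ) : ‖(run R η p G C x₀ ω (t + 1)).err i‖ ^ 2 ≤
    (1 - μ) * ‖(run R η p G C x₀ ω t).err i + (clientEstimate R η p G C x₀ ω i t -
      prevTerm (clientEstimate R η p G C x₀ ω i) t) + fccResidual R η p G C x₀ ω i t‖ ^ 2 := by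
  set u := (run R η p G C x₀ ω t).err i + (clientEstimate R η p G C x₀ ω i t -
      prevTerm (clientEstimate R η p G C x₀ ω i) t) + fccResidual R η p G C x₀ ω i t with hu
  have hu' : u = (run R η p G C x₀ ω t).err i + (1 / (p : ℝ)) • ((List.range p).map fun j =>
      G i (run R η p G C x₀ ω t).model (R.sample t i j ω)).sum + R.xi t ω -
      (run R η p G C x₀ ω t).est i - (fccMessages (fun l => C (R.seed t i l ω))
        ((run R η p G C x₀ ω t).err i - (run R η p G C x₀ ω t).errPrev i) p).sum := by
    rw [hu, run_est, run_errPrev, sum_map_range, fccResidual, clientEstimate]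
    abel
  have he : (run R η p G C x₀ ω (t + 1)).err i = u - C (R.seed t i p ω) u := by
    rw [hu']
    simp only [run, step]
    abel
  rw [he]
  exact hC t i p u

include hμ1

lemma norm_fccResidual_sq_le (i : Fin n) (t : ℕ) : ‖fccResidual R η p G C x₀ ω i t‖ ^ 2 ≤
    (1 - μ) ^ p * ‖(run R η p G C x₀ ω t).err i -
      prevTerm (fun s => (run R η p G C x₀ ω s).err i) t‖ ^ 2 :=
  norm_sub_fccMessages_sum_sq_le hμ1 (fun l x => hC t i l x) _ p

end Algorithm

/-! ### The high-probability statement and the choice of constants -/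

section Main

/-- High-probability convergence under explicit conditions on the parameters. -/
theorem measureReal_three_quarters_ge {L Lt s σ r Δ Φ ι μ ε η fmin : ℝ} {n d p T : ℕ}
    (hL : 0 < L) (hσ : 0 < σ) (hn : 0 < n) (hd : 0 < d) (hp : 0 < p)
    (hs : s = σ ^ 2 + r ^ 2) (hμ : 0 < μ) (hμ1 : μ ≤ 1) (hε : 0 < ε) (hη : 0 < η)
    (hq : 96 * ((1 - μ) ^ p * (1 - μ)) ≤ μ ^ 2) (hη1 : 8 * (L * η) ≤ 1)
    (hη2 : 864 * (Lt ^ 2 * η ^ 2) ≤ μ ^ 2)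
    (hbudget : Δ + η * (8 * (12 * s / (n * p)) * ι) +
      L ^ 2 * η ^ 3 * (48 * Φ + 144 * (16 * (12 * s / p) * (T + 1 + ι))) / μ ^ 2 +
      (L * η ^ 2 + L ^ 2 * η ^ 3 / 2) * (16 * (12 * s / (n * p)) * (T + 1 + ι)) ≤
      η / 16 * (ε ^ 2 * (T + 1)))
    {f : Fin n → Vec d → ℝ} {x₀ : Vec d}
    {S : Type u} [MeasurableSpace S] {D : Fin n → Measure S} [∀ i, IsProbabilityMeasure (D i)]
    {G : Fin n → Vec d → S → Vec d} {lip : Fin n → ℝ}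
    {U : Type v} [MeasurableSpace U] {ν : Measure U} {C : U → Vec d → Vec d}
    {Ω : Type w} [MeasurableSpace Ω] {P : Measure Ω} [IsProbabilityMeasure P]
    (R : Randomness P D ν d (r ^ 2 / (n * p * d)))
    (hmin : ∀ x, fmin ≤ globalObjective f x) (hF : IsSmooth (globalObjective f) L)
    (hf : ∀ i, Differentiable ℝ (f i))
    (hG : ∀ i, IsStochasticGradient (D i) (G i) (f i) (lip i) σ)
    (hLt : (1 / (n : ℝ)) * ∑ i, lip i ^ 2 ≤ Lt ^ 2) (hC : IsCompressor ν C μ)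
    (hΔ : globalObjective f x₀ - fmin ≤ Δ) (hΦ : meanSq (fun i => ∇ (f i) x₀) ≤ Φ) :
    1 - 3 * Real.exp (-ι) ≤ P.real {ω | (3 / 4 : ℝ) * (T + 1) ≤
      (Set.ncard {t : ℕ | t ≤ T ∧ IsFOSP (globalObjective f) ε
        (run R η p G C x₀ ω t).model} : ℝ)} := by
  have hn0 : (0 : ℝ) < n := by positivity
  have hp0 : (0 : ℝ) < p := by positivity
  have hd0 : (0 : ℝ) < d := by positivity
  have hn1 : (1 : ℝ) ≤ n := by exact_mod_cast hn
  have hs0 : 0 < s := by rw [hs]; positivity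
  have hσs : σ ^ 2 ≤ s := by rw [hs]; linarith [sq_nonneg r]
  -- The proxy uses $s=\sigma^2+r^2$ in place of $r^2$, so it is positive even without perturbation;
  -- its total over $d$ coordinates is $s/(np)$.
  have hτ : NormSubG (multivariateGaussian 0 ((r ^ 2 / (n * p * d)) •
      (1 : Matrix (Fin d) (Fin d) ℝ))) (fun x : Vec d => x) (6 * (d * (s / (n * p * d)))) := by
    refine normSubG_multivariateGaussian hd (by positivity) ?_ (by positivity)
    rw [hs]
    gcongr
    linarith [sq_nonneg σ]
  have hτe : 6 * (d * (s / (n * p * d))) = 6 * s / (n * p) := by field_simp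
  rw [hτe] at hτ
  have hΘ1 : 6 * s / (n * p) + 6 * σ ^ 2 / (n * p) ≤ 12 * s / (n * p) := by
    rw [← add_div]
    gcongr
    linarith
  have hΘ2 : 6 * s / (n * p) + 6 * σ ^ 2 / p ≤ 12 * s / p := by
    have h1 : 6 * s / (n * p) ≤ 6 * s / p := by
      refine div_le_div_of_nonneg_left (by positivity) hp0 ?_
      exact le_mul_of_one_le_left hp0.le hn1
    have h2 : 6 * σ ^ 2 / p ≤ 6 * s / p := by gcongr
    have h3 : 12 * s / p = 6 * s / p + 6 * s / p := by ring
    linarith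
  set F := globalObjective f with hFdef
  set y : ℕ → Ω → Vec d := fun t ω => (run R η p G C x₀ ω t).model -
    η • mean fun i => (run R η p G C x₀ ω t).err i with hy
  have hym : ∀ t, Measurable[R.sigma (history n t)] fun ω => -∇ F (y t ω) := by
    intro t
    have hrun := R.isMeasurable_run (η := η) (p := p) (fun i => (hG i).measurable)
      hC.measurable x₀ t
    have hsum : Measurable[R.sigma (history n t)] fun ω => ∑ i, (run R η p G C x₀ ω t).err i :=
      @Finset.measurable_fun_sum _ _ _ _ _ _ (R.sigma (history n t)) _ _ fun i _ => hrun.err i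
    have hyt : Measurable[R.sigma (history n t)] (y t) :=
      hrun.model.sub ((measurable_const_smul η).comp
        ((measurable_const_smul (1 / (n : ℝ))).comp hsum))
    have hg : Measurable fun x : Vec d => -∇ F x :=
      (continuous_of_norm_sub_le hF.2).measurable.neg
    exact hg.comp hyt
  -- The iterates $x_0,\dots,x_T$ number $T+1$, so the sums extend one iteration beyond the counted
  -- run.
  set N := T + 1 with hN
  set bad₁ := {ω | 8 * (12 * s / (n * p)) * ι + 1 / 4 *
    ∑ t ∈ Finset.range N, ‖-∇ F (y t ω)‖ ^ 2 ≤
      ∑ t ∈ Finset.range N, ⟪-∇ F (y t ω), meanNoise R η p G C f x₀ t ω⟫} with hbad₁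
  set bad₂ := {ω | 16 * (12 * s / (n * p)) * (N + ι) ≤
    ∑ t ∈ Finset.range N, ‖meanNoise R η p G C f x₀ t ω‖ ^ 2} with hbad₂
  set bad₃ := {ω | 16 * (12 * s / p) * (N + ι) ≤ ∑ t ∈ Finset.range N,
      (1 / (n : ℝ)) * ∑ i, ‖clientNoise R η p G C f x₀ i t ω‖ ^ 2} with hbad₃
  set good := {ω | ∀ t i l x, ‖x - C (R.seed t i l ω) x‖ ^ 2 ≤ (1 - μ) * ‖x‖ ^ 2} with hgood
  set ev := {ω | (3 / 4 : ℝ) * (T + 1) ≤ (Set.ncard {t : ℕ | t ≤ T ∧ IsFOSP F ε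
    (run R η p G C x₀ ω t).model} : ℝ)} with hev
  have h₁ : P bad₁ ≤ expE (-ι) :=
    measure_sum_inner_meanNoise hσ hG hC.measurable hτ hn hp hΘ1 hym N ι
  have h₂ : P bad₂ ≤ expE (-ι) :=
    measure_sum_norm_sq_meanNoise hσ hG hC.measurable hτ hn hp hΘ1 N ι
  have h₃ : P bad₃ ≤ expE (-ι) :=
    measure_sum_norm_sq_clientNoise hσ hG hC.measurable hτ hn hp hΘ2 N ι
  -- There are countably many seeds, and the contraction holds for all inputs at once; the
  -- adaptively chosen inputs are thus covered.
  have h₄ : P goodᶜ = 0 := by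
    have : ∀ᵐ ω ∂P, ∀ t i l x, ‖x - C (R.seed t i l ω) x‖ ^ 2 ≤ (1 - μ) * ‖x‖ ^ 2 := by
      simp only [ae_all_iff (ι := ℕ), ae_all_iff (ι := Fin n)]
      intro t i l
      have hlaw := R.seed_law t i l
      have h := hC.contraction
      rw [← hlaw.map_eq] at h
      exact ae_of_ae_map hlaw.aemeasurable h
    exact this
  have hsub : (Set.univ : Set Ω) ⊆ ev ∪ bad₁ ∪ bad₂ ∪ bad₃ ∪ goodᶜ := by
    intro ω _
    by_contra hω
    simp only [Set.mem_union, not_or, Set.mem_compl_iff, not_not] at hω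
    obtain ⟨⟨⟨⟨hωe, hω1⟩, hω2⟩, hω3⟩, hω4⟩ := hω
    simp only [hbad₁, Set.mem_ofPred_eq, not_le] at hω1
    replace hω1 := hω1.le
    simp only [hbad₂, Set.mem_ofPred_eq, not_le] at hω2
    replace hω2 := hω2.le
    simp only [hbad₃, Set.mem_ofPred_eq, not_le] at hω3
    replace hω3 := hω3.le
    refine hωe (three_quarters_le_ncard hε (fun t => (run R η p G C x₀ ω t).model) T ?_)
    have hmain := sum_norm_gradient_sq_le hn hF hL hmin
      (g := fun i => ∇ (f i)) (fun x => gradient_globalObjective hf x)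
      (fun i x y => (hG i).norm_gradient_sub_le hσ x y) hLt hμ hμ1 hq hη hη1 hη2
      (x := fun t => (run R η p G C x₀ ω t).model)
      (e := fun i t => (run R η p G C x₀ ω t).err i)
      (a := fun i t => clientEstimate R η p G C x₀ ω i t)
      (v := fun i t => clientNoise R η p G C f x₀ i t ω)
      (δ := fun i t => fccResidual R η p G C x₀ ω i t)
      (fun i t => clientEstimate_eq R η p G C f x₀ ω i t) (fun i => rfl)
      (fun i t => run_err_sq_le R η p G x₀ hω4 i t)
      (fun i t => norm_fccResidual_sq_le R η p G x₀ hμ1 hω4 i t)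
      (fun t => run_model_succ R η p G C x₀ ω t) (y := fun t => y t ω) (fun t => rfl)
      (Φ := Φ) hΦ N (m := 8 * (12 * s / (n * p)) * ι) hω1
    have hx0 : (run R η p G C x₀ ω 0).model = x₀ := rfl
    rw [hx0] at hmain
    have hV : ∑ t ∈ Finset.range N, meanSq (fun i => clientNoise R η p G C f x₀ i t ω) ≤
        16 * (12 * s / p) * (N + ι) := hω3
    have hZ : ∑ t ∈ Finset.range N, ‖mean fun i => clientNoise R η p G C f x₀ i t ω‖ ^ 2 ≤
        16 * (12 * s / (n * p)) * (N + ι) := hω2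
    have hNr : (N : ℝ) = T + 1 := by rw [hN]; push_cast; ring
    rw [hNr] at hV hZ
    have hV' : L ^ 2 * η ^ 3 * (48 * Φ + 144 * ∑ t ∈ Finset.range N,
        meanSq fun i => clientNoise R η p G C f x₀ i t ω) / μ ^ 2 ≤
        L ^ 2 * η ^ 3 * (48 * Φ + 144 * (16 * (12 * s / p) * (T + 1 + ι))) / μ ^ 2 := by
      gcongr
    have hZ' := mul_le_mul_of_nonneg_left hZ
      (show 0 ≤ L * η ^ 2 + L ^ 2 * η ^ 3 / 2 by positivity)
    refine le_of_mul_le_mul_left ?_ (show 0 < η / 16 by positivity)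
    refine le_trans ?_ hbudget
    refine le_trans (le_of_eq ?_) (hmain.trans ?_)
    · ring
    · linarith
  -- Only monotonicity and subadditivity are used, so the success event need not be shown
  -- measurable.
  have hP : 1 ≤ P ev + expE (-ι) + expE (-ι) + expE (-ι) := by
    calc (1 : ℝ≥0∞) = P Set.univ := measure_univ.symm
      _ ≤ P (ev ∪ bad₁ ∪ bad₂ ∪ bad₃ ∪ goodᶜ) := measure_mono hsub
      _ ≤ P (ev ∪ bad₁ ∪ bad₂ ∪ bad₃) + P goodᶜ := measure_union_le _ _
      _ ≤ P (ev ∪ bad₁ ∪ bad₂) + P bad₃ + P goodᶜ := by gcongr; exact measure_union_le _ _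
      _ ≤ P (ev ∪ bad₁) + P bad₂ + P bad₃ + P goodᶜ := by gcongr; exact measure_union_le _ _
      _ ≤ P ev + P bad₁ + P bad₂ + P bad₃ + P goodᶜ := by gcongr; exact measure_union_le _ _
      _ ≤ _ := by rw [h₄, add_zero]; gcongr
  have hPe : P ev = ENNReal.ofReal (P.real ev) := by simp
  rw [hPe, expE, ← ENNReal.ofReal_add measureReal_nonneg (Real.exp_nonneg _),
    ← ENNReal.ofReal_add (by positivity) (Real.exp_nonneg _),
    ← ENNReal.ofReal_add (by positivity) (Real.exp_nonneg _), ENNReal.one_le_ofReal] at hP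
  linarith

/-- Finitely many positive upper bounds leave room for a positive constant. -/
lemma exists_stepSize_constant {L Lt s Δ Φ K : ℝ} (hL : 0 < L) (hLt : 0 < Lt) (hs : 0 < s)
    (hΔ : 0 < Δ) (hΦ : 0 < Φ) (hK : 0 < K) : ∃ c : ℝ, 0 < c ∧ c ≤ 1 ∧
      c * K ^ 3 ≤ Δ * L * √Φ ∧ c * (4423680 * s) ≤ Φ ∧ c * 61440 ≤ 1 ∧ c * (8 * K) ≤ √Φ ∧
      c * (30 * Lt * K) ≤ L * √Φ := by
  have hsΦ : 0 < √Φ := Real.sqrt_pos.2 hΦ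
  refine ⟨min (1 / 61440) (min (Δ * L * √Φ / K ^ 3) (min (Φ / (4423680 * s))
    (min (√Φ / (8 * K)) (L * √Φ / (30 * Lt * K))))), by positivity, ?_, ?_, ?_, ?_, ?_, ?_⟩
  · exact (min_le_left _ _).trans (by norm_num)
  · exact (le_div_iff₀ (by positivity)).1 ((min_le_right _ _).trans (min_le_left _ _))
  · exact (le_div_iff₀ (by positivity)).1
      ((min_le_right _ _).trans ((min_le_right _ _).trans (min_le_left _ _)))
  · exact (le_div_iff₀ (by positivity)).1 (min_le_left _ _)
  · exact (le_div_iff₀ (by positivity)).1 ((min_le_right _ _).trans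
      ((min_le_right _ _).trans ((min_le_right _ _).trans (min_le_left _ _))))
  · exact (le_div_iff₀ (by positivity)).1 ((min_le_right _ _).trans
      ((min_le_right _ _).trans ((min_le_right _ _).trans (min_le_right _ _))))

/-- The conditions on the step size that the analysis needs. -/
lemma stepSize_bounds {L Lt Φ K ι μ ε η κ χ np : ℝ} (hL : 0 < L) (hLt : 0 < Lt) (hΦ : 0 < Φ)
    (hι : 0 < ι) (hμ : 0 < μ) (hε : 0 < ε) (hκ : 0 < κ) (hχ : 0 < χ)
    (hnp : 0 < np) (hεK : ε ≤ K * √μ) (hκ1 : κ * (8 * K) ≤ √Φ)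
    (hκ2 : κ * (30 * Lt * K) ≤ L * √Φ) (hμ1 : μ ≤ 1)
    (hη : η = κ * min (μ * ε / (L * √(μ * Φ + χ * ι / np))) (np * ε ^ 2 / (χ * L))) :
    0 < η ∧ L * η * √Φ ≤ κ * (√μ * ε) ∧ χ * L * η ≤ κ * (np * ε ^ 2) ∧ 8 * (L * η) ≤ 1 ∧
      864 * (Lt ^ 2 * η ^ 2) ≤ μ ^ 2 := by
  have hsμ : 0 < √μ := Real.sqrt_pos.2 hμ
  have hsΦ : 0 < √Φ := Real.sqrt_pos.2 hΦ
  have hμsq : √μ * √μ = μ := Real.mul_self_sqrt hμ.le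
  set W := √(μ * Φ + χ * ι / np) with hW
  have hW0 : 0 < W := Real.sqrt_pos.2 (by positivity)
  have hWge : √μ * √Φ ≤ W := by
    rw [← Real.sqrt_mul hμ.le]
    exact Real.sqrt_le_sqrt (le_add_of_nonneg_right (by positivity))
  have hη0 : 0 < η := by rw [hη]; positivity
  have h1 : L * η * √Φ ≤ κ * (√μ * ε) := by
    have t1 : η ≤ κ * (μ * ε / (L * W)) := by
      rw [hη]
      exact mul_le_mul_of_nonneg_left (min_le_left _ _) hκ.le
    rw [← mul_div_assoc, le_div_iff₀ (by positivity)] at t1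
    refine le_of_mul_le_mul_left ?_ hsμ
    calc √μ * (L * η * √Φ) = L * η * (√μ * √Φ) := by ring
      _ ≤ L * η * W := by gcongr
      _ = η * (L * W) := by ring
      _ ≤ κ * (μ * ε) := t1
      _ = κ * (√μ * √μ * ε) := by rw [hμsq]
      _ = _ := by ring
  have h2 : χ * L * η ≤ κ * (np * ε ^ 2) := by
    have t1 : η ≤ κ * (np * ε ^ 2 / (χ * L)) := by
      rw [hη]
      exact mul_le_mul_of_nonneg_left (min_le_right _ _) hκ.le
    rw [← mul_div_assoc, le_div_iff₀ (by positivity)] at t1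
    linarith
  have h3 : √μ * ε ≤ K * μ := by
    calc √μ * ε ≤ √μ * (K * √μ) := by gcongr
      _ = K * (√μ * √μ) := by ring
      _ = K * μ := by rw [hμsq]
  have h4 : L * η * √Φ ≤ κ * (K * μ) := h1.trans (mul_le_mul_of_nonneg_left h3 hκ.le)
  have h5 : 8 * (L * η) ≤ 1 := by
    refine le_of_mul_le_mul_right ?_ hsΦ
    have t1 := mul_le_mul_of_nonneg_right hκ1 hμ.le
    have t2 : √Φ * μ ≤ √Φ := mul_le_of_le_one_right hsΦ.le hμ1
    linarith
  -- Squaring gives 900, which dominates the required 864.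
  have h6 : 30 * Lt * η ≤ μ := by
    refine le_of_mul_le_mul_right ?_ (show 0 < L * √Φ by positivity)
    have t1 := mul_le_mul_of_nonneg_right hκ2 hμ.le
    have t2 := mul_le_mul_of_nonneg_left h4 (show 0 ≤ 30 * Lt by positivity)
    linarith
  refine ⟨hη0, h1, h2, h5, ?_⟩
  have t := pow_le_pow_left₀ (by positivity) h6 2
  have t2 : 0 ≤ Lt ^ 2 * η ^ 2 := by positivity
  linarith

end Main

end PowerEF

end

/-! ### Assembly of the result -/

theorem corollary1 :
    -- a universal exponent for the polylogarithmic factor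
    ∃ k : ℕ,
    -- problem constants
    ∀ L Lt σ r Δ Φ K : ℝ, 0 < L → 0 < Lt → 0 < σ → 0 ≤ r → 0 < Δ → 0 < Φ → 0 < K →
    ∃ M : ℝ, 0 < M ∧
    ∀ (d : ℕ) (ι : ℝ), 2 ≤ d → 0 < ι →
    -- the constants of the parameter choice do not depend on `n`, `μ`, `ε`
    ∃ κT κη κp : ℝ, 0 < κT ∧ 0 < κη ∧ 0 < κp ∧
    ∀ (n : ℕ) (μ ε : ℝ), 1 ≤ n → 0 < μ → μ ≤ 1 → 0 < ε → ε ≤ K * √μ →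
    ∀ (χsq η B : ℝ) (p T : ℕ),
      χsq = PowerEF.effectiveVariance σ r d →
      p = PowerEF.fccExponent κp μ →
      η = PowerEF.stepSize κη L Φ χsq ι μ ε n p →
      T = PowerEF.horizon κT Δ η χsq ι ε n p →
      B = M * ((1 + Real.log d) * (1 + ι) * (1 + Real.log (1 / μ))) ^ k *
        (1 / (n * ε ^ 4) + 1 / (μ ^ (3 / 2 : ℝ) * ε ^ 3)) →
    -- an arbitrary instance
    ∀ (f : Fin n → PowerEF.Vec d → ℝ) (fmin : ℝ) (x₀ : PowerEF.Vec d)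
      {S : Type u} [MeasurableSpace S] (D : Fin n → Measure S) [∀ i, IsProbabilityMeasure (D i)]
      (G : Fin n → PowerEF.Vec d → S → PowerEF.Vec d) (lip : Fin n → ℝ)
      {U : Type v} [MeasurableSpace U] (ν : Measure U) [IsProbabilityMeasure ν]
      (C : U → PowerEF.Vec d → PowerEF.Vec d)
      {Ω : Type w} [MeasurableSpace Ω] (P : Measure Ω) [IsProbabilityMeasure P]
      (R : PowerEF.Randomness P D ν d (r ^ 2 / (n * p * d))),
      (∀ x, fmin ≤ PowerEF.globalObjective f x) →
      PowerEF.IsSmooth (PowerEF.globalObjective f) L →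
      (∀ i, Differentiable ℝ (f i)) →
      (∀ i, PowerEF.IsStochasticGradient (D i) (G i) (f i) (lip i) σ) →
      √((1 / (n : ℝ)) * ∑ i, lip i ^ 2) ≤ Lt →
      PowerEF.IsCompressor ν C μ →
      PowerEF.globalObjective f x₀ - fmin ≤ Δ →
      (1 / (n : ℝ)) * ∑ i, ‖∇ (f i) x₀‖ ^ 2 +
        Lt * (PowerEF.globalObjective f x₀ - fmin) ≤ Φ →
    -- at least 3/4 of the iterates are `ε`-FOSPs with high probability
    1 - 7 * Real.exp (-ι) ≤
      P.real {ω | (3 / 4 : ℝ) * (T + 1) ≤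
        (Set.ncard {t : ℕ | t ≤ T ∧ PowerEF.IsFOSP (PowerEF.globalObjective f) ε
          (PowerEF.run R η p G C x₀ ω t).model} : ℝ)} ∧
    -- number of queries and of compressed messages of each client in the whole run
    ∀ (ω : Ω) (i : Fin n),
      ((PowerEF.run R η p G C x₀ ω T).queries i : ℝ) ≤ B ∧
      ((PowerEF.run R η p G C x₀ ω T).messages i : ℝ) ≤ B := by
  refine ⟨2, ?_⟩
  intro L Lt σ r Δ Φ K hL hLt hσ hr hΔ hΦ hK
  have hs : 0 < σ ^ 2 + r ^ 2 := by positivity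
  obtain ⟨c, hc, hc1, hc2, hc3, hc4, hc5, hc6⟩ :=
    PowerEF.exists_stepSize_constant hL hLt hs hΔ hΦ hK
  refine ⟨2 * (15360 * (Δ * L / c * (99 * (1 + Φ + 2 * (σ ^ 2 + r ^ 2)) + (σ ^ 2 + r ^ 2)) +
    (σ ^ 2 + r ^ 2) * K ^ 2) + 99 * K ^ 3), by positivity, ?_⟩
  intro d ι hd hι
  -- $15360=80\cdot192$ comes from the martingale term. Dividing by $1+\iota$ pays for
  -- $T+1+\iota\le(1+\iota)(T+1)$ in the noise sums, and keeps $c$ free of $d$ and $\iota$.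
  refine ⟨15360, c / (1 + ι), 97, by norm_num, by positivity, by norm_num, ?_⟩
  intro n μ ε hn hμ hμ1 hε hεK χ η B p T hχ hp hη hT hB f fmin x₀ S _ D _ G lip U _ ν _ C Ω _ P _ R
    hmin hF hf hG hlip hC hgap hinit
  set s := σ ^ 2 + r ^ 2 with hsdef
  set κ := c / (1 + ι) with hκdef
  have hκ : 0 < κ := by positivity
  have hκc : κ ≤ c := div_le_self hc.le (by linarith)
  have hκι : κ * (1 + ι) = c := div_mul_cancel₀ c (by positivity)
  -- Here $d\ge2$ matters: it makes $\chi^2$ comparable from below with $\sigma^2+r^2$, the variance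
  -- in the dimension-free noise bounds.
  have hld : 1 / 2 ≤ Real.log d := by
    have h1 : Real.log 2 ≤ Real.log d := Real.log_le_log (by norm_num) (by exact_mod_cast hd)
    have h2 := Real.log_two_gt_d9
    linarith
  have hχs : s ≤ 2 * χ := by
    rw [hχ, PowerEF.effectiveVariance, hsdef]
    linarith [mul_le_mul_of_nonneg_left hld (sq_nonneg σ), sq_nonneg r]
  have hχld : χ ≤ s * (1 + Real.log d) := by
    rw [hχ, PowerEF.effectiveVariance, hsdef]
    linarith [sq_nonneg σ, mul_nonneg (sq_nonneg r) (by linarith : 0 ≤ Real.log d)]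
  have hχ0 : 0 < χ := by linarith
  have hp1 : 1 ≤ p := hp ▸ PowerEF.one_le_fccExponent 97 μ
  have hpμ : 1 ≤ 2 * μ * p := hp ▸ PowerEF.one_le_two_mul_fccExponent hμ
  have hq : 96 * ((1 - μ) ^ p * (1 - μ)) ≤ μ ^ 2 := hp ▸ PowerEF.fcc_contraction_le hμ hμ1
  have hpΛ : (p : ℝ) ≤ 99 * (1 + Real.log (1 / μ)) / μ := hp ▸ PowerEF.fccExponent_le hμ hμ1
  have hΛ : 1 ≤ 1 + Real.log (1 / μ) := by
    have := PowerEF.one_sub_le_log_inv hμ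
    linarith
  have hn1 : (1 : ℝ) ≤ n := by exact_mod_cast hn
  have hn0 : (0 : ℝ) < n := by linarith
  have hp1' : (1 : ℝ) ≤ p := by exact_mod_cast hp1
  have hp0 : (0 : ℝ) < p := by linarith
  obtain ⟨hη0, hη1, hη2, hη3, hη4⟩ := PowerEF.stepSize_bounds (K := K) hL hLt hΦ hι hμ hε hκ hχ0
    (mul_pos hn0 hp0) hεK ((mul_le_mul_of_nonneg_right hκc (by positivity)).trans hc5)
    ((mul_le_mul_of_nonneg_right hκc (by positivity)).trans hc6) hμ1 hη
  have hmax1 : Δ / (η * ε ^ 2) ≤ max (Δ / (η * ε ^ 2)) (χ * ι / (n * p * ε ^ 2)) :=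
    le_max_left _ _
  have hmax2 : χ * ι / (n * p * ε ^ 2) ≤ max (Δ / (η * ε ^ 2)) (χ * ι / (n * p * ε ^ 2)) :=
    le_max_right _ _
  have hmaxpos : 0 < Δ / (η * ε ^ 2) := by positivity
  have hTge : 15360 * max (Δ / (η * ε ^ 2)) (χ * ι / (n * p * ε ^ 2)) ≤ T := hT ▸ Nat.le_ceil _
  have hTle : (T : ℝ) ≤ 15360 * max (Δ / (η * ε ^ 2)) (χ * ι / (n * p * ε ^ 2)) + 1 :=
    hT ▸ (Nat.ceil_lt_add_one (mul_nonneg (by norm_num) (hmaxpos.le.trans hmax1))).le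
  have hT0 : (0 : ℝ) < T := by linarith
  have hT1 : 15360 * Δ ≤ T * (η * ε ^ 2) := by
    rw [← div_le_iff₀ (by positivity), mul_div_assoc]
    linarith
  have hT2 : 15360 * (χ * ι) ≤ T * (n * p * ε ^ 2) := by
    rw [← div_le_iff₀ (by positivity), mul_div_assoc]
    linarith
  have hbudget := PowerEF.error_budget_le hL hs hΦ hK hι hμ hμ1 hε hη0 hκ hT0 hp0
    (mul_pos hn0 hp0) (hκc.trans hc1)
    ((mul_le_mul_of_nonneg_right hκc (by positivity)).trans hc2)
    (by rw [mul_assoc, mul_comm (1 + ι), hκι]; linarith)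
    (by rw [mul_assoc, mul_comm (1 + ι), hκι]; linarith) hη1 hη2 hη3 hχs hpμ hT1 hT2 hεK
  have hrounds : (T : ℝ) * (p + 1) ≤ B := by
    rw [hB]
    exact PowerEF.rounds_le hL hs hΔ hΦ hK hι hμ hμ1 hε hc hn1 hp1' hχ0 hχld (by linarith) hΛ hpμ
      hpΛ hεK hη hTle
  refine ⟨?_, fun ω i => ⟨?_, ?_⟩⟩
  · have hgap0 : 0 ≤ Lt * (PowerEF.globalObjective f x₀ - fmin) :=
      mul_nonneg hLt.le (sub_nonneg.2 (hmin x₀))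
    have h := PowerEF.measureReal_three_quarters_ge (T := T) hL hσ hn (by omega) hp1 hsdef hμ hμ1
      hε hη0 hq hη3 hη4 hbudget R hmin hF hf hG ((Real.sqrt_le_left hLt.le).1 hlip) hC hgap
      (by unfold PowerEF.meanSq; linarith)
    have := Real.exp_pos (-ι)
    linarith
  · rw [PowerEF.run_queries]
    push_cast
    exact (mul_le_mul_of_nonneg_left (by linarith) hT0.le).trans hrounds
  · rw [PowerEF.run_messages]
    push_cast
    exact hrounds
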